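/- **Notation.** Let $\mathbb F_q$ be a finite field with $q$ elements, $\mathbf A=\mathbb F_q[\theta]$, $k=\mathbb F_q(\theta)$, $k_\infty=\mathbb F_q((1/\theta))$, and let $\mathbb K$ be the completion of an algebraic closure of $k_\infty$; $\overline k$ and $k^{\mathrm{sep}}$ are the algebraic and the separable closure of $k$ in $\mathbb K$. Let $t$ be a variable independent of $\theta$, and for $n\in\mathbb Z$ let $f\mapsto f^{(n)}$ be the twist which raises the coefficients of $f\in\mathbb K((t))$ (or of a rational function in $\overline k(t)$) to the $q^n$-th power; matrices are twisted entrywise. Let $\partial_t^j$ be the $j$-th hyperderivative, $\partial_t^j(t^m)=\binom mj t^{m-j}$. Let $\mathbb T\subseteq\mathbb K[[t]]$ be the Tate algebra of power series whose coefficients tend to $0$. **$t$-motives.** Let $\overline k(t)[\sigma,\sigma^{-1}]$ be the ring with $\sigma f=f^{(-1)}\sigma$. A pre-$t$-motive is a left $\overline k(t)[\sigma,\sigma^{-1}]$-module which is finite-dimensional over $\overline k(t)$. An $\mathbf A$-finite dual $t$-motive is a left $\overline k[t,\sigma]$-module $\mathcal M$ which is free and finitely generated both over $\overline k[\sigma]$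 and over $\overline k[t]$ and satisfies $(t-\theta)^s\mathcal M\subseteq\sigma\mathcal M$ for some $s$; it is rigid analytically trivial if for the matrix $\Phi$ with $\sigma \boldsymbol m=\Phi \boldsymbol m$, where $\boldsymbol m$ is a $\overline k[t]$-basis, there is $\Psi\in\mathrm{GL}(\mathbb T)$ with $\Psi^{(-1)}=\Phi\Psi$. The category $\mathcal T$ of $t$-motives is the strictly full Tannakian subcategory of (rigid analytically trivial) pre-$t$-motives generated by the $\overline k(t)\otimes_{\overline k[t]}\mathcal M$ with $\mathcal M$ a rigid analytically trivial $\mathbf A$-finite dual $t$-motive, i.e. the smallest full subcategory which contains these and the unit object and is closed under finite direct sums, subobjects, quotients, tensor products, duals and isomorphisms. The unit object $\mathbf 1$ is $\overline k(t)$ with $\sigma f=f^{(-1)}$. **The Drinfeld module.** Let $\rho$ be a Drinfeld $\mathbf A$-module of rank $r\ge1$ over $k^{\mathrm{sep}}$, $\rho_t=\theta+\kappa_1\tau+\dots+\kappa_r\tau^r$ with $\kappa_i\in k^{\mathrm{sep}}$ and $\kappa_r\ne0$. Let $\mathrm{Exp}_\rho(z)=z+\sum_{h\ge1}a_hz^{q^h}$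 be its exponential function, determined by $\mathrm{Exp}_\rho(\theta z)=\theta\,\mathrm{Exp}_\rho(z)+\sum_{j=1}^r\kappa_j\mathrm{Exp}_\rho(z)^{q^j}$, and let $\Lambda_\rho\subseteq\mathbb K$ be its kernel, with $\mathbf A$-basis $\lambda_1,\dots,\lambda_r$. Put $\mathrm{End}(\rho)=\{c\in\mathbb K: c\Lambda_\rho\subseteq\Lambda_\rho\}$, let $K_\rho\subseteq\mathbb K$ be its fraction field and $\boldsymbol s=[K_\rho:k]$. Let $$\Phi_\rho=\begin{pmatrix}0&1&\cdots&0\\ \vdots&\vdots&\ddots&\vdots\\0&0&\cdots&1\\ (t-\theta)/\kappa_r^{(-r)}&-\kappa_1^{(-1)}/\kappa_r^{(-r)}&\cdots&-\kappa_{r-1}^{(-r+1)}/\kappa_r^{(-r)}\end{pmatrix}.$$ Let $M_\rho$ be the pre-$t$-motive with a $\overline k(t)$-basis $\boldsymbol m=(m_1,\dots,m_r)^{\mathsf T}$ such that $\sigma\boldsymbol m=\Phi_\rho\boldsymbol m$ (this is $\overline k(t)\otimes_{\overline k[t]}\mathcal M_\rho$ for the dual $t$-motive $\mathcal M_\rho=\overline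 k[\sigma]$ of $\rho$ and its basis $1,\sigma,\dots,\sigma^{r-1}$). For $n\ge1$ let $\mathrm P_nM_\rho$ be its $n$-th prolongation: it has the $\overline k(t)$-basis $\boldsymbol D_n\boldsymbol m=(D_n\boldsymbol m^{\mathsf T},D_{n-1}\boldsymbol m^{\mathsf T},\dots,D_0\boldsymbol m^{\mathsf T})^{\mathsf T}$, on which $\sigma$ acts through the block upper triangular matrix $\Phi_{\mathrm P_n\rho}$ with $(n+1)\times(n+1)$ blocks, whose block $(a,b)$ is $\partial_t^{b-a}(\Phi_\rho)$ for $a\le b$ and $0$ for $a>b$. For $\alpha\in k^{\mathrm{sep}}$ let $Y_{\alpha,n}$ be the pre-$t$-motive of dimension $(n+1)r+1$ on a basis of which $\sigma$ acts through $$\Phi_{\alpha,n}=\begin{pmatrix}\Phi_{\mathrm P_n\rho}&0\\(\alpha,0,\dots,0)&1\end{pmatrix};$$ it is an extension $0\to\mathrm P_nM_\rho\to Y_{\alpha,n}\to\mathbf 1\to0$. **Theorem.** Let $u_1,\dots,u_w\in\mathbb K$ be such that $\mathrm{Exp}_\rho(u_i)=\alpha_i\in k^{\mathrm{sep}}$ for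 $1\le i\le w$ and $$\dim_{K_\rho}\mathrm{Span}_{K_\rho}(\lambda_1,\dots,\lambda_r,u_1,\dots,u_w)=r/\boldsymbol s+w .$$ Let $n\ge1$ and $Y_{i,n}=Y_{\alpha_i,n}$. Then $M_\rho$, $\mathrm P_nM_\rho$ and $Y_{1,n},\dots,Y_{w,n}$ are $t$-motives, and for all $e_1,\dots,e_w\in\mathrm{End}_{\mathcal T}(M_\rho)$, not all zero, the Baer sum of pushouts $$\mathbf e_{1*}Y_{1,n}+\dots+\mathbf e_{w*}Y_{w,n}$$ is non-trivial in $\mathrm{Ext}^1_{\mathcal T}(\mathbf 1,\mathrm P_nM_\rho)$. Here, if $e_i(\boldsymbol m)=\mathrm E_i\boldsymbol m$ with $\mathrm E_i\in\mathrm{Mat}_r(\overline k(t))$, then $\mathbf e_i\in\mathrm{End}_{\mathcal T}(\mathrm P_nM_\rho)$ is the endomorphism with $\mathbf e_i(\boldsymbol D_n\boldsymbol m)=\mathbf E_i\boldsymbol D_n\boldsymbol m$, where $\mathbf E_i$ is the block matrix with $\mathrm E_i$ in the upper right corner and zeros elsewhere. -/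

import Mathlib

noncomputable section

open scoped NNReal WithZero Polynomial PowerSeries Matrix
open CategoryTheory

namespace DrinfeldProlongation

universe u

section Fields

variable (Fq : Type u) [Field Fq] [Fintype Fq]

/-- The field `k_∞ = F_q((1/θ))`; the variable of the Laurent series stands for `1/θ`. -/
abbrev KInf : Type u := LaurentSeries Fq

lemma one_lt_card : (1 : ℝ≥0) < (Fintype.card Fq : ℝ≥0) := by
  exact_mod_cast Fintype.one_lt_card

open MonoidWithZeroHom.ValueGroup₀ in
instance : Valuation.RankOne (Valued.v : Valuation (KInf Fq) ℤᵐ⁰) where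
  hom' := (WithZeroMulInt.toNNReal (one_pos.trans (one_lt_card Fq)).ne').comp embedding
  strictMono' := (WithZeroMulInt.toNNReal_strictMono (one_lt_card Fq)).comp embedding_strictMono
  exists_val_nontrivial := by
    obtain ⟨x, hx⟩ := LaurentSeries.valuation_surjective (K := Fq) (WithZero.exp 1)
    exact ⟨x, by rw [hx]; simp, by rw [hx]; simp⟩

/-- The absolute value on `k_∞` with `|1/θ| = 1/q`. -/
instance : NontriviallyNormedField (KInf Fq) := Valued.toNontriviallyNormedField (KInf Fq) ℤᵐ⁰

/-- An algebraic closure of `k_∞`. -/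
abbrev KInfAlg : Type u := AlgebraicClosure (KInf Fq)

instance : CompleteSpace (KInf Fq) := inferInstanceAs (CompleteSpace (LaurentSeries Fq))

/-- The unique extension of the absolute value of `k_∞` to its algebraic closure. -/
instance : NontriviallyNormedField (KInfAlg Fq) :=
  spectralNorm.nontriviallyNormedField (KInf Fq) (KInfAlg Fq)

/-- The field `𝕂`, the completion of an algebraic closure of `k_∞`. -/
def CInf : Type u := UniformSpace.Completion (KInfAlg Fq)

instance : NormedField (CInf Fq) :=
  inferInstanceAs (NormedField (UniformSpace.Completion (KInfAlg Fq)))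

instance : CompleteSpace (CInf Fq) :=
  inferInstanceAs (CompleteSpace (UniformSpace.Completion (KInfAlg Fq)))

/-- The inclusion of the algebraic closure of `k_∞` in `𝕂`. -/
def algToCInf : KInfAlg Fq →+* CInf Fq :=
  UniformSpace.Completion.coeRingHom (α := KInfAlg Fq)

/-- The inclusion `k_∞ → 𝕂`. -/
def toCInf : KInf Fq →+* CInf Fq :=
  (algToCInf Fq).comp (algebraMap (KInf Fq) (KInfAlg Fq))

instance : Algebra Fq (CInf Fq) := ((toCInf Fq).comp (algebraMap Fq (KInf Fq))).toAlgebra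

/-- The element `θ` of `𝕂`. -/
def theta : CInf Fq := toCInf Fq (HahnSeries.single (-1) 1)

/-- The number `q` of elements of the finite field. -/
abbrev q : ℕ := Fintype.card Fq

lemma pow_q_bijective : Function.Bijective (FiniteField.frobeniusAlgHom Fq (CInf Fq)) := by
  set f := FiniteField.frobeniusAlgHom Fq (CInf Fq) with hf
  have hfx : ∀ x, f x = x ^ q Fq := fun x => rfl
  have hq : q Fq ≠ 0 := Fintype.card_ne_zero
  refine ⟨f.toRingHom.injective, ?_⟩
  have hd : ∀ x y, dist (f x) (f y) = dist x y ^ q Fq := by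
    intro x y
    rw [dist_eq_norm, ← map_sub, hfx, norm_pow, dist_eq_norm]
  have hui : IsUniformInducing f := by
    rw [Metric.isUniformInducing_iff]
    constructor
    · rw [Metric.uniformContinuous_iff]
      intro ε hε
      refine ⟨min ε 1, by positivity, fun x y h => ?_⟩
      rw [hd]
      exact (pow_le_of_le_one dist_nonneg ((h.le.trans (min_le_right _ _))) hq).trans_lt
        (h.trans_le (min_le_left _ _))
    · intro δ hδ
      refine ⟨δ ^ q Fq, by positivity, fun {a b} h => ?_⟩
      rw [hd] at h
      exact lt_of_pow_lt_pow_left₀ _ hδ.le h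
  have hcl : IsClosed (Set.range f) := hui.isComplete_range.isClosed
  have hden : Dense (Set.range f) := by
    have h1 : DenseRange (algToCInf Fq) := UniformSpace.Completion.denseRange_coe
    refine Dense.mono ?_ h1
    rintro _ ⟨x, rfl⟩
    obtain ⟨z, hz⟩ := IsAlgClosed.exists_pow_nat_eq x (Nat.pos_of_ne_zero hq)
    exact ⟨algToCInf Fq z, by rw [hfx, ← map_pow, hz]⟩
  intro y
  have := hcl.closure_eq ▸ hden y
  exact this

/-- The automorphism `x ↦ x^q` of `𝕂`. -/
def frobC : CInf Fq ≃+* CInf Fq :=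
  RingEquiv.ofBijective (FiniteField.frobeniusAlgHom Fq (CInf Fq)).toRingHom (pow_q_bijective Fq)

/-- The field `k = F_q(θ)` inside `𝕂`. -/
abbrev ratField : IntermediateField Fq (CInf Fq) := IntermediateField.adjoin Fq {theta Fq}

/-- The ring `A = F_q[θ]` inside `𝕂`. -/
abbrev polyRing : Subalgebra Fq (CInf Fq) := Algebra.adjoin Fq {theta Fq}

/-- The algebraic closure `k̄` of `k` inside `𝕂`. -/
abbrev Kbar : IntermediateField (ratField Fq) (CInf Fq) :=
  algebraicClosure (ratField Fq) (CInf Fq)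

/-- The separable closure `k^sep` of `k` inside `𝕂`. -/
abbrev Ksep : IntermediateField (ratField Fq) (CInf Fq) :=
  separableClosure (ratField Fq) (CInf Fq)

lemma theta_mem : theta Fq ∈ Kbar Fq :=
  isIntegral_algebraMap (R := ratField Fq)
    (x := ⟨theta Fq, IntermediateField.mem_adjoin_simple_self Fq _⟩)

/-- `θ` as an element of `k̄`. -/
def thetaBar : Kbar Fq := ⟨theta Fq, theta_mem Fq⟩

lemma kbar_pow_q_bijective :
    Function.Bijective (FiniteField.frobeniusAlgHom Fq (Kbar Fq)) := by
  refine ⟨(FiniteField.frobeniusAlgHom Fq (Kbar Fq)).toRingHom.injective, fun x => ?_⟩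
  obtain ⟨y, hy⟩ := (pow_q_bijective Fq).2 x
  have hy' : y ^ q Fq = x := hy
  have : IsIntegral (ratField Fq) (y ^ q Fq) := hy' ▸ x.2
  exact ⟨⟨y, this.of_pow Fintype.card_pos⟩, Subtype.ext hy⟩

/-- The automorphism `x ↦ x^q` of `k̄`; its inverse is `c ↦ c^{(-1)}`. -/
def frobKbar : Kbar Fq ≃+* Kbar Fq :=
  RingEquiv.ofBijective (FiniteField.frobeniusAlgHom Fq (Kbar Fq)).toRingHom
    (kbar_pow_q_bijective Fq)

end Fields

section Twist

variable (Fq : Type u) [Field Fq] [Fintype Fq]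

/-- `f ↦ f^{(-1)}` on `k̄[t]`. -/
def polyUntwist : (Kbar Fq)[X] ≃+* (Kbar Fq)[X] := Polynomial.mapEquiv (frobKbar Fq).symm

/-- The field `k̄(t)`. -/
abbrev Kt : Type u := RatFunc (Kbar Fq)

/-- `f ↦ f^{(-1)}` on `k̄(t)`. -/
def untwist : Kt Fq ≃+* Kt Fq := IsFractionRing.ringEquivOfRingEquiv (polyUntwist Fq)

/-- `f ↦ f^{(-1)}` on `𝕂[[t]]`. -/
def powerSeriesUntwist : (CInf Fq)⟦X⟧ →+* (CInf Fq)⟦X⟧ :=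
  PowerSeries.map ((frobC Fq).symm : CInf Fq →+* CInf Fq)

/-- The inclusion `k̄[t] → 𝕂[[t]]`. -/
def polyToPowerSeries : (Kbar Fq)[X] →+* (CInf Fq)⟦X⟧ :=
  (Polynomial.coeToPowerSeries.ringHom).comp (Polynomial.mapRingHom (algebraMap (Kbar Fq) (CInf Fq)))

/-- Membership in the Tate algebra: the coefficients tend to zero. -/
def IsTate (f : (CInf Fq)⟦X⟧) : Prop :=
  Filter.Tendsto (fun m => ‖PowerSeries.coeff m f‖) Filter.atTop (nhds 0)

/-- The generator of `ℤ` acts on `k̄(t)` by `f ↦ f^{(-1)}`. -/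
instance : MulSemiringAction (Multiplicative ℤ) (Kt Fq) :=
  MulSemiringAction.compHom (Kt Fq) (zpowersHom (RingAut (Kt Fq)) (untwist Fq))

/-- The ring `k̄(t)[σ, σ⁻¹]` with `σ f = f^{(-1)} σ`, as a skew group ring of `ℤ`. -/
abbrev SigmaRing : Type u := SkewMonoidAlgebra (Kt Fq) (Multiplicative ℤ)

/-- `f ∈ k̄(t)` as an element of `k̄(t)[σ, σ⁻¹]`. -/
abbrev constS (f : Kt Fq) : SigmaRing Fq := SkewMonoidAlgebra.single 1 f
/-- The element `σ` of `k̄(t)[σ, σ⁻¹]`. -/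
abbrev sigmaS : SigmaRing Fq := SkewMonoidAlgebra.single (Multiplicative.ofAdd 1) 1

lemma sigmaS_mul_constS (f : Kt Fq) :
    sigmaS Fq * constS Fq f = constS Fq (untwist Fq f) * sigmaS Fq := by
  simp [SkewMonoidAlgebra.single_mul_single]
  rfl

end Twist


section MatrixModules

variable {Fq : Type u} [Field Fq] [Fintype Fq]
variable {ι κ : Type} [Fintype ι] [DecidableEq ι] [Fintype κ] [DecidableEq κ]

/-- The bijective additive map `x ↦ x^{(-1)} Φ` on row vectors over `k̄(t)`. -/
def sigmaUnit (Φ : GL ι (Kt Fq)) : (AddMonoid.End (ι → Kt Fq))ˣ where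
  val := AddMonoidHom.mk' (fun x => (untwist Fq ∘ x) ᵥ* Φ.val) (by
    intro x y
    rw [← Matrix.add_vecMul]
    congr 1
    funext i
    simp)
  inv := AddMonoidHom.mk' (fun y => (untwist Fq).symm ∘ (y ᵥ* (Φ⁻¹).val)) (by
    intro x y
    rw [Matrix.add_vecMul]
    funext i
    simp)
  val_inv := by
    ext y : 1
    change (untwist Fq ∘ ((untwist Fq).symm ∘ (y ᵥ* (Φ⁻¹).val))) ᵥ* Φ.val = y
    have : (untwist Fq ∘ ((untwist Fq).symm ∘ (y ᵥ* (Φ⁻¹).val))) = y ᵥ* (Φ⁻¹).val := by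
      funext i; simp
    rw [this, Matrix.vecMul_vecMul, ← Units.val_mul]
    simp
  inv_val := by
    ext x : 1
    change (untwist Fq).symm ∘ (((untwist Fq ∘ x) ᵥ* Φ.val) ᵥ* (Φ⁻¹).val) = x
    rw [Matrix.vecMul_vecMul, ← Units.val_mul]
    funext i
    simp

lemma sigmaUnit_smul (Φ : GL ι (Kt Fq)) (f : Kt Fq) (x : ι → Kt Fq) :
    (sigmaUnit Φ).val (f • x) = untwist Fq f • (sigmaUnit Φ).val x := by
  change (untwist Fq ∘ (f • x)) ᵥ* (Φ : Matrix ι ι (Kt Fq)) = _ • ((untwist Fq ∘ x) ᵥ* _)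
  rw [← Matrix.smul_vecMul]
  congr 1
  funext i
  simp

lemma sigmaUnit_inv_apply (Φ : GL ι (Kt Fq)) (x : ι → Kt Fq) :
    (sigmaUnit Φ).val ((sigmaUnit Φ)⁻¹.val x) = x :=
  DFunLike.congr_fun (sigmaUnit Φ).mul_inv x

lemma sigmaUnit_injective (Φ : GL ι (Kt Fq)) : Function.Injective (sigmaUnit Φ).val := by
  intro x y h
  have h1 : ∀ z, (sigmaUnit Φ)⁻¹.val ((sigmaUnit Φ).val z) = z :=
    fun z => DFunLike.congr_fun (sigmaUnit Φ).inv_mul z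
  rw [← h1 x, h, h1]

lemma sigmaUnit_zpow_smul (Φ : GL ι (Kt Fq)) (m : ℤ) (f : Kt Fq) (x : ι → Kt Fq) :
    (sigmaUnit Φ ^ m).val (f • x) =
      ((untwist Fq : RingAut (Kt Fq)) ^ m) f • (sigmaUnit Φ ^ m).val x := by
  induction m generalizing f x with
  | zero => simp
  | succ m ih =>
    rw [zpow_add_one, zpow_add_one]
    change (sigmaUnit Φ ^ (m : ℤ)).val ((sigmaUnit Φ).val (f • x)) = _
    rw [sigmaUnit_smul, ih]
    rfl
  | pred m ih =>
    rw [zpow_sub_one, zpow_sub_one]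
    change (sigmaUnit Φ ^ (-m : ℤ)).val ((sigmaUnit Φ)⁻¹.val (f • x)) = _
    have : (sigmaUnit Φ)⁻¹.val (f • x) = (untwist Fq).symm f • (sigmaUnit Φ)⁻¹.val x := by
      apply sigmaUnit_injective Φ
      rw [sigmaUnit_smul, sigmaUnit_inv_apply, sigmaUnit_inv_apply, RingEquiv.apply_symm_apply]
    rw [this, ih]
    rfl

/-- The powers of `x ↦ x^{(-1)} Φ`. -/
def sigmaPow (Φ : GL ι (Kt Fq)) : Multiplicative ℤ →* AddMonoid.End (ι → Kt Fq) :=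
  (Units.coeHom _).comp (zpowersHom _ (sigmaUnit Φ))

/-- The action of `k̄(t)[σ, σ⁻¹]` on row vectors for which `σ x = x^{(-1)} Φ`. -/
def sigmaRingAction (Φ : GL ι (Kt Fq)) : SigmaRing Fq →+* AddMonoid.End (ι → Kt Fq) :=
  SkewMonoidAlgebra.liftNCRingHom (Module.toAddMonoidEnd (Kt Fq) (ι → Kt Fq)) (sigmaPow Φ)
    (by
      intro f m
      ext x : 1
      exact (sigmaUnit_zpow_smul Φ m.toAdd f x).symm)

/-- The pre-`t`-motive with a `k̄(t)`-basis `m` (a column) on which `σ m = Φ m`: the element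
`x m` is written as the row vector `x`, so that `σ x = x^{(-1)} Φ`. -/
def MatMod (_Φ : GL ι (Kt Fq)) : Type u := ι → Kt Fq

instance (Φ : GL ι (Kt Fq)) : AddCommGroup (MatMod Φ) := inferInstanceAs (AddCommGroup (ι → Kt Fq))

instance (Φ : GL ι (Kt Fq)) : Module (SigmaRing Fq) (MatMod Φ) :=
  Module.compHom (ι → Kt Fq) (sigmaRingAction Φ)

lemma single_smul (Φ : GL ι (Kt Fq)) (m : ℤ) (f : Kt Fq) (x : MatMod Φ) :
    (SkewMonoidAlgebra.single (Multiplicative.ofAdd m) f : SigmaRing Fq) • x =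
      (f • (sigmaUnit Φ ^ m).val x : ι → Kt Fq) := by
  change sigmaRingAction Φ (SkewMonoidAlgebra.single (Multiplicative.ofAdd m) f) x = _
  simp [sigmaRingAction, SkewMonoidAlgebra.liftNCRingHom]
  rfl

lemma constS_smul (Φ : GL ι (Kt Fq)) (f : Kt Fq) (x : MatMod Φ) :
    constS Fq f • x = (fun i => f * x i : ι → Kt Fq) := by
  have := single_smul Φ 0 f x
  rw [zpow_zero] at this
  exact this

lemma sigmaS_smul (Φ : GL ι (Kt Fq)) (x : MatMod Φ) :
    sigmaS Fq • x = ((untwist Fq ∘ x) ᵥ* (Φ : Matrix ι ι (Kt Fq)) : ι → Kt Fq) := by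
  have := single_smul Φ 1 1 x
  rw [zpow_one, one_smul] at this
  exact this

/-- A matrix `B` with `B^{(-1)} Φ' = Φ B` as the morphism `x ↦ x B` of pre-`t`-motives. -/
def matMap (Φ : GL ι (Kt Fq)) (Φ' : GL κ (Kt Fq)) (B : Matrix ι κ (Kt Fq))
    (hB : B.map (untwist Fq) * Φ'.val = Φ.val * B) :
    MatMod Φ →ₗ[SigmaRing Fq] MatMod Φ' where
  toFun x := ((x : ι → Kt Fq) ᵥ* B : κ → Kt Fq)
  map_add' x y := Matrix.add_vecMul B x y
  map_smul' a x := by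
    have key : ∀ x : ι → Kt Fq,
        ((sigmaUnit Φ).val x) ᵥ* B = (sigmaUnit Φ').val (x ᵥ* B) := by
      intro x
      change ((untwist Fq ∘ x) ᵥ* Φ.val) ᵥ* B = (untwist Fq ∘ (x ᵥ* B)) ᵥ* Φ'.val
      have h2 : untwist Fq ∘ (x ᵥ* B) = (untwist Fq ∘ x) ᵥ* B.map (untwist Fq) := by
        funext j
        simp [Matrix.vecMul, dotProduct]
      rw [h2, Matrix.vecMul_vecMul, Matrix.vecMul_vecMul, hB]
    have keyz : ∀ (m : ℤ) (x : ι → Kt Fq),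
        ((sigmaUnit Φ ^ m).val x) ᵥ* B = (sigmaUnit Φ' ^ m).val (x ᵥ* B) := by
      intro m
      induction m with
      | zero => intro x; simp
      | succ m ih =>
        intro x
        rw [zpow_add_one, zpow_add_one]
        change ((sigmaUnit Φ ^ (m : ℤ)).val ((sigmaUnit Φ).val x)) ᵥ* B = _
        rw [ih, key]
        rfl
      | pred m ih =>
        intro x
        rw [zpow_sub_one, zpow_sub_one]
        change ((sigmaUnit Φ ^ (-m : ℤ)).val ((sigmaUnit Φ)⁻¹.val x)) ᵥ* B = _
        rw [ih]
        have : ((sigmaUnit Φ)⁻¹.val x) ᵥ* B = (sigmaUnit Φ')⁻¹.val (x ᵥ* B) := by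
          apply sigmaUnit_injective Φ'
          rw [← key, sigmaUnit_inv_apply, sigmaUnit_inv_apply]
        rw [this]
        rfl
    induction a using SkewMonoidAlgebra.induction_on with
    | zero =>
      refine (congrArg (fun y : ι → Kt Fq => y ᵥ* B) (zero_smul (SigmaRing Fq) x)).trans ?_
      exact (Matrix.zero_vecMul B).trans (zero_smul (SigmaRing Fq) (_ : MatMod Φ')).symm
    | single m f =>
      have := single_smul Φ m.toAdd f x
      have h2 := single_smul Φ' m.toAdd f ((x : ι → Kt Fq) ᵥ* B : κ → Kt Fq)
      simp only [RingHom.id_apply]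
      refine Eq.trans ?_ h2.symm
      refine (congrArg (fun y : ι → Kt Fq => y ᵥ* B) this).trans ?_
      exact (Matrix.smul_vecMul f _ B).trans (congrArg (f • ·) (keyz m.toAdd x))
    | add a b ha hb =>
      rw [RingHom.id_apply] at ha hb ⊢
      refine (congrArg (fun y : ι → Kt Fq => y ᵥ* B) (add_smul a b x)).trans ?_
      refine (Matrix.add_vecMul B _ _).trans ((congrArg₂ (· + ·) ha hb).trans ?_)
      exact (add_smul a b (_ : MatMod Φ')).symm

end MatrixModules

section TMotives

variable {Fq : Type u} [Field Fq] [Fintype Fq]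
variable {ι : Type} [Fintype ι] [DecidableEq ι]

/-- The action of `σ` on the free `k̄[t]`-module with basis `m` on which `σ m = Φ m`: the element
`x m` is written as the row vector `x`, so that `σ x = x^{(-1)} Φ`. -/
def polySigma (Φ : Matrix ι ι (Kbar Fq)[X]) (x : ι → (Kbar Fq)[X]) : ι → (Kbar Fq)[X] :=
  (polyUntwist Fq ∘ x) ᵥ* Φ

/-- The left `k̄[t, σ]`-module with a finite `k̄[t]`-basis on which `σ` acts through `Φ` is
an `A`-finite dual `t`-motive: it is free and finitely generated over `k̄[σ]`, that is,
there are finitely many elements `c j` such that the `σ^i (c j)` form a basis over `k̄`, and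
`(t - θ)^s` maps it into its image under `σ` for some `s`. -/
structure IsDualTMotive (Φ : Matrix ι ι (Kbar Fq)[X]) : Prop where
  free_finite : ∃ (e : ℕ) (c : Fin e → ι → (Kbar Fq)[X]),
    LinearIndependent (Kbar Fq) (fun p : ℕ × Fin e => (polySigma Φ)^[p.1] (c p.2)) ∧
    Submodule.span (Kbar Fq) (Set.range fun p : ℕ × Fin e => (polySigma Φ)^[p.1] (c p.2)) = ⊤
  exists_pow : ∃ s : ℕ, ∀ x : ι → (Kbar Fq)[X], ∃ y : ι → (Kbar Fq)[X],
    polySigma Φ y = (Polynomial.X - Polynomial.C (thetaBar Fq)) ^ s • x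

/-- Rigid analytic triviality: `Ψ^{(-1)} = Φ Ψ` for some invertible matrix `Ψ` over the
Tate algebra. -/
def IsRigidAnalyticallyTrivial (Φ : Matrix ι ι (Kbar Fq)[X]) : Prop :=
  ∃ Ψ Ψ' : Matrix ι ι (CInf Fq)⟦X⟧,
    (∀ i j, IsTate Fq (Ψ i j)) ∧ (∀ i j, IsTate Fq (Ψ' i j)) ∧ Ψ * Ψ' = 1 ∧ Ψ' * Ψ = 1 ∧
    Ψ.map (powerSeriesUntwist Fq) = Φ.map (polyToPowerSeries Fq) * Ψ

variable (Fq) in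
/-- The category of left `k̄(t)[σ, σ⁻¹]`-modules. Pre-`t`-motives are its objects which are
finite-dimensional over `k̄(t)`. -/
abbrev SigmaMod : Type (u + 1) := ModuleCat.{u} (SigmaRing Fq)

/-- The pre-`t`-motive with a basis `m` such that `σ m = Φ m`. -/
abbrev matObj (Φ : GL ι (Kt Fq)) : SigmaMod Fq := ModuleCat.of (SigmaRing Fq) (MatMod Φ)

/-- The matrix of `σ` on a tensor product, where `σ (x ⊗ y) = σ x ⊗ σ y`. -/
def tensorGL {κ : Type} [Fintype κ] [DecidableEq κ] (Φ : GL ι (Kt Fq)) (Φ' : GL κ (Kt Fq)) :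
    GL (ι × κ) (Kt Fq) where
  val := Matrix.kroneckerMap (· * ·) Φ.val Φ'.val
  inv := Matrix.kroneckerMap (· * ·) (Φ⁻¹).val (Φ'⁻¹).val
  val_inv := by
    rw [← Matrix.mul_kronecker_mul, ← Units.val_mul, ← Units.val_mul]
    simp
  inv_val := by
    rw [← Matrix.mul_kronecker_mul, ← Units.val_mul, ← Units.val_mul]
    simp

/-- The matrix of `σ` on the dual basis of the dual, where `(σ f) (σ x) = (f x)^{(-1)}`. -/
def dualGL (Φ : GL ι (Kt Fq)) : GL ι (Kt Fq) where
  val := ((Φ⁻¹).val)ᵀ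
  inv := (Φ.val)ᵀ
  val_inv := by
    rw [← Matrix.transpose_mul, ← Units.val_mul]
    simp
  inv_val := by
    rw [← Matrix.transpose_mul, ← Units.val_mul]
    simp

variable (Fq) in
/-- The unit object `1`: the vector space `k̄(t)` with `σ f = f^{(-1)}`. -/
abbrev unitObj : SigmaMod Fq := matObj (1 : GL Unit (Kt Fq))

variable (Fq) in
/-- The `t`-motives: the smallest class of left `k̄(t)[σ, σ⁻¹]`-modules which contains the
modules `k̄(t) ⊗ ℳ` for all rigid analytically trivial `A`-finite dual `t`-motives `ℳ`, contains
the unit object, and is stable under finite direct sums, subobjects, quotients (hence under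
isomorphisms), tensor products and duals. Every member is a rigid analytically trivial
pre-`t`-motive. -/
inductive IsTMotive : ObjectProperty (SigmaMod Fq)
  | of_dual {ι : Type} [Fintype ι] [DecidableEq ι] (Φ : Matrix ι ι (Kbar Fq)[X])
      (hΦ : IsDualTMotive Φ) (hrat : IsRigidAnalyticallyTrivial Φ) (G : GL ι (Kt Fq))
      (hG : G.val = Φ.map (algebraMap (Kbar Fq)[X] (Kt Fq))) : IsTMotive (matObj G)
  | unit : IsTMotive (unitObj Fq)
  | sum (M N : SigmaMod Fq) (hM : IsTMotive M) (hN : IsTMotive N) :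
      IsTMotive (ModuleCat.of (SigmaRing Fq) (M × N))
  | sub {M N : SigmaMod Fq} (f : M ⟶ N) (hf : Mono f) (hN : IsTMotive N) : IsTMotive M
  | quot {M N : SigmaMod Fq} (f : M ⟶ N) (hf : Epi f) (hM : IsTMotive M) : IsTMotive N
  | tensor {ι κ : Type} [Fintype ι] [DecidableEq ι] [Fintype κ] [DecidableEq κ]
      (Φ : GL ι (Kt Fq)) (Φ' : GL κ (Kt Fq)) (h : IsTMotive (matObj Φ))
      (h' : IsTMotive (matObj Φ')) : IsTMotive (matObj (tensorGL Φ Φ'))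
  | dual {ι : Type} [Fintype ι] [DecidableEq ι] (Φ : GL ι (Kt Fq))
      (h : IsTMotive (matObj Φ)) : IsTMotive (matObj (dualGL Φ))

instance : (IsTMotive Fq).IsClosedUnderSubobjects where
  prop_of_mono f hf hY := .sub f hf hY

instance : (IsTMotive Fq).IsClosedUnderQuotients where
  prop_of_epi f hf hX := .quot f hf hX

instance : (IsTMotive Fq).ContainsZero where
  exists_zero := ⟨ModuleCat.of (SigmaRing Fq) PUnit, ModuleCat.isZero_of_subsingleton _,
    .sub (0 : ModuleCat.of (SigmaRing Fq) PUnit ⟶ unitObj Fq)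
      ((ModuleCat.isZero_of_subsingleton _).mono _) .unit⟩

instance : (IsTMotive Fq).IsClosedUnderBinaryProducts where
  limitsOfShape_le := by
    rintro X ⟨p⟩
    let F := p.diag
    have e : X ≅ ModuleCat.of (SigmaRing Fq) (F.obj ⟨.left⟩ × F.obj ⟨.right⟩) :=
      p.isLimit.conePointUniqueUpToIso
        ((Limits.IsLimit.postcomposeInvEquiv (Limits.diagramIsoPair F) _).symm
          (ModuleCat.binaryProductLimitCone (F.obj ⟨.left⟩) (F.obj ⟨.right⟩)).isLimit)
    exact .sub e.hom inferInstance (.sum _ _ (p.prop_diag_obj _) (p.prop_diag_obj _))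

instance : (IsTMotive Fq).IsClosedUnderFiniteProducts :=
  ObjectProperty.IsClosedUnderFiniteProducts.mk'

variable (Fq) in
/-- The category of `t`-motives. -/
abbrev TMot : Type (u + 1) := (IsTMotive Fq).FullSubcategory

instance : HasExt.{u + 1} (TMot Fq) := HasExt.standard _

/-- A short complex of `t`-motives is short exact as soon as it is so on the modules. -/
lemma shortExact_of_modules (S : ShortComplex (TMot Fq))
    (hfg : Function.Exact S.f.hom.hom S.g.hom.hom)
    (hf : Function.Injective S.f.hom.hom) (hg : Function.Surjective S.g.hom.hom) :
    S.ShortExact := by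
  have h : (S.map (IsTMotive Fq).ι).ShortExact :=
    ModuleCat.shortComplex_shortExact _ hfg hf hg
  have : (IsTMotive Fq).ι.PreservesHomology :=
    { preservesKernels := (IsTMotive Fq).preservesKernels_ι
      preservesCokernels := (IsTMotive Fq).preservesCokernels_ι }
  exact
    { exact := (S.exact_map_iff_of_faithful (IsTMotive Fq).ι).1 h.exact
      mono_f := (IsTMotive Fq).ι.mono_of_mono_map h.mono_f
      epi_g := (IsTMotive Fq).ι.epi_of_epi_map h.epi_g }

end TMotives

section Drinfeld

variable (Fq : Type u) [Field Fq] [Fintype Fq]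

/-- A Drinfeld `A`-module `ρ` of rank `r ≥ 1` defined over `k^sep`, given by
`ρ_t = θ + κ_1 τ + ⋯ + κ_r τ^r` with `κ_r ≠ 0`. The entry `κ i` is the coefficient `κ_{i+1}`
of `τ^{i+1}`. -/
structure DrinfeldModule where
  rank : ℕ
  rank_pos : 0 < rank
  κ : Fin rank → Kbar Fq
  κ_sep : ∀ i, (κ i : CInf Fq) ∈ Ksep Fq
  κ_top : κ ⟨rank - 1, Nat.sub_lt rank_pos one_pos⟩ ≠ 0

variable {Fq}

namespace DrinfeldModule

variable (ρ : DrinfeldModule Fq)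

/-- The leading coefficient `κ_r`. -/
def lead : Kbar Fq := ρ.κ ⟨ρ.rank - 1, Nat.sub_lt ρ.rank_pos one_pos⟩

/-- The coefficients `α_h` of `Exp_ρ(z) = ∑ α_h z^{q^h}`. They are determined by `α_0 = 1` and
`Exp_ρ(θ z) = ρ_t(Exp_ρ(z))`, that is, by
`(θ^{q^{h+1}} - θ) α_{h+1} = ∑_{1 ≤ j ≤ min(r, h+1)} κ_j α_{h+1-j}^{q^j}`, with `j = i + 1`. -/
def expCoeff : ℕ → CInf Fq
  | 0 => 1
  | h + 1 => (theta Fq ^ q Fq ^ (h + 1) - theta Fq)⁻¹ *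
      ∑ i : Fin ρ.rank, if (i : ℕ) ≤ h then
        (ρ.κ i : CInf Fq) * expCoeff (h - i) ^ q Fq ^ ((i : ℕ) + 1) else 0

/-- The exponential function `Exp_ρ : 𝕂 → 𝕂`. -/
def Exp (z : CInf Fq) : CInf Fq := ∑' h : ℕ, ρ.expCoeff h * z ^ q Fq ^ h

/-- The period lattice `Λ_ρ`, the kernel of `Exp_ρ`. -/
def lattice : Set (CInf Fq) := {z | ρ.Exp z = 0}

/-- `ω_1, …, ω_r` is an `A`-basis of `Λ_ρ`. -/
def IsPeriodBasis (ω : Fin ρ.rank → CInf Fq) : Prop :=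
  LinearIndependent (polyRing Fq) ω ∧
    (Submodule.span (polyRing Fq) (Set.range ω) : Set (CInf Fq)) = ρ.lattice

/-- `End(ρ)`, identified with `{c ∈ 𝕂 ∣ c Λ_ρ ⊆ Λ_ρ}`. -/
def endSet : Set (CInf Fq) := {c | ∀ z ∈ ρ.lattice, c * z ∈ ρ.lattice}

/-- `K_ρ`, the fraction field of `End(ρ)`: since `End(ρ)` contains `A`, it is the subfield of `𝕂`
generated by `End(ρ)` over `k`. -/
abbrev endField : IntermediateField (ratField Fq) (CInf Fq) :=
  IntermediateField.adjoin (ratField Fq) ρ.endSet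

/-- The matrix `Φ_ρ` of `σ` on the dual `t`-motive `ℳ_ρ = k̄[σ]` in the `k̄[t]`-basis
`1, σ, …, σ^{r-1}`. It has the entries `1` above the diagonal and the last row
`(t - θ)/κ_r^{(-r)}, -κ_1^{(-1)}/κ_r^{(-r)}, …, -κ_{r-1}^{(-r+1)}/κ_r^{(-r)}`. -/
def phi : Matrix (Fin ρ.rank) (Fin ρ.rank) (Kbar Fq)[X] := fun i j =>
  if (i : ℕ) + 1 < ρ.rank then
    if (j : ℕ) = i + 1 then 1 else 0
  else if (j : ℕ) = 0 then
    (Polynomial.X - Polynomial.C (thetaBar Fq)) *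
      Polynomial.C (((frobKbar Fq).symm^[ρ.rank] ρ.lead)⁻¹)
  else
    Polynomial.C (-((frobKbar Fq).symm^[j] (ρ.κ ⟨j - 1, (Nat.sub_le _ _).trans_lt j.2⟩)) *
      ((frobKbar Fq).symm^[ρ.rank] ρ.lead)⁻¹)

end DrinfeldModule

/-- A square matrix over `k̄[t]` with nonzero determinant, over `k̄(t)`. -/
def toGL {ι : Type} [Fintype ι] [DecidableEq ι] (Φ : Matrix ι ι (Kbar Fq)[X])
    (h : Φ.det ≠ 0) : GL ι (Kt Fq) :=
  Matrix.GeneralLinearGroup.mkOfDetNeZero (Φ.map (algebraMap (Kbar Fq)[X] (Kt Fq))) (by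
    rw [← RingHom.mapMatrix_apply, ← RingHom.map_det]
    exact (map_ne_zero_iff _ (IsFractionRing.injective (Kbar Fq)[X] (Kt Fq))).2 h)

lemma toGL_val {ι : Type} [Fintype ι] [DecidableEq ι] (Φ : Matrix ι ι (Kbar Fq)[X])
    (h : Φ.det ≠ 0) : (toGL Φ h).val = Φ.map (algebraMap (Kbar Fq)[X] (Kt Fq)) := rfl

/-- The block matrix `d_{t,n+1}[Φ]`: for `a ≤ b` the block in position `(a, b)` is the entrywise
hyperderivative `∂_t^{b-a} Φ`, and the blocks with `a > b` vanish. If `Φ` gives `σ` in the basis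
`m` then `d_{t,n+1}[Φ]` gives `σ` on the `n`-th prolongation in the basis
`D_n m, D_{n-1} m, …, D_0 m`; the index `(a, i)` belongs to `D_{n-a} m_i`. -/
def dMatrix {ι : Type} (n : ℕ) (Φ : Matrix ι ι (Kbar Fq)[X]) :
    Matrix (Fin (n + 1) × ι) (Fin (n + 1) × ι) (Kbar Fq)[X] := fun x y =>
  if x.1 ≤ y.1 then Polynomial.hasseDeriv ((y.1 : ℕ) - x.1) (Φ x.2 y.2) else 0

lemma dMatrix_det_ne_zero {ι : Type} [Fintype ι] [DecidableEq ι] (n : ℕ)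
    (Φ : Matrix ι ι (Kbar Fq)[X]) (h : Φ.det ≠ 0) : (dMatrix n Φ).det ≠ 0 := by
  intro h0
  obtain ⟨v, hv, hv0⟩ := Matrix.exists_mulVec_eq_zero_iff.2 h0
  apply hv
  have key : ∀ m : ℕ, ∀ a : Fin (n + 1), n - a = m → ∀ i, v (a, i) = 0 := by
    intro m
    induction m using Nat.strong_induction_on with
    | _ m ih =>
      intro a ha
      have hz : Φ *ᵥ (fun i => v (a, i)) = 0 := by
        funext i
        have h1 := congrFun hv0 (a, i)
        rw [Matrix.mulVec, dotProduct, Fintype.sum_prod_type, Finset.sum_eq_single a] at h1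
        · simpa [dMatrix, Matrix.mulVec, dotProduct] using h1
        · intro b _ hb
          by_cases hab : a ≤ b
          · have : a < b := lt_of_le_of_ne hab (Ne.symm hb)
            refine Finset.sum_eq_zero fun j _ => ?_
            rw [ih (n - b) (by omega) b rfl j, mul_zero]
          · simp [dMatrix, hab]
        · simp
      by_contra hne
      refine h (Matrix.exists_mulVec_eq_zero_iff.1 ⟨_, ?_, hz⟩)
      intro h2
      exact hne fun i => congrFun h2 i
  funext ⟨a, i⟩
  exact key _ a rfl i

namespace DrinfeldModule

variable (ρ : DrinfeldModule Fq)

lemma phi_det_ne_zero : ρ.phi.det ≠ 0 := by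
  intro h0
  obtain ⟨v, hv, hv0⟩ := Matrix.exists_mulVec_eq_zero_iff.2 h0
  apply hv
  have hpos : ∀ j : Fin ρ.rank, (j : ℕ) ≠ 0 → v j = 0 := by
    intro j hj
    have h1 := congrFun hv0 ⟨j - 1, by omega⟩
    rw [Matrix.mulVec, dotProduct, Finset.sum_eq_single j] at h1
    · have h2 : (j : ℕ) - 1 + 1 = j := by omega
      simpa [phi, h2] using h1
    · intro b _ hb
      have h2 : (j : ℕ) - 1 + 1 = j := by omega
      have h3 : (b : ℕ) ≠ j := fun h => hb (Fin.ext h)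
      simp [phi, h2, h3]
    · simp
  funext j
  by_cases hj : (j : ℕ) = 0
  · have h1 := congrFun hv0 ⟨ρ.rank - 1, Nat.sub_lt ρ.rank_pos one_pos⟩
    rw [Matrix.mulVec, dotProduct, Finset.sum_eq_single j] at h1
    · have h2 : ¬ (ρ.rank - 1 + 1 < ρ.rank) := by omega
      have h3 : (frobKbar Fq).symm^[ρ.rank] ρ.lead ≠ 0 := by
        have : ∀ m : ℕ, (frobKbar Fq).symm^[m] ρ.lead ≠ 0 := by
          intro m
          induction m with
          | zero => exact ρ.κ_top
          | succ m ih =>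
            rw [Function.iterate_succ_apply']
            exact (map_ne_zero_iff _ (RingEquiv.injective _)).2 ih
        exact this _
      simpa [phi, h2, hj, h3, Polynomial.X_sub_C_ne_zero] using h1
    · intro b _ hb
      rw [hpos b fun h => hb (Fin.ext (h.trans hj.symm)), mul_zero]
    · simp
  · exact hpos j hj

/-- The pre-`t`-motive `M_ρ`, with the basis `m = (m_1, …, m_r)` such that `σ m = Φ_ρ m`. -/
def motiveGL : GL (Fin ρ.rank) (Kt Fq) := toGL ρ.phi ρ.phi_det_ne_zero

/-- The matrix `d_{t,n+1}[Φ_ρ]` of `σ` on the prolongation `P_n M_ρ`. -/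
def prolGL (n : ℕ) : GL (Fin (n + 1) × Fin ρ.rank) (Kt Fq) :=
  toGL (dMatrix n ρ.phi) (dMatrix_det_ne_zero n _ ρ.phi_det_ne_zero)

/-- The row `(α, 0, …, 0)`. -/
def hRow (n : ℕ) (α : Kbar Fq) : Matrix Unit (Fin (n + 1) × Fin ρ.rank) (Kbar Fq)[X] :=
  fun _ x => if (x.1 : ℕ) = 0 ∧ (x.2 : ℕ) = 0 then Polynomial.C α else 0

/-- The matrix of `σ` on the pre-`t`-motive `Y_{α,n}`: the block matrix with rows
`(d_{t,n+1}[Φ_ρ], 0)` and `((α, 0, …, 0), 1)`. -/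
def extGL (n : ℕ) (α : Kbar Fq) : GL ((Fin (n + 1) × Fin ρ.rank) ⊕ Unit) (Kt Fq) :=
  toGL (Matrix.fromBlocks (dMatrix n ρ.phi) 0 (ρ.hRow n α) 1) (by
    rw [Matrix.det_fromBlocks_zero₁₂, Matrix.det_one, mul_one]
    exact dMatrix_det_ne_zero n _ ρ.phi_det_ne_zero)

/-- The pre-`t`-motive `M_ρ`. -/
abbrev motive : SigmaMod Fq := matObj ρ.motiveGL

/-- The pre-`t`-motive `P_n M_ρ`. -/
abbrev prol (n : ℕ) : SigmaMod Fq := matObj (ρ.prolGL n)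

/-- The pre-`t`-motive `Y_{α,n}`. -/
abbrev extObj (n : ℕ) (α : Kbar Fq) : SigmaMod Fq := matObj (ρ.extGL n α)

/-- The projection `P_n M_ρ → M_ρ` with `D_n m ↦ m` and `D_i m ↦ 0` for `i < n`. -/
def prolProj (n : ℕ) : ρ.prol n ⟶ ρ.motive :=
  ModuleCat.ofHom (matMap _ _ (Matrix.of fun x j => if x.1 = 0 ∧ x.2 = j then 1 else 0) (by
    ext ⟨a, i⟩ j
    rw [Matrix.mul_apply, Matrix.mul_apply, Fintype.sum_prod_type,
      Finset.sum_eq_single (0 : Fin (n + 1)), Finset.sum_eq_single i, Finset.sum_eq_single j]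
    · by_cases ha : a = 0
      · simp [ha, prolGL, motiveGL, toGL_val, dMatrix]
      · have : ¬ a ≤ 0 := by simpa using ha
        simp [ha, prolGL, motiveGL, toGL_val, dMatrix]
    · intro b _ hb
      simp [hb]
    · simp
    · intro b _ hb
      simp [Ne.symm hb]
    · simp
    · intro b _ hb
      simp [hb]
    · simp))

/-- The inclusion `M_ρ → P_n M_ρ` with `m ↦ D_0 m`. -/
def prolIncl (n : ℕ) : ρ.motive ⟶ ρ.prol n :=
  ModuleCat.ofHom (matMap _ _ (Matrix.of fun j x => if x.1 = Fin.last n ∧ x.2 = j then 1 else 0) (by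
    ext j ⟨b, l⟩
    rw [Matrix.mul_apply, Matrix.mul_apply, Fintype.sum_prod_type,
      Finset.sum_eq_single (Fin.last n), Finset.sum_eq_single j, Finset.sum_eq_single l]
    · by_cases hb : b = Fin.last n
      · simp [hb, prolGL, motiveGL, toGL_val, dMatrix]
      · have : ¬ Fin.last n ≤ b := fun h => hb (le_antisymm (Fin.le_last b) h)
        simp [hb, prolGL, motiveGL, toGL_val, dMatrix]
    · intro i _ hi
      simp [Ne.symm hi]
    · simp
    · intro i _ hi
      simp [hi]
    · simp
    · intro c _ hc
      simp [hc]
    · simp))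

/-- The endomorphism `𝐞` of `P_n M_ρ` attached to an endomorphism `e` of `M_ρ`: if
`e(m) = E m`, then in the basis `D_n m, …, D_0 m` the block matrix of `𝐞` has the block `E` in
its upper right corner and zeros elsewhere. -/
def prolEnd (n : ℕ) (e : ρ.motive ⟶ ρ.motive) : ρ.prol n ⟶ ρ.prol n :=
  ρ.prolProj n ≫ e ≫ ρ.prolIncl n

/-- If `e` is the row vector map `x ↦ x E`, then `𝐞` is the row vector map `x ↦ x 𝐄` where `𝐄` has
the block `E` in position `(0, n)` and zeros elsewhere. -/
lemma prolEnd_matMap (n : ℕ) (E : Matrix (Fin ρ.rank) (Fin ρ.rank) (Kt Fq))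
    (hE : E.map (untwist Fq) * ρ.motiveGL.val = ρ.motiveGL.val * E)
    (x : Fin (n + 1) × Fin ρ.rank → Kt Fq) :
    (ρ.prolEnd n (ModuleCat.ofHom (matMap _ _ E hE))).hom x =
      (x ᵥ* (Matrix.of fun y z => if y.1 = 0 ∧ z.1 = Fin.last n then E y.2 z.2 else 0) :
        Fin (n + 1) × Fin ρ.rank → Kt Fq) := by
  change ((x ᵥ* Matrix.of fun y j => if y.1 = 0 ∧ y.2 = j then 1 else 0) ᵥ* E) ᵥ*
    (Matrix.of fun j (z : Fin (n + 1) × Fin ρ.rank) => if z.1 = Fin.last n ∧ z.2 = j then 1 else 0) = _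
  rw [Matrix.vecMul_vecMul, Matrix.vecMul_vecMul]
  congr 1
  ext ⟨a, i⟩ ⟨b, l⟩
  rw [Matrix.mul_apply, Finset.sum_eq_single i, Matrix.mul_apply,
    Finset.sum_eq_single l]
  · by_cases ha : a = 0 <;> by_cases hb : b = Fin.last n <;> simp [ha, hb]
  · intro c _ hc
    simp [Ne.symm hc]
  · simp
  · intro c _ hc
    simp [Ne.symm hc]
  · simp

/-- The inclusion `P_n M_ρ → Y_{α,n}`. -/
def extIncl (n : ℕ) (α : Kbar Fq) : ρ.prol n ⟶ ρ.extObj n α :=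
  ModuleCat.ofHom (matMap _ _ (Matrix.fromCols 1 0) (by
    rw [extGL, prolGL, toGL_val, toGL_val, Matrix.fromBlocks_map, Matrix.fromCols_map,
      Matrix.fromCols_mul_fromBlocks, Matrix.mul_fromCols]
    simp))

/-- The projection `Y_{α,n} → 1`. -/
def extProj (n : ℕ) (α : Kbar Fq) : ρ.extObj n α ⟶ unitObj Fq :=
  ModuleCat.ofHom (matMap _ _ (Matrix.fromRows 0 1) (by
    rw [extGL, toGL_val, Matrix.fromBlocks_map, Matrix.fromRows_map,
      Matrix.fromRows_mul, Matrix.fromBlocks_mul_fromRows]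
    simp))

lemma extIncl_apply (n : ℕ) (α : Kbar Fq) (x : Fin (n + 1) × Fin ρ.rank → Kt Fq) :
    (ρ.extIncl n α).hom x = (Sum.elim x 0 : (Fin (n + 1) × Fin ρ.rank) ⊕ Unit → Kt Fq) := by
  change x ᵥ* Matrix.fromCols 1 0 = _
  rw [Matrix.vecMul_fromCols, Matrix.vecMul_one, Matrix.vecMul_zero]

lemma extProj_apply (n : ℕ) (α : Kbar Fq) (y : (Fin (n + 1) × Fin ρ.rank) ⊕ Unit → Kt Fq) :
    (ρ.extProj n α).hom y = (y ∘ Sum.inr : Unit → Kt Fq) := by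
  change y ᵥ* Matrix.fromRows 0 1 = _
  rw [Matrix.vecMul_fromRows, Matrix.vecMul_one, Matrix.vecMul_zero, zero_add]

/-- The unit object as a `t`-motive. -/
abbrev unitT (Fq : Type u) [Field Fq] [Fintype Fq] : TMot Fq := ⟨unitObj Fq, .unit⟩

/-- The complex `P_n M_ρ → Y_{α,n} → 1` of `t`-motives. -/
abbrev extComplex (n : ℕ) (α : Kbar Fq) (hP : IsTMotive Fq (ρ.prol n))
    (hY : IsTMotive Fq (ρ.extObj n α)) : ShortComplex (TMot Fq) where
  X₁ := ⟨ρ.prol n, hP⟩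
  X₂ := ⟨ρ.extObj n α, hY⟩
  X₃ := unitT Fq
  f := ObjectProperty.homMk (ρ.extIncl n α)
  g := ObjectProperty.homMk (ρ.extProj n α)
  zero := by
    ext x
    exact (congrArg (ρ.extProj n α).hom (ρ.extIncl_apply n α x)).trans (ρ.extProj_apply n α _)

lemma extComplex_shortExact (n : ℕ) (α : Kbar Fq) (hP : IsTMotive Fq (ρ.prol n))
    (hY : IsTMotive Fq (ρ.extObj n α)) : (ρ.extComplex n α hP hY).ShortExact := by
  refine shortExact_of_modules _ ?_ ?_ ?_
  · intro y
    constructor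
    · intro h
      have h' : (y ∘ Sum.inr : Unit → Kt Fq) = 0 := (ρ.extProj_apply n α y).symm.trans h
      refine ⟨(y ∘ Sum.inl : Fin (n + 1) × Fin ρ.rank → Kt Fq),
        (ρ.extIncl_apply n α _).trans ?_⟩
      funext i
      rcases i with i | i
      · rfl
      · exact (congrFun h' i).symm
    · rintro ⟨x, rfl⟩
      exact (congrArg (ρ.extProj n α).hom (ρ.extIncl_apply n α x)).trans
        (ρ.extProj_apply n α _)
  · intro x x' h
    have h' := ((ρ.extIncl_apply n α x).symm.trans h).trans (ρ.extIncl_apply n α x')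
    funext i
    exact congrFun h' (Sum.inl i)
  · intro z
    refine ⟨(Sum.elim 0 z : (Fin (n + 1) × Fin ρ.rank) ⊕ Unit → Kt Fq), ?_⟩
    exact ρ.extProj_apply n α _

/-- The class of `0 → P_n M_ρ → Y_{α,n} → 1 → 0` in `Ext¹(1, P_n M_ρ)`, the group of
extensions in the abelian category of `t`-motives. -/
def extClass (n : ℕ) (α : Kbar Fq) (hP : IsTMotive Fq (ρ.prol n))
    (hY : IsTMotive Fq (ρ.extObj n α)) :
    Abelian.Ext.{u + 1} (unitT Fq) (⟨ρ.prol n, hP⟩ : TMot Fq) 1 :=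
  (ρ.extComplex_shortExact n α hP hY).extClass

/-- The class of the pushout `𝐞_* Y_{α,n}` along the endomorphism `𝐞` of `P_n M_ρ` attached to
an endomorphism `e` of the `t`-motive `M_ρ`. -/
def pushClass (n : ℕ) (α : Kbar Fq) (hP : IsTMotive Fq (ρ.prol n))
    (hY : IsTMotive Fq (ρ.extObj n α)) (hM : IsTMotive Fq ρ.motive)
    (e : End (⟨ρ.motive, hM⟩ : TMot Fq)) :
    Abelian.Ext.{u + 1} (unitT Fq) (⟨ρ.prol n, hP⟩ : TMot Fq) 1 :=
  (ρ.extClass n α hP hY).comp (Abelian.Ext.mk₀ (ObjectProperty.homMk (ρ.prolEnd n ((IsTMotive Fq).ι.map e))))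
    (add_zero 1)

end DrinfeldModule

end Drinfeld

end DrinfeldProlongation

end

open CategoryTheory DrinfeldProlongation

noncomputable section

open scoped NNReal WithZero Polynomial PowerSeries Matrix
open CategoryTheory

namespace DrinfeldProlongation

universe u

section NormFacts

variable (Fq : Type u) [Field Fq] [Fintype Fq]

instance : IsUltrametricDist (KInf Fq) :=
  inferInstanceAs (IsUltrametricDist (KInf Fq))

instance : IsUltrametricDist (KInfAlg Fq) :=
  IsUltrametricDist.isUltrametricDist_of_forall_norm_add_le_max_norm
    (fun x y => isNonarchimedean_spectralNorm (K := KInf Fq) (L := KInfAlg Fq) x y)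

lemma norm_algToCInf (x : KInfAlg Fq) : ‖algToCInf Fq x‖ = ‖x‖ :=
  UniformSpace.Completion.norm_coe x

lemma denseRange_algToCInf : DenseRange (algToCInf Fq) :=
  UniformSpace.Completion.denseRange_coe

instance : IsUltrametricDist (CInf Fq) := by
  refine IsUltrametricDist.isUltrametricDist_of_forall_norm_add_le_max_norm ?_
  have hcl : IsClosed {p : CInf Fq × CInf Fq | ‖p.1 + p.2‖ ≤ max ‖p.1‖ ‖p.2‖} :=
    isClosed_le (by fun_prop) (by fun_prop)
  intro x y
  refine (denseRange_algToCInf Fq).induction_on₂ (p := fun x y => ‖x + y‖ ≤ max ‖x‖ ‖y‖) hcl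
    (fun a b => ?_) x y
  rw [← map_add, norm_algToCInf, norm_algToCInf, norm_algToCInf]
  exact IsUltrametricDist.norm_add_le_max a b

instance : NonarchimedeanRing (CInf Fq) where
  is_nonarchimedean := NonarchimedeanAddGroup.is_nonarchimedean

lemma one_lt_norm_theta : 1 < ‖theta Fq‖ := by
  have h1 : ‖theta Fq‖ = ‖(HahnSeries.single (-1) 1 : KInf Fq)‖ := by
    rw [theta, toCInf, RingHom.comp_apply, norm_algToCInf]
    exact spectralNorm_extends (K := KInf Fq) (L := KInfAlg Fq) _
  rw [h1, Valued.toNormedField.one_lt_norm_iff]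
  have := LaurentSeries.valuation_single_zpow Fq (-1)
  erw [this]
  decide

lemma theta_ne_zero : theta Fq ≠ 0 := by
  intro h
  have := one_lt_norm_theta Fq
  rw [h, norm_zero] at this
  linarith

lemma one_lt_q : 1 < q Fq := Fintype.one_lt_card

end NormFacts

section Frobenius

variable (Fq : Type u) [Field Fq] [Fintype Fq]

/-- The endomorphism `x ↦ x^(q^j)` of `𝕂`. -/
def frobPow (j : ℕ) : CInf Fq →+* CInf Fq := (FiniteField.frobeniusAlgHom Fq (CInf Fq)).toRingHom ^ j

variable {Fq}

@[simp]
lemma frobPow_apply (j : ℕ) (x : CInf Fq) : frobPow Fq j x = x ^ q Fq ^ j := by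
  induction j with
  | zero => simp [frobPow]
  | succ j ih =>
    have : frobPow Fq (j + 1) x = (frobPow Fq j x) ^ q Fq := by
      rw [frobPow, pow_succ']; rfl
    rw [this, ih, ← pow_mul, pow_succ]

lemma frobPow_algebraMap (j : ℕ) (c : Fq) :
    frobPow Fq j (algebraMap Fq (CInf Fq) c) = algebraMap Fq (CInf Fq) c := by
  rw [frobPow_apply, ← map_pow, FiniteField.pow_card_pow]

lemma continuous_frobPow (j : ℕ) : Continuous (frobPow Fq j) :=
  (continuous_pow (M := CInf Fq) (q Fq ^ j)).congr fun x => (frobPow_apply j x).symm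

lemma frobC_symm_pow (x : CInf Fq) : ((frobC Fq).symm x) ^ q Fq = x :=
  (frobC Fq).apply_symm_apply x

lemma frobC_symm_pow' (x : CInf Fq) : (frobC Fq).symm (x ^ q Fq) = x :=
  (frobC Fq).symm_apply_apply x

lemma norm_frobC_symm_pow (x : CInf Fq) : ‖(frobC Fq).symm x‖ ^ q Fq = ‖x‖ := by
  rw [← norm_pow, frobC_symm_pow]

lemma exists_algebraMap_eq_of_pow_eq {x : CInf Fq} (hx : x ^ q Fq = x) :
    ∃ c : Fq, algebraMap Fq (CInf Fq) c = x := by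
  classical
  have hne : (Polynomial.X ^ q Fq - Polynomial.X : (CInf Fq)[X]) ≠ 0 :=
    FiniteField.X_pow_card_sub_X_ne_zero _ (one_lt_q Fq)
  have hroots := FiniteField.roots_X_pow_card_sub_X Fq
  have hdeg : (Polynomial.X ^ q Fq - Polynomial.X : Fq[X]).natDegree = q Fq :=
    FiniteField.X_pow_card_sub_X_natDegree_eq _ (one_lt_q Fq)
  have hcard : (Polynomial.X ^ q Fq - Polynomial.X : Fq[X]).roots.card =
      (Polynomial.X ^ q Fq - Polynomial.X : Fq[X]).natDegree := by
    rw [hroots, hdeg]; rfl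
  have hspl := (Polynomial.splits_iff_card_roots).2 hcard
  have hr := hspl.roots_map (algebraMap Fq (CInf Fq))
  rw [hroots] at hr
  have hx' : x ∈ ((Polynomial.X ^ q Fq - Polynomial.X : Fq[X]).map
      (algebraMap Fq (CInf Fq))).roots := by
    rw [Polynomial.mem_roots']
    simp only [Polynomial.map_sub, Polynomial.map_pow, Polynomial.map_X]
    exact ⟨hne, by simp [hx]⟩
  rw [hr] at hx'
  obtain ⟨c, -, hc⟩ := Multiset.mem_map.1 hx'
  exact ⟨c, hc⟩

lemma exists_sub_pow_eq_of_norm_lt_one {b : CInf Fq} (hb : ‖b‖ < 1) :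
    ∃ y : CInf Fq, y - y ^ q Fq = b ∧ ‖y‖ ≤ ‖b‖ := by
  have hle : ∀ i, ‖b ^ q Fq ^ i‖ ≤ ‖b‖ ^ i := fun i => by
    rw [norm_pow]
    exact pow_le_pow_of_le_one (norm_nonneg _) hb.le (Nat.lt_pow_self (one_lt_q Fq)).le
  have hs : Summable fun i => b ^ q Fq ^ i :=
    Summable.of_norm_bounded (summable_geometric_of_lt_one (norm_nonneg _) hb) hle
  refine ⟨∑' i, b ^ q Fq ^ i, ?_, ?_⟩
  · have h1 : (∑' i, b ^ q Fq ^ i) ^ q Fq = ∑' i, b ^ q Fq ^ (i + 1) := by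
      have := (hs.hasSum.map (frobPow Fq 1) (continuous_frobPow 1)).tsum_eq
      simp only [Function.comp_def, frobPow_apply, pow_one] at this
      rw [← this]
      exact tsum_congr fun i => by rw [← pow_mul, pow_succ]
    rw [h1, hs.tsum_eq_zero_add]
    simp
  · refine IsUltrametricDist.norm_tsum_le_of_forall_le fun i => ?_
    rw [norm_pow]
    exact pow_le_of_le_one (norm_nonneg _) hb.le (pow_ne_zero _ Fintype.card_ne_zero)

lemma exists_sub_pow_eq (b : CInf Fq) :
    ∃ y : CInf Fq, y - y ^ q Fq = b ∧ (‖b‖ < 1 → ‖y‖ ≤ ‖b‖) := by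
  by_cases hb : ‖b‖ < 1
  · obtain ⟨y, h1, h2⟩ := exists_sub_pow_eq_of_norm_lt_one hb
    exact ⟨y, h1, fun _ => h2⟩
  obtain ⟨b', hb'⟩ := (denseRange_algToCInf Fq).exists_dist_lt b one_pos
  obtain ⟨z, hz, -⟩ := exists_sub_pow_eq_of_norm_lt_one (b := b - algToCInf Fq b')
    (by rwa [← dist_eq_norm])
  have hdeg : (Polynomial.X ^ q Fq - Polynomial.X + Polynomial.C b' : (KInfAlg Fq)[X]).degree =
      q Fq := by
    have h1 : (Polynomial.X ^ q Fq - Polynomial.X : (KInfAlg Fq)[X]).degree = q Fq := by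
      rw [Polynomial.degree_eq_natDegree (FiniteField.X_pow_card_sub_X_ne_zero _ (one_lt_q Fq)),
        FiniteField.X_pow_card_sub_X_natDegree_eq _ (one_lt_q Fq)]
    rw [Polynomial.degree_add_C, h1]
    rw [h1]
    exact_mod_cast Fintype.card_pos
  obtain ⟨y, hy⟩ := IsAlgClosed.exists_root _ (by
    rw [hdeg]; exact_mod_cast (Fintype.card_pos (α := Fq)).ne')
  refine ⟨algToCInf Fq y + z, ?_, fun h => absurd h hb⟩
  have hy' : b' = y - y ^ q Fq := by
    simp only [Polynomial.IsRoot, Polynomial.eval_add, Polynomial.eval_sub, Polynomial.eval_pow,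
      Polynomial.eval_X, Polynomial.eval_C] at hy
    linear_combination hy
  have h2 : (algToCInf Fq y + z) ^ q Fq = algToCInf Fq y ^ q Fq + z ^ q Fq := by
    simpa using map_add (frobPow Fq 1) (algToCInf Fq y) z
  have h3 : algToCInf Fq b' = algToCInf Fq y - algToCInf Fq y ^ q Fq := by
    rw [hy', map_sub, map_pow]
  rw [h2]
  linear_combination hz - h3

end Frobenius

section Restricted

variable {Fq : Type u} [Field Fq] [Fintype Fq]

variable (Fq) in
/-- The power series over `𝕂` which converge on the closed disc of radius `c`. -/
abbrev restrictedRing (c : ℝ) : Subring (CInf Fq)⟦X⟧ := PowerSeries.IsRestricted.subring c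

lemma mem_restrictedRing {c : ℝ} {f : (CInf Fq)⟦X⟧} : f ∈ restrictedRing Fq c ↔
    Filter.Tendsto (fun m => ‖PowerSeries.coeff m f‖ * c ^ m) Filter.atTop (nhds 0) :=
  PowerSeries.isRestricted_iff' c f

variable (Fq) in
/-- The Tate algebra. -/
abbrev tate : Subring (CInf Fq)⟦X⟧ := restrictedRing Fq 1

lemma mem_tate {f : (CInf Fq)⟦X⟧} : f ∈ tate Fq ↔ IsTate Fq f := by
  rw [mem_restrictedRing, IsTate]
  simp

lemma C_mem_restrictedRing (c : ℝ) (x : CInf Fq) : PowerSeries.C x ∈ restrictedRing Fq c :=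
  PowerSeries.isRestricted_C c x

lemma X_mem_restrictedRing (c : ℝ) : (PowerSeries.X : (CInf Fq)⟦X⟧) ∈ restrictedRing Fq c := by
  rw [PowerSeries.X_eq]
  exact PowerSeries.isRestricted_monomial c 1 1

lemma coe_mem_restrictedRing (c : ℝ) (p : (CInf Fq)[X]) :
    (p : (CInf Fq)⟦X⟧) ∈ restrictedRing Fq c := by
  induction p using Polynomial.induction_on' with
  | add p q hp hq => rw [Polynomial.coe_add]; exact add_mem hp hq
  | monomial n a =>
    rw [Polynomial.coe_monomial]
    exact PowerSeries.isRestricted_monomial c n a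

lemma polyToPowerSeries_mem (c : ℝ) (p : (Kbar Fq)[X]) :
    polyToPowerSeries Fq p ∈ restrictedRing Fq c := coe_mem_restrictedRing c _

lemma summable_coeff_mul_pow {c : ℝ} {a : CInf Fq} (ha : ‖a‖ ≤ c) {f : (CInf Fq)⟦X⟧}
    (hf : f ∈ restrictedRing Fq c) : Summable fun m => PowerSeries.coeff m f * a ^ m := by
  refine NonarchimedeanAddGroup.summable_of_tendsto_cofinite_zero ?_
  rw [Nat.cofinite_eq_atTop]
  refine squeeze_zero_norm (fun m => ?_) (mem_restrictedRing.1 hf)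
  rw [norm_mul, norm_pow]
  gcongr

lemma tsum_mul_tsum_antidiagonal {F G : ℕ → CInf Fq} (hf : Summable F) (hg : Summable G) :
    (∑' m, F m) * ∑' m, G m = ∑' m, ∑ p ∈ Finset.HasAntidiagonal.antidiagonal m, F p.1 * G p.2 := by
  have h := hf.mul_of_nonarchimedean hg
  exact hf.tsum_mul_tsum_eq_tsum_sum_antidiagonal hg h

lemma tsum_coeff_mul {c : ℝ} {a : CInf Fq} (ha : ‖a‖ ≤ c) {f g : (CInf Fq)⟦X⟧}
    (hf : f ∈ restrictedRing Fq c) (hg : g ∈ restrictedRing Fq c) :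
    ∑' m, PowerSeries.coeff m (f * g) * a ^ m =
      (∑' m, PowerSeries.coeff m f * a ^ m) * ∑' m, PowerSeries.coeff m g * a ^ m := by
  rw [tsum_mul_tsum_antidiagonal (summable_coeff_mul_pow ha hf) (summable_coeff_mul_pow ha hg)]
  refine tsum_congr fun m => ?_
  rw [PowerSeries.coeff_mul, Finset.sum_mul]
  refine Finset.sum_congr rfl fun p hp => ?_
  rw [← Finset.HasAntidiagonal.mem_antidiagonal.1 hp, pow_add]
  ring

/-- Evaluation of a convergent power series at a point of the closed disc of radius `c`. -/
def evalAt (c : ℝ) (a : CInf Fq) (ha : ‖a‖ ≤ c) : restrictedRing Fq c →+* CInf Fq where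
  toFun f := ∑' m, PowerSeries.coeff m (f : (CInf Fq)⟦X⟧) * a ^ m
  map_zero' := by simp
  map_one' := by
    rw [tsum_eq_single 0]
    · simp
    · intro m hm
      simp [PowerSeries.coeff_one, hm]
  map_add' f g := by
    rw [← (summable_coeff_mul_pow ha f.2).tsum_add (summable_coeff_mul_pow ha g.2)]
    exact tsum_congr fun m => by simp [add_mul]
  map_mul' f g := tsum_coeff_mul ha f.2 g.2

lemma evalAt_coe (c : ℝ) (a : CInf Fq) (ha : ‖a‖ ≤ c) (p : (CInf Fq)[X])
    (hp : (p : (CInf Fq)⟦X⟧) ∈ restrictedRing Fq c) : evalAt c a ha ⟨p, hp⟩ = p.eval a := by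
  change ∑' m, PowerSeries.coeff m (p : (CInf Fq)⟦X⟧) * a ^ m = _
  rw [tsum_eq_sum (s := Finset.range (p.natDegree + 1)), Polynomial.eval_eq_sum_range]
  · simp
  · intro m hm
    rw [Polynomial.coeff_coe, Polynomial.coeff_eq_zero_of_natDegree_lt (by simpa using hm), zero_mul]

lemma evalAt_C (c : ℝ) (a : CInf Fq) (ha : ‖a‖ ≤ c) (x : CInf Fq) :
    evalAt c a ha ⟨PowerSeries.C x, C_mem_restrictedRing c x⟩ = x := by
  have := evalAt_coe c a ha (Polynomial.C x) (by simpa using C_mem_restrictedRing c x)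
  simpa using this

lemma evalAt_X (c : ℝ) (a : CInf Fq) (ha : ‖a‖ ≤ c) :
    evalAt c a ha ⟨PowerSeries.X, X_mem_restrictedRing c⟩ = a := by
  have := evalAt_coe c a ha Polynomial.X (by simpa using X_mem_restrictedRing c)
  simpa using this

lemma map_frobPow_mem_tate {f : (CInf Fq)⟦X⟧} (hf : f ∈ tate Fq) (j : ℕ) :
    PowerSeries.map (frobPow Fq j) f ∈ tate Fq := by
  rw [mem_tate, IsTate] at *
  have := hf.pow (q Fq ^ j)
  rw [zero_pow (pow_ne_zero _ Fintype.card_ne_zero)] at this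
  simpa using this

lemma untwist_mem_tate {f : (CInf Fq)⟦X⟧} (hf : f ∈ tate Fq) :
    powerSeriesUntwist Fq f ∈ tate Fq := by
  rw [mem_tate, IsTate] at *
  have h0 : (0 : ℝ) < q Fq := by exact_mod_cast Fintype.card_pos
  have := hf.rpow_const (p := (q Fq : ℝ)⁻¹) (Or.inr (by positivity))
  rw [Real.zero_rpow (by positivity)] at this
  refine this.congr fun m => ?_
  have h1 := norm_frobC_symm_pow (PowerSeries.coeff m f)
  rw [powerSeriesUntwist, PowerSeries.coeff_map, ← h1, ← Real.rpow_natCast,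
    ← Real.rpow_mul (norm_nonneg _), mul_inv_cancel₀ h0.ne', Real.rpow_one]
  rfl

/-- Every equation `x^{(-1)} - x = b` over the Tate algebra is solvable. -/
lemma exists_untwist_sub_eq {b : (CInf Fq)⟦X⟧} (hb : b ∈ tate Fq) :
    ∃ x ∈ tate Fq, powerSeriesUntwist Fq x - x = b := by
  choose y hy hy' using exists_sub_pow_eq (Fq := Fq)
  refine ⟨PowerSeries.mk fun m => (y (PowerSeries.coeff m b)) ^ q Fq, ?_, ?_⟩
  · rw [mem_tate, IsTate] at *
    have h1 : ∀ᶠ m in Filter.atTop, ‖PowerSeries.coeff m b‖ < 1 := hb.eventually_lt_const one_pos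
    refine squeeze_zero' (.of_forall fun m => norm_nonneg _) ?_ hb
    filter_upwards [h1] with m hm
    rw [PowerSeries.coeff_mk, norm_pow]
    exact (pow_le_of_le_one (norm_nonneg _) ((hy' _ hm).trans hm.le) Fintype.card_ne_zero).trans
      (hy' _ hm)
  · ext m
    rw [map_sub, powerSeriesUntwist, PowerSeries.coeff_map, PowerSeries.coeff_mk]
    exact (congrArg (· - _) (frobC_symm_pow' _)).trans (hy _)

lemma inv_mem_tate {f : (CInf Fq)⟦X⟧} {s : ℝ} (hs0 : 0 ≤ s) (hs : s < 1)
    (h0 : PowerSeries.coeff 0 f ≠ 0)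
    (hf : ∀ m, ‖PowerSeries.coeff m f‖ ≤ ‖PowerSeries.coeff 0 f‖ * s ^ m) :
    f⁻¹ ∈ tate Fq := by
  have key : ∀ m, ‖PowerSeries.coeff m f⁻¹‖ ≤ ‖PowerSeries.coeff 0 f‖⁻¹ * s ^ m := by
    intro m
    induction m using Nat.strong_induction_on with
    | _ m ih =>
      rw [PowerSeries.coeff_inv]
      split_ifs with hm
      · simp [hm]
      · rw [norm_mul, norm_neg, norm_inv, ← PowerSeries.coeff_zero_eq_constantCoeff_apply]
        refine mul_le_mul_of_nonneg_left ?_ (by positivity)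
        refine IsUltrametricDist.norm_sum_le_of_forall_le_of_nonneg (by positivity) fun p hp => ?_
        have hp' := Finset.HasAntidiagonal.mem_antidiagonal.1 hp
        split_ifs with h
        · rw [norm_mul]
          calc _ ≤ (‖PowerSeries.coeff 0 f‖ * s ^ p.1) * (‖PowerSeries.coeff 0 f‖⁻¹ * s ^ p.2) :=
                mul_le_mul (hf _) (ih _ h) (norm_nonneg _) (by positivity)
            _ = s ^ m := by
                rw [← hp', pow_add]
                have : ‖PowerSeries.coeff 0 f‖ ≠ 0 := norm_ne_zero_iff.2 h0
                field_simp
        · simpa using by positivity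
  rw [mem_tate, IsTate]
  refine squeeze_zero (fun _ => norm_nonneg _) key ?_
  simpa using (tendsto_pow_atTop_nhds_zero_of_lt_one hs0 hs).const_mul _

/-- There is an invertible element `Ω` of the Tate algebra with `Ω^{(-1)} = (t - θ) Ω`. -/
lemma exists_omega (Fq : Type u) [Field Fq] [Fintype Fq] :
    ∃ W W' : (CInf Fq)⟦X⟧, W ∈ tate Fq ∧ W' ∈ tate Fq ∧ W * W' = 1 ∧
      powerSeriesUntwist Fq W = (PowerSeries.X - PowerSeries.C (theta Fq)) * W := by
  have hq1 : 0 < q Fq - 1 := Nat.sub_pos_of_lt (one_lt_q Fq)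
  obtain ⟨z', hz'⟩ := IsAlgClosed.exists_pow_nat_eq
    (-(algebraMap (KInf Fq) (KInfAlg Fq) (HahnSeries.single (-1) 1))) hq1
  set z := algToCInf Fq z' with hz_def
  have hz : z ^ (q Fq - 1) = - theta Fq := by
    rw [hz_def, ← map_pow, hz', map_neg]; rfl
  have hz0 : z ≠ 0 := by
    rintro h
    rw [h, zero_pow hq1.ne'] at hz
    exact theta_ne_zero Fq (neg_eq_zero.1 hz.symm)
  have hzq : z ^ q Fq = - theta Fq * z := by
    rw [← hz, ← pow_succ, Nat.sub_add_cancel (one_lt_q Fq).le]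
  choose y hy hy' using exists_sub_pow_eq (Fq := Fq)
  let x : ℕ → CInf Fq := fun m => Nat.rec 1 (fun _ a => y (a / theta Fq)) m
  have hx0 : x 0 = 1 := rfl
  have hxs : ∀ m, x (m + 1) = y (x m / theta Fq) := fun m => rfl
  have hθ := one_lt_norm_theta Fq
  have hθ0 : 0 < ‖theta Fq‖ := one_pos.trans hθ
  have hxn : ∀ m, ‖x m‖ ≤ ‖theta Fq‖⁻¹ ^ m := by
    intro m
    induction m with
    | zero => simp [hx0]
    | succ m ih =>
      have h1 : ‖x m / theta Fq‖ ≤ ‖theta Fq‖⁻¹ ^ (m + 1) := by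
        rw [norm_div, pow_succ, div_eq_mul_inv]; gcongr
      have h2 : ‖theta Fq‖⁻¹ ^ (m + 1) < 1 :=
        pow_lt_one₀ (by positivity) (inv_lt_one_of_one_lt₀ hθ) (by omega)
      rw [hxs]
      exact (hy' _ (h1.trans_lt h2)).trans h1
  set V : (CInf Fq)⟦X⟧ := PowerSeries.mk fun m => (z * x m) ^ q Fq with hV
  have hV0 : PowerSeries.coeff 0 V = z ^ q Fq := by simp [hV, hx0]
  have hs1 : ‖theta Fq‖⁻¹ < 1 := inv_lt_one_of_one_lt₀ hθ
  have hVn : ∀ m, ‖PowerSeries.coeff m V‖ ≤ ‖PowerSeries.coeff 0 V‖ * ‖theta Fq‖⁻¹ ^ m := by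
    intro m
    rw [hV0, hV, PowerSeries.coeff_mk, mul_pow, norm_mul, norm_pow (x m)]
    gcongr
    exact (pow_le_of_le_one (norm_nonneg _) ((hxn m).trans
      (pow_le_one₀ (by positivity) hs1.le)) Fintype.card_ne_zero).trans (hxn m)
  have hV0' : PowerSeries.coeff 0 V ≠ 0 := by rw [hV0]; exact pow_ne_zero _ hz0
  have hVT : V ∈ tate Fq := by
    rw [mem_tate, IsTate]
    refine squeeze_zero (fun _ => norm_nonneg _) hVn ?_
    simpa using (tendsto_pow_atTop_nhds_zero_of_lt_one (by positivity) hs1).const_mul _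
  have hVinv : V * V⁻¹ = 1 := PowerSeries.mul_inv_cancel V (by
    rwa [← PowerSeries.coeff_zero_eq_constantCoeff_apply])
  have hVeq : (PowerSeries.X - PowerSeries.C (theta Fq)) * powerSeriesUntwist Fq V = V := by
    have hun : powerSeriesUntwist Fq V = PowerSeries.mk fun m => z * x m := by
      ext m
      rw [powerSeriesUntwist, PowerSeries.coeff_map, hV, PowerSeries.coeff_mk,
        PowerSeries.coeff_mk]
      exact frobC_symm_pow' _
    rw [hun]
    ext m
    rw [sub_mul, map_sub, PowerSeries.coeff_C_mul, PowerSeries.coeff_mk, hV, PowerSeries.coeff_mk]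
    cases m with
    | zero =>
      simp [hx0, hzq]
    | succ m =>
      rw [PowerSeries.coeff_succ_X_mul, PowerSeries.coeff_mk, mul_pow, hzq]
      have h3 := hy (x m / theta Fq)
      rw [← hxs, eq_div_iff (theta_ne_zero Fq)] at h3
      linear_combination (-z) * h3
  have hM := congrArg (powerSeriesUntwist Fq) hVinv
  rw [map_mul, map_one] at hM
  refine ⟨V⁻¹, V, inv_mem_tate (by positivity) hs1 hV0' hVn, hVT, by rw [mul_comm, hVinv], ?_⟩
  calc powerSeriesUntwist Fq V⁻¹ = powerSeriesUntwist Fq V⁻¹ * (V * V⁻¹) := by rw [hVinv, mul_one]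
    _ = (powerSeriesUntwist Fq V * powerSeriesUntwist Fq V⁻¹) *
        ((PowerSeries.X - PowerSeries.C (theta Fq)) * V⁻¹) := by
        nth_rewrite 2 [← hVeq]; ring
    _ = _ := by rw [hM, one_mul]

end Restricted

namespace DrinfeldModule

section Exponential

variable {Fq : Type u} [Field Fq] [Fintype Fq] (ρ : DrinfeldModule Fq)

lemma norm_theta_pow_sub {N : ℕ} (hN : 1 < N) : ‖theta Fq ^ N - theta Fq‖ = ‖theta Fq‖ ^ N := by
  have h1 : ‖theta Fq‖ < ‖theta Fq ^ N‖ := by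
    rw [norm_pow]
    simpa using pow_lt_pow_right₀ (one_lt_norm_theta Fq) hN
  rw [sub_eq_add_neg, IsUltrametricDist.norm_add_eq_max_of_norm_ne_norm (by rw [norm_neg]; exact h1.ne'),
    norm_neg, max_eq_left h1.le, norm_pow]

lemma one_lt_q_pow (h : ℕ) : 1 < q Fq ^ (h + 1) := Nat.one_lt_pow (by omega) (one_lt_q Fq)

lemma theta_pow_sub_ne_zero (h : ℕ) : theta Fq ^ q Fq ^ (h + 1) - theta Fq ≠ 0 := by
  rw [← norm_ne_zero_iff, norm_theta_pow_sub (one_lt_q_pow h)]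
  exact pow_ne_zero _ (norm_ne_zero_iff.2 (theta_ne_zero Fq))

lemma expCoeff_zero : ρ.expCoeff 0 = 1 := by rw [expCoeff]

lemma expCoeff_succ (h : ℕ) : (theta Fq ^ q Fq ^ (h + 1) - theta Fq) * ρ.expCoeff (h + 1) =
    ∑ i : Fin ρ.rank, if (i : ℕ) ≤ h then
        (ρ.κ i : CInf Fq) * ρ.expCoeff (h - i) ^ q Fq ^ ((i : ℕ) + 1) else 0 := by
  rw [expCoeff, mul_inv_cancel_left₀ (theta_pow_sub_ne_zero h)]

/-- A bound for the coefficients of `ρ_t`. -/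
def coeffBound : ℝ := 1 + ∑ i, ‖(ρ.κ i : CInf Fq)‖

lemma one_le_coeffBound : 1 ≤ ρ.coeffBound :=
  le_add_of_nonneg_right (Finset.sum_nonneg fun _ _ => norm_nonneg _)

lemma norm_κ_le (i : Fin ρ.rank) : ‖(ρ.κ i : CInf Fq)‖ ≤ ρ.coeffBound := by
  have := Finset.single_le_sum (f := fun i => ‖(ρ.κ i : CInf Fq)‖) (fun _ _ => norm_nonneg _)
    (Finset.mem_univ i)
  exact this.trans (by rw [coeffBound]; linarith)

lemma norm_expCoeff_succ_le {h : ℕ} {R : ℝ} (hR : 0 < R)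
    (hb : ∀ i : Fin ρ.rank, (i : ℕ) ≤ h → ‖ρ.expCoeff (h - i)‖ ≤ R ^ q Fq ^ (h - i)) :
    ‖ρ.expCoeff (h + 1)‖ * ‖theta Fq‖ ^ q Fq ^ (h + 1) ≤
      ρ.coeffBound * R ^ q Fq ^ (h + 1) := by
  have hK := ρ.one_le_coeffBound
  rw [← norm_theta_pow_sub (one_lt_q_pow h), ← norm_mul, mul_comm, expCoeff_succ]
  refine IsUltrametricDist.norm_sum_le_of_forall_le_of_nonneg (by positivity) fun i _ => ?_
  split_ifs with hi
  · rw [norm_mul, norm_pow]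
    gcongr
    · exact ρ.norm_κ_le i
    · calc _ ≤ (R ^ q Fq ^ (h - i)) ^ q Fq ^ ((i : ℕ) + 1) := by gcongr; exact hb i hi
        _ = _ := by rw [← pow_mul, ← pow_add]; congr 2; omega
  · rw [norm_zero]; positivity

lemma exists_coeffBound_le {s : ℝ} (hs : 1 < s) :
    ∃ H, ∀ h, H ≤ h → ρ.coeffBound ≤ s ^ q Fq ^ h := by
  obtain ⟨H, hH⟩ := pow_unbounded_of_one_lt ρ.coeffBound hs
  refine ⟨H, fun h hh => hH.le.trans (pow_le_pow_right₀ hs.le ?_)⟩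
  exact hh.trans (Nat.lt_pow_self (one_lt_q Fq)).le

lemma exists_norm_expCoeff_le : ∃ R : ℝ, 0 < R ∧ ∀ h, ‖ρ.expCoeff h‖ ≤ R ^ q Fq ^ h := by
  obtain ⟨H, hH⟩ := ρ.exists_coeffBound_le (one_lt_norm_theta Fq)
  set R : ℝ := 1 + ∑ h ∈ Finset.range (H + 1), ‖ρ.expCoeff h‖ with hR
  have hR1 : 1 ≤ R := le_add_of_nonneg_right (Finset.sum_nonneg fun _ _ => norm_nonneg _)
  refine ⟨R, by linarith, fun h => ?_⟩
  induction h using Nat.strong_induction_on with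
  | _ h ih =>
    by_cases hh : h < H + 1
    · have := Finset.single_le_sum (f := fun h => ‖ρ.expCoeff h‖) (fun _ _ => norm_nonneg _)
        (Finset.mem_range.2 hh)
      calc ‖ρ.expCoeff h‖ ≤ R := by linarith
        _ ≤ _ := le_self_pow₀ hR1 (pow_ne_zero _ Fintype.card_ne_zero)
    · obtain ⟨h, rfl⟩ : ∃ h', h = h' + 1 := ⟨h - 1, by omega⟩
      have h1 := ρ.norm_expCoeff_succ_le (R := R) (by linarith) fun i hi => ih (h - i) (by omega)
      have h2 := hH (h + 1) (by omega)
      have h3 : 0 < ‖theta Fq‖ ^ q Fq ^ (h + 1) :=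
        pow_pos (one_pos.trans (one_lt_norm_theta Fq)) _
      refine le_of_mul_le_mul_right ?_ h3
      refine h1.trans ?_
      rw [mul_comm]
      gcongr

lemma eventually_norm_expCoeff_le_div {R s : ℝ} (hR : 0 < R) (hs : 1 < s) (hs2 : s * s = ‖theta Fq‖)
    (h : ∃ H, ∀ h, H ≤ h → ‖ρ.expCoeff h‖ ≤ R ^ q Fq ^ h) :
    ∃ H, ∀ h, H ≤ h → ‖ρ.expCoeff h‖ ≤ (R / s) ^ q Fq ^ h := by
  obtain ⟨H, hH⟩ := h
  obtain ⟨H', hH'⟩ := ρ.exists_coeffBound_le hs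
  refine ⟨H + H' + ρ.rank + 1, fun h hh => ?_⟩
  obtain ⟨h, rfl⟩ : ∃ h', h = h' + 1 := ⟨h - 1, by omega⟩
  have h1 := ρ.norm_expCoeff_succ_le (R := R) hR fun i hi => hH (h - i) (by omega)
  have h2 := hH' (h + 1) (by omega)
  have h3 : 0 < s ^ q Fq ^ (h + 1) := pow_pos (one_pos.trans hs) _
  rw [div_pow, le_div_iff₀ h3]
  refine le_of_mul_le_mul_right ?_ h3
  calc _ = ‖ρ.expCoeff (h + 1)‖ * ‖theta Fq‖ ^ q Fq ^ (h + 1) := by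
        rw [← hs2, mul_pow, mul_assoc]
    _ ≤ ρ.coeffBound * R ^ q Fq ^ (h + 1) := h1
    _ ≤ _ := by rw [mul_comm]; gcongr

lemma eventually_norm_expCoeff_le {R : ℝ} (hR : 0 < R) :
    ∃ H, ∀ h, H ≤ h → ‖ρ.expCoeff h‖ ≤ R ^ q Fq ^ h := by
  obtain ⟨R₀, hR₀, hb⟩ := ρ.exists_norm_expCoeff_le
  have hθ := one_lt_norm_theta Fq
  set s := Real.sqrt ‖theta Fq‖ with hs_def
  have hs2 : s * s = ‖theta Fq‖ := Real.mul_self_sqrt (norm_nonneg _)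
  have hs : 1 < s := by rw [hs_def]; exact Real.lt_sqrt_of_sq_lt (by simpa using hθ)
  have key : ∀ n : ℕ, ∃ H, ∀ h, H ≤ h → ‖ρ.expCoeff h‖ ≤ (R₀ / s ^ n) ^ q Fq ^ h := by
    intro n
    induction n with
    | zero => exact ⟨0, fun h _ => by simpa using hb h⟩
    | succ n ih =>
      have := ρ.eventually_norm_expCoeff_le_div (by positivity) hs hs2 ih
      rwa [div_div, ← pow_succ] at this
  obtain ⟨n, hn⟩ := pow_unbounded_of_one_lt (R₀ / R) hs
  obtain ⟨H, hH⟩ := key n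
  refine ⟨H, fun h hh => (hH h hh).trans ?_⟩
  have : R₀ / s ^ n ≤ R := by
    rw [div_lt_iff₀ hR] at hn
    rw [div_le_iff₀ (by positivity)]
    linarith
  gcongr

lemma summable_exp (z : CInf Fq) : Summable fun h => ρ.expCoeff h * z ^ q Fq ^ h := by
  obtain ⟨H, hH⟩ := ρ.eventually_norm_expCoeff_le (R := (2 * (‖z‖ + 1))⁻¹) (by positivity)
  refine Summable.of_norm_bounded_eventually_nat (g := fun h => (1 / 2 : ℝ) ^ h)
    (summable_geometric_of_lt_one (by norm_num) (by norm_num)) ?_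
  filter_upwards [Filter.eventually_ge_atTop H] with h hh
  have h1 : (2 * (‖z‖ + 1))⁻¹ * ‖z‖ ≤ 1 / 2 := by
    rw [inv_mul_le_iff₀ (by positivity)]
    linarith
  calc ‖ρ.expCoeff h * z ^ q Fq ^ h‖ ≤ (2 * (‖z‖ + 1))⁻¹ ^ q Fq ^ h * ‖z‖ ^ q Fq ^ h := by
        rw [norm_mul, norm_pow]
        gcongr
        exact hH h hh
    _ = ((2 * (‖z‖ + 1))⁻¹ * ‖z‖) ^ q Fq ^ h := (mul_pow _ _ _).symm
    _ ≤ (1 / 2) ^ q Fq ^ h := by gcongr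
    _ ≤ _ := pow_le_pow_of_le_one (by norm_num) (by norm_num) (Nat.lt_pow_self (one_lt_q Fq)).le

/-- The exponential function as an `F_q`-linear map. -/
def expLin : CInf Fq →ₗ[Fq] CInf Fq where
  toFun := ρ.Exp
  map_add' x y := by
    rw [Exp, Exp, Exp, ← (ρ.summable_exp x).tsum_add (ρ.summable_exp y)]
    refine tsum_congr fun h => ?_
    have := map_add (frobPow Fq h) x y
    simp only [frobPow_apply] at this
    rw [this, mul_add]
  map_smul' c x := by
    rw [Exp, Exp, RingHom.id_apply, Algebra.smul_def, Algebra.smul_def, ← tsum_mul_left]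
    refine tsum_congr fun h => ?_
    have := frobPow_algebraMap h c
    rw [frobPow_apply] at this
    rw [mul_pow, this]
    ring

lemma expLin_apply (z : CInf Fq) : ρ.expLin z = ρ.Exp z := rfl

lemma Exp_theta_mul (z : CInf Fq) : ρ.Exp (theta Fq * z) =
    theta Fq * ρ.Exp z + ∑ i : Fin ρ.rank, (ρ.κ i : CInf Fq) * ρ.Exp z ^ q Fq ^ ((i : ℕ) + 1) := by
  have h0 := (ρ.summable_exp z).hasSum
  have h1 : ∀ i : Fin ρ.rank, HasSum
      (fun h => if (i : ℕ) + 1 ≤ h then (ρ.κ i : CInf Fq) *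
        ρ.expCoeff (h - (i + 1)) ^ q Fq ^ ((i : ℕ) + 1) * z ^ q Fq ^ h else 0)
      ((ρ.κ i : CInf Fq) * ρ.Exp z ^ q Fq ^ ((i : ℕ) + 1)) := by
    intro i
    have h2 := (h0.map (frobPow Fq (i + 1)) (continuous_frobPow _)).mul_left (ρ.κ i : CInf Fq)
    rw [frobPow_apply] at h2
    have hinj : Function.Injective fun h : ℕ => h + ((i : ℕ) + 1) := fun a b h => by simpa using h
    refine (hinj.hasSum_iff ?_).1 (h2.congr_fun ?_)
    · intro h hh
      rw [if_neg]
      intro hle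
      exact hh ⟨h - (i + 1), by simp only; omega⟩
    · intro h
      simp only [Function.comp_apply, frobPow_apply]
      rw [if_pos (by omega), Nat.add_sub_cancel, mul_pow, ← pow_mul z, ← pow_add, mul_assoc]
  have h3 := (h0.mul_left (theta Fq)).add (hasSum_sum fun i (_ : i ∈ Finset.univ) => h1 i)
  refine Eq.trans ?_ h3.tsum_eq
  rw [Exp]
  refine tsum_congr fun h => ?_
  cases h with
  | zero => simp [expCoeff_zero]
  | succ h =>
    have h4 : ∑ i : Fin ρ.rank, (if (i : ℕ) + 1 ≤ h + 1 then (ρ.κ i : CInf Fq) *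
        ρ.expCoeff (h + 1 - (i + 1)) ^ q Fq ^ ((i : ℕ) + 1) * z ^ q Fq ^ (h + 1) else 0) =
        ((theta Fq ^ q Fq ^ (h + 1) - theta Fq) * ρ.expCoeff (h + 1)) * z ^ q Fq ^ (h + 1) := by
      rw [expCoeff_succ, Finset.sum_mul]
      refine Finset.sum_congr rfl fun i _ => ?_
      by_cases hi : (i : ℕ) ≤ h
      · rw [if_pos hi, if_pos (by omega), Nat.add_sub_add_right]
      · rw [if_neg hi, if_neg (by omega), zero_mul]
    rw [h4, mul_pow]
    ring

lemma exists_norm_Exp_sub_le : ∃ C : ℝ, 0 ≤ C ∧ ∀ z : CInf Fq, ‖z‖ ≤ 1 →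
    ‖ρ.Exp z - z‖ ≤ C * ‖z‖ ^ 2 := by
  have hb := (ρ.summable_exp 1).tendsto_atTop_zero.norm.bddAbove_range
  simp only [one_pow, mul_one] at hb
  obtain ⟨C, hC⟩ := hb
  have hC' : ∀ h, ‖ρ.expCoeff h‖ ≤ C := fun h => hC ⟨h, rfl⟩
  have hC0 : 0 ≤ C := (norm_nonneg _).trans (hC' 0)
  refine ⟨C, hC0, fun z hz => ?_⟩
  rw [Exp, (ρ.summable_exp z).tsum_eq_zero_add, expCoeff_zero]
  simp only [pow_zero, pow_one, one_mul, add_sub_cancel_left]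
  refine IsUltrametricDist.norm_tsum_le_of_forall_le_of_nonneg (by positivity) fun h => ?_
  rw [norm_mul, norm_pow]
  exact mul_le_mul (hC' _) (pow_le_pow_of_le_one (norm_nonneg _) hz (one_lt_q_pow h))
    (by positivity) hC0

end Exponential

section AndersonGeneratingFunctions

variable {Fq : Type u} [Field Fq] [Fintype Fq] (ρ : DrinfeldModule Fq)

/-- The Anderson generating function `∑ Exp(u/θ^{m+1}) t^m`. -/
def agf : CInf Fq →ₗ[Fq] (CInf Fq)⟦X⟧ where
  toFun u := PowerSeries.mk fun m => ρ.Exp (u / theta Fq ^ (m + 1))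
  map_add' x y := by
    ext m
    rw [map_add, PowerSeries.coeff_mk, PowerSeries.coeff_mk, PowerSeries.coeff_mk, add_div]
    exact ρ.expLin.map_add _ _
  map_smul' c x := by
    ext m
    rw [RingHom.id_apply, PowerSeries.coeff_smul, PowerSeries.coeff_mk, PowerSeries.coeff_mk,
      smul_div_assoc]
    exact ρ.expLin.map_smul _ _

lemma coeff_agf (m : ℕ) (u : CInf Fq) :
    PowerSeries.coeff m (ρ.agf u) = ρ.Exp (u / theta Fq ^ (m + 1)) :=
  PowerSeries.coeff_mk m fun m => ρ.Exp (u / theta Fq ^ (m + 1))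

lemma tendsto_div_theta_pow (u : CInf Fq) :
    Filter.Tendsto (fun m : ℕ => ‖u / theta Fq ^ (m + 1)‖) Filter.atTop (nhds 0) := by
  have h1 := (tendsto_pow_atTop_nhds_zero_of_lt_one (by positivity)
    (inv_lt_one_of_one_lt₀ (one_lt_norm_theta Fq))).comp (Filter.tendsto_add_atTop_nat 1)
  have h2 := h1.const_mul ‖u‖
  rw [mul_zero] at h2
  refine h2.congr fun m => ?_
  rw [norm_div, norm_pow, Function.comp_apply, inv_pow, div_eq_mul_inv]

lemma agf_sub_mem (u : CInf Fq) :
    ρ.agf u - PowerSeries.mk (fun m => u / theta Fq ^ (m + 1)) ∈ restrictedRing Fq ‖theta Fq‖ := by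
  obtain ⟨C, hC, hb⟩ := ρ.exists_norm_Exp_sub_le
  rw [mem_restrictedRing]
  have h0 := tendsto_div_theta_pow u
  have h1 : ∀ᶠ m in Filter.atTop, ‖u / theta Fq ^ (m + 1)‖ < 1 := h0.eventually_lt_const one_pos
  have h2 := h0.const_mul (C * ‖u‖)
  rw [mul_zero] at h2
  have hθ := one_lt_norm_theta Fq
  refine squeeze_zero' (.of_forall fun m => by positivity) ?_ h2
  filter_upwards [h1] with m hm
  rw [map_sub, coeff_agf, PowerSeries.coeff_mk]
  calc _ ≤ C * ‖u / theta Fq ^ (m + 1)‖ ^ 2 * ‖theta Fq‖ ^ m := by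
        gcongr; exact hb _ hm.le
    _ = C * (‖u / theta Fq ^ (m + 1)‖ * ‖theta Fq‖ ^ m) * ‖u / theta Fq ^ (m + 1)‖ := by ring
    _ ≤ _ := by
        gcongr
        rw [norm_div, norm_pow, div_mul_eq_mul_div, div_le_iff₀ (by positivity)]
        gcongr <;> simp [hθ.le]

lemma norm_coeff_agf_le (u : CInf Fq) : ∃ C : ℝ, 0 ≤ C ∧ ∀ᶠ m in Filter.atTop,
    ‖PowerSeries.coeff m (ρ.agf u)‖ ≤ C * ‖u / theta Fq ^ (m + 1)‖ := by
  obtain ⟨C, hC, hb⟩ := ρ.exists_norm_Exp_sub_le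
  have h1 : ∀ᶠ m in Filter.atTop, ‖u / theta Fq ^ (m + 1)‖ < 1 :=
    (tendsto_div_theta_pow u).eventually_lt_const one_pos
  refine ⟨C + 1, by positivity, ?_⟩
  filter_upwards [h1] with m hm
  rw [coeff_agf]
  set z := u / theta Fq ^ (m + 1)
  calc ‖ρ.Exp z‖ = ‖(ρ.Exp z - z) + z‖ := by rw [sub_add_cancel]
    _ ≤ ‖ρ.Exp z - z‖ + ‖z‖ := norm_add_le _ _
    _ ≤ C * ‖z‖ ^ 2 + ‖z‖ := by gcongr; exact hb z hm.le
    _ ≤ C * ‖z‖ + ‖z‖ := by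
        gcongr
        rw [sq]
        exact mul_le_of_le_one_left (norm_nonneg _) hm.le
    _ = _ := by ring

lemma agf_mem_tate (u : CInf Fq) : ρ.agf u ∈ tate Fq := by
  obtain ⟨C, hC, hb⟩ := ρ.norm_coeff_agf_le u
  rw [mem_tate, IsTate]
  have h2 := (tendsto_div_theta_pow u).const_mul C
  rw [mul_zero] at h2
  exact squeeze_zero' (.of_forall fun m => norm_nonneg _) hb h2

lemma map_frobPow_agf_mem (u : CInf Fq) (j : ℕ) :
    PowerSeries.map (frobPow Fq (j + 1)) (ρ.agf u) ∈ restrictedRing Fq ‖theta Fq‖ := by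
  obtain ⟨C, hC, hb⟩ := ρ.norm_coeff_agf_le u
  have h0 := tendsto_div_theta_pow u
  have h1 := mem_tate.1 (ρ.agf_mem_tate u)
  have h1' : ∀ᶠ m in Filter.atTop, ‖PowerSeries.coeff m (ρ.agf u)‖ < 1 :=
    Filter.Tendsto.eventually_lt_const one_pos h1
  rw [mem_restrictedRing]
  have hθ := one_lt_norm_theta Fq
  have h2 := Filter.Tendsto.const_mul (C * ‖u‖) h1
  rw [mul_zero] at h2
  refine squeeze_zero' (.of_forall fun m => by positivity) ?_ h2
  filter_upwards [hb, h1'] with m hm hm'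
  rw [PowerSeries.coeff_map, frobPow_apply, norm_pow]
  set y := ‖PowerSeries.coeff m (ρ.agf u)‖
  have hy : y ^ q Fq ^ (j + 1) ≤ y ^ 2 :=
    pow_le_pow_of_le_one (norm_nonneg _) hm'.le (one_lt_q_pow j)
  have hy0 : 0 ≤ y := norm_nonneg _
  calc _ ≤ y * y * ‖theta Fq‖ ^ m := by rw [← sq]; gcongr
    _ ≤ (C * ‖u / theta Fq ^ (m + 1)‖) * y * ‖theta Fq‖ ^ m := by gcongr
    _ = C * (‖u / theta Fq ^ (m + 1)‖ * ‖theta Fq‖ ^ m) * y := by ring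
    _ ≤ _ := by
        gcongr
        rw [norm_div, norm_pow, div_mul_eq_mul_div, div_le_iff₀ (by positivity)]
        gcongr <;> simp [hθ.le]

lemma agf_theta_mul (u : CInf Fq) :
    ρ.agf (theta Fq * u) = PowerSeries.X * ρ.agf u + PowerSeries.C (ρ.Exp u) := by
  have hθ := theta_ne_zero Fq
  ext m
  rw [map_add, coeff_agf, PowerSeries.coeff_C]
  cases m with
  | zero => simp [mul_div_cancel_left₀ _ hθ]
  | succ m =>
    rw [PowerSeries.coeff_succ_X_mul, coeff_agf, if_neg (by omega), add_zero]
    congr 1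
    rw [pow_succ' _ (m + 1), mul_div_mul_left _ _ hθ]

lemma agf_functional (u : CInf Fq) :
    (PowerSeries.X - PowerSeries.C (theta Fq)) * ρ.agf u + PowerSeries.C (ρ.Exp u) =
      ∑ i : Fin ρ.rank, PowerSeries.C (ρ.κ i : CInf Fq) *
        PowerSeries.map (frobPow Fq ((i : ℕ) + 1)) (ρ.agf u) := by
  have h := ρ.agf_theta_mul u
  rw [sub_mul, sub_add_eq_add_sub, ← h]
  ext m
  rw [map_sub, map_sum, coeff_agf, PowerSeries.coeff_C_mul, mul_div_assoc, Exp_theta_mul,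
    coeff_agf, add_sub_cancel_left]
  refine Finset.sum_congr rfl fun i _ => ?_
  rw [PowerSeries.coeff_C_mul, PowerSeries.coeff_map, coeff_agf, frobPow_apply]

end AndersonGeneratingFunctions

end DrinfeldModule

section Constants

variable {Fq : Type u} [Field Fq] [Fintype Fq]

lemma coe_frobKbar_symm (x : Kbar Fq) :
    (((frobKbar Fq).symm x : Kbar Fq) : CInf Fq) = (frobC Fq).symm (x : CInf Fq) := by
  rw [RingEquiv.eq_symm_apply]
  exact congrArg Subtype.val ((frobKbar Fq).apply_symm_apply x)

@[simp]
lemma polyToPowerSeries_C (x : Kbar Fq) :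
    polyToPowerSeries Fq (Polynomial.C x) = PowerSeries.C (x : CInf Fq) := by
  simp [polyToPowerSeries]

@[simp]
lemma polyToPowerSeries_X : polyToPowerSeries Fq Polynomial.X = PowerSeries.X := by
  simp [polyToPowerSeries]

@[simp]
lemma powerSeriesUntwist_C (x : CInf Fq) :
    powerSeriesUntwist Fq (PowerSeries.C x) = PowerSeries.C ((frobC Fq).symm x) := by
  simp [powerSeriesUntwist]

@[simp]
lemma powerSeriesUntwist_X : powerSeriesUntwist Fq PowerSeries.X = PowerSeries.X := by
  simp [powerSeriesUntwist]

lemma powerSeriesUntwist_map_frobPow (j : ℕ) (f : (CInf Fq)⟦X⟧) :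
    powerSeriesUntwist Fq (PowerSeries.map (frobPow Fq (j + 1)) f) =
      PowerSeries.map (frobPow Fq j) f := by
  ext m
  rw [powerSeriesUntwist, PowerSeries.coeff_map, PowerSeries.coeff_map, PowerSeries.coeff_map,
    frobPow_apply, frobPow_apply, pow_succ, pow_mul]
  exact frobC_symm_pow' _

lemma map_frobPow_zero (f : (CInf Fq)⟦X⟧) : PowerSeries.map (frobPow Fq 0) f = f := by
  ext m
  simp

variable (Fq) in
/-- The inclusion `F_q[t] → 𝕂[[t]]`. -/
def fqToPowerSeries : Fq[X] →+* (CInf Fq)⟦X⟧ :=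
  (Polynomial.coeToPowerSeries.ringHom).comp (Polynomial.mapRingHom (algebraMap Fq (CInf Fq)))

lemma fqToPowerSeries_apply (g : Fq[X]) :
    fqToPowerSeries Fq g = ((g.map (algebraMap Fq (CInf Fq)) : (CInf Fq)[X]) : (CInf Fq)⟦X⟧) := rfl

lemma fqToPowerSeries_mem (c : ℝ) (g : Fq[X]) : fqToPowerSeries Fq g ∈ restrictedRing Fq c :=
  coe_mem_restrictedRing c _

lemma coeff_fqToPowerSeries (g : Fq[X]) (m : ℕ) :
    PowerSeries.coeff m (fqToPowerSeries Fq g) = algebraMap Fq (CInf Fq) (g.coeff m) := by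
  rw [fqToPowerSeries_apply, Polynomial.coeff_coe, Polynomial.coeff_map]

lemma map_frobPow_fqToPowerSeries (j : ℕ) (g : Fq[X]) :
    PowerSeries.map (frobPow Fq j) (fqToPowerSeries Fq g) = fqToPowerSeries Fq g := by
  ext m
  rw [PowerSeries.coeff_map, coeff_fqToPowerSeries, frobPow_algebraMap]

lemma evalAt_fqToPowerSeries (c : ℝ) (a : CInf Fq) (ha : ‖a‖ ≤ c) (g : Fq[X]) :
    evalAt c a ha ⟨fqToPowerSeries Fq g, fqToPowerSeries_mem c g⟩ = Polynomial.aeval a g := by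
  refine (evalAt_coe c a ha _ _).trans ?_
  exact Polynomial.eval_map_algebraMap g a

lemma norm_algebraMap_le_one (c : Fq) : ‖algebraMap Fq (CInf Fq) c‖ ≤ 1 := by
  by_contra! h
  have h1 : ‖algebraMap Fq (CInf Fq) c‖ ^ q Fq = ‖algebraMap Fq (CInf Fq) c‖ := by
    rw [← norm_pow, ← map_pow, FiniteField.pow_card]
  have := pow_lt_pow_right₀ h (one_lt_q Fq)
  rw [h1, pow_one] at this
  exact lt_irrefl _ this

lemma one_le_norm_algebraMap {c : Fq} (hc : c ≠ 0) : 1 ≤ ‖algebraMap Fq (CInf Fq) c‖ := by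
  have h1 := norm_algebraMap_le_one (Fq := Fq) c⁻¹
  rw [map_inv₀, norm_inv] at h1
  have h2 : 0 < ‖algebraMap Fq (CInf Fq) c‖ := by simpa using hc
  rwa [inv_le_one₀ h2] at h1

/-- The elements of the Tate algebra which are fixed by the twist are the polynomials
over `F_q`. -/
lemma exists_fqToPowerSeries_eq {f : (CInf Fq)⟦X⟧} (hf : f ∈ tate Fq)
    (h : powerSeriesUntwist Fq f = f) : ∃ g : Fq[X], fqToPowerSeries Fq g = f := by
  have h1 : ∀ m, ∃ c : Fq, algebraMap Fq (CInf Fq) c = PowerSeries.coeff m f := by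
    intro m
    refine exists_algebraMap_eq_of_pow_eq ?_
    have h2 := congrArg (PowerSeries.coeff m) h
    rw [powerSeriesUntwist, PowerSeries.coeff_map] at h2
    conv_lhs => rw [← h2]
    exact frobC_symm_pow _
  choose c hc using h1
  have h2 : ∀ᶠ m in Filter.atTop, ‖PowerSeries.coeff m f‖ < 1 :=
    Filter.Tendsto.eventually_lt_const one_pos (mem_tate.1 hf)
  obtain ⟨N, hN⟩ := Filter.eventually_atTop.1 h2
  have h3 : ∀ m, N ≤ m → c m = 0 := by
    intro m hm
    by_contra h4
    exact (hN m hm).not_ge (hc m ▸ one_le_norm_algebraMap h4)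
  refine ⟨∑ m ∈ Finset.range N, Polynomial.monomial m (c m), ?_⟩
  ext m
  rw [coeff_fqToPowerSeries, ← hc, Polynomial.finsetSum_coeff]
  simp only [Polynomial.coeff_monomial]
  rw [Finset.sum_ite_eq']
  split_ifs with hm
  · rfl
  · rw [h3 m (by simpa using hm)]

end Constants

namespace DrinfeldModule

section Rows

variable {Fq : Type u} [Field Fq] [Fintype Fq] (ρ : DrinfeldModule Fq)

/-- The element `κ_{i+1}^{(-j)}`. -/
def rootCoeff (j : ℕ) (i : Fin ρ.rank) : CInf Fq := ((frobKbar Fq).symm^[j] (ρ.κ i) : Kbar Fq)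

lemma frobC_symm_rootCoeff (j : ℕ) (i : Fin ρ.rank) :
    (frobC Fq).symm (ρ.rootCoeff j i) = ρ.rootCoeff (j + 1) i := by
  rw [rootCoeff, rootCoeff, Function.iterate_succ_apply', coe_frobKbar_symm]

/-- The index of the last row. -/
def lastIdx : Fin ρ.rank := ⟨ρ.rank - 1, Nat.sub_lt ρ.rank_pos one_pos⟩

/-- The index of the first row. -/
def zeroIdx : Fin ρ.rank := ⟨0, ρ.rank_pos⟩

lemma rootCoeff_last_ne_zero (j : ℕ) : ρ.rootCoeff j ρ.lastIdx ≠ 0 := by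
  induction j with
  | zero =>
    intro h
    exact ρ.κ_top (Subtype.ext h)
  | succ j ih =>
    rw [← frobC_symm_rootCoeff]
    exact (map_ne_zero_iff _ (RingEquiv.injective _)).2 ih

/-- The row vector `s_u` of Anderson generating functions, with
`s_u^{(-1)} Φ_ρ = s_u - (Exp_ρ(u), 0, …, 0)`. -/
def srow : CInf Fq →+ (Fin ρ.rank → (CInf Fq)⟦X⟧) where
  toFun u j := ∑ i : Fin ρ.rank, if j ≤ i then PowerSeries.C (ρ.rootCoeff j i) *
    PowerSeries.map (frobPow Fq ((i : ℕ) + 1 - j)) (ρ.agf u) else 0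
  map_zero' := by
    funext j
    simp
  map_add' x y := by
    funext j
    rw [Pi.add_apply, ← Finset.sum_add_distrib]
    refine Finset.sum_congr rfl fun i _ => ?_
    split_ifs
    · rw [map_add, map_add, mul_add]
    · rw [add_zero]

lemma srow_apply (u : CInf Fq) (j : Fin ρ.rank) : ρ.srow u j =
    ∑ i : Fin ρ.rank, if j ≤ i then PowerSeries.C (ρ.rootCoeff j i) *
      PowerSeries.map (frobPow Fq ((i : ℕ) + 1 - j)) (ρ.agf u) else 0 := rfl

lemma srow_zeroIdx (u : CInf Fq) : ρ.srow u ρ.zeroIdx =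
    (PowerSeries.X - PowerSeries.C (theta Fq)) * ρ.agf u + PowerSeries.C (ρ.Exp u) := by
  rw [agf_functional, srow_apply]
  refine Finset.sum_congr rfl fun i _ => ?_
  rw [if_pos (show ρ.zeroIdx ≤ i from Nat.zero_le _)]
  rfl

lemma srow_mem_tate (u : CInf Fq) (j : Fin ρ.rank) : ρ.srow u j ∈ tate Fq := by
  rw [srow_apply]
  refine sum_mem fun i _ => ?_
  split_ifs
  · exact mul_mem (C_mem_restrictedRing _ _) (map_frobPow_mem_tate (ρ.agf_mem_tate u) _)
  · exact zero_mem _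

lemma srow_mem_restrictedRing (u : CInf Fq) (j : Fin ρ.rank) :
    ρ.srow u j ∈ restrictedRing Fq ‖theta Fq‖ := by
  rw [srow_apply]
  refine sum_mem fun i _ => ?_
  split_ifs with h
  · obtain ⟨m, hm⟩ : ∃ m, (i : ℕ) + 1 - j = m + 1 := ⟨i - j, by have : (j : ℕ) ≤ i := h; omega⟩
    rw [hm]
    exact mul_mem (C_mem_restrictedRing _ _) (ρ.map_frobPow_agf_mem u m)
  · exact zero_mem _

lemma evalAt_theta_srow (u : CInf Fq) :
    evalAt ‖theta Fq‖ (theta Fq) le_rfl ⟨_, ρ.srow_mem_restrictedRing u ρ.zeroIdx⟩ =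
      ρ.Exp u - u := by
  have hθ := theta_ne_zero Fq
  have h1 : (PowerSeries.X - PowerSeries.C (theta Fq)) *
      PowerSeries.mk (fun m => u / theta Fq ^ (m + 1)) = - PowerSeries.C u := by
    ext m
    rw [sub_mul, map_sub, PowerSeries.coeff_C_mul, PowerSeries.coeff_mk, map_neg,
      PowerSeries.coeff_C]
    cases m with
    | zero => simp [mul_div_cancel₀ _ hθ]
    | succ m =>
      rw [PowerSeries.coeff_succ_X_mul, PowerSeries.coeff_mk, if_neg (by omega),
        pow_succ' _ (m + 1), ← mul_div_assoc, mul_div_mul_left _ _ hθ, sub_self, neg_zero]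
  have h2 : (⟨_, ρ.srow_mem_restrictedRing u ρ.zeroIdx⟩ : restrictedRing Fq ‖theta Fq‖) =
      (⟨PowerSeries.X, X_mem_restrictedRing _⟩ - ⟨_, C_mem_restrictedRing _ (theta Fq)⟩) *
        ⟨_, ρ.agf_sub_mem u⟩ + ⟨_, C_mem_restrictedRing _ (ρ.Exp u - u)⟩ := by
    apply Subtype.ext
    simp only [Subring.coe_add, Subring.coe_mul, AddSubgroupClass.coe_sub]
    rw [srow_zeroIdx, mul_sub, h1, map_sub]
    ring
  rw [h2, map_add, map_mul, map_sub, evalAt_X, evalAt_C, evalAt_C, sub_self, zero_mul, zero_add]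

lemma phi_apply_eq (i j : Fin ρ.rank) : ρ.phi i j = (if (i : ℕ) + 1 = j then 1 else 0) +
    if i = ρ.lastIdx then (if (j : ℕ) = 0 then Polynomial.X - Polynomial.C (thetaBar Fq)
      else Polynomial.C (-((frobKbar Fq).symm^[j]
        (ρ.κ ⟨j - 1, (Nat.sub_le _ _).trans_lt j.2⟩)))) *
      Polynomial.C (((frobKbar Fq).symm^[ρ.rank] ρ.lead)⁻¹) else 0 := by
  have hi := i.2
  have hj := j.2
  by_cases h : (i : ℕ) + 1 < ρ.rank
  · have h1 : i ≠ ρ.lastIdx := by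
      intro h2
      rw [h2] at h
      simp only [lastIdx] at h
      omega
    rw [phi, if_pos h, if_neg h1, add_zero]
    simp only [eq_comm]
  · have h1 : i = ρ.lastIdx := Fin.ext (by simp only [lastIdx]; omega)
    have h2 : ¬ (i : ℕ) + 1 = j := by omega
    rw [phi, if_neg h, if_pos h1, if_neg h2, zero_add]
    split_ifs
    · rfl
    · rw [← Polynomial.C_mul]

lemma untwist_srow_last (u : CInf Fq) : powerSeriesUntwist Fq (ρ.srow u ρ.lastIdx) =
    PowerSeries.C (ρ.rootCoeff ρ.rank ρ.lastIdx) * ρ.agf u := by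
  have hr := ρ.rank_pos
  rw [srow_apply, Finset.sum_eq_single ρ.lastIdx, if_pos le_rfl, map_mul, powerSeriesUntwist_C,
    frobC_symm_rootCoeff]
  · have h1 : (ρ.lastIdx : ℕ) + 1 - ρ.lastIdx = 0 + 1 := by omega
    have h2 : (ρ.lastIdx : ℕ) + 1 = ρ.rank := by simp only [lastIdx]; omega
    rw [h1, powerSeriesUntwist_map_frobPow, map_frobPow_zero, h2]
  · intro i _ hi
    rw [if_neg]
    intro hle
    apply hi
    apply Fin.ext
    have : ρ.rank - 1 ≤ i := hle
    have := i.2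
    simp only [lastIdx]
    omega
  · simp

lemma untwist_srow (u : CInf Fq) (i : Fin ρ.rank) : powerSeriesUntwist Fq (ρ.srow u i) =
    ∑ l : Fin ρ.rank, if i ≤ l then PowerSeries.C (ρ.rootCoeff (i + 1) l) *
      PowerSeries.map (frobPow Fq ((l : ℕ) - i)) (ρ.agf u) else 0 := by
  rw [srow_apply, map_sum]
  refine Finset.sum_congr rfl fun l _ => ?_
  split_ifs with h
  · have h1 : (l : ℕ) + 1 - i = (l - i) + 1 := by have : (i : ℕ) ≤ l := h; omega
    rw [h1, map_mul, powerSeriesUntwist_map_frobPow, powerSeriesUntwist_C, frobC_symm_rootCoeff]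
  · rw [map_zero]

lemma srow_twist (u : CInf Fq) :
    (powerSeriesUntwist Fq ∘ ρ.srow u) ᵥ* ρ.phi.map (polyToPowerSeries Fq) =
      ρ.srow u - fun j : Fin ρ.rank => if (j : ℕ) = 0 then PowerSeries.C (ρ.Exp u) else 0 := by
  have hlead : PowerSeries.C (ρ.rootCoeff ρ.rank ρ.lastIdx) *
      polyToPowerSeries Fq (Polynomial.C (((frobKbar Fq).symm^[ρ.rank] ρ.lead)⁻¹)) = 1 := by
    rw [polyToPowerSeries_C, ← map_mul]
    have : ((((frobKbar Fq).symm^[ρ.rank] ρ.lead)⁻¹ : Kbar Fq) : CInf Fq) =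
        (ρ.rootCoeff ρ.rank ρ.lastIdx)⁻¹ := by
      rw [rootCoeff]; push_cast; rfl
    rw [this, mul_inv_cancel₀ (ρ.rootCoeff_last_ne_zero _), map_one]
  funext j
  rw [Pi.sub_apply, Matrix.vecMul, dotProduct]
  have h1 : ∀ i, (powerSeriesUntwist Fq ∘ ρ.srow u) i * ρ.phi.map (polyToPowerSeries Fq) i j =
      (if (i : ℕ) + 1 = j then powerSeriesUntwist Fq (ρ.srow u i) else 0) +
      if i = ρ.lastIdx then polyToPowerSeries Fq (if (j : ℕ) = 0 then
        Polynomial.X - Polynomial.C (thetaBar Fq) else Polynomial.C (-((frobKbar Fq).symm^[j]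
        (ρ.κ ⟨j - 1, (Nat.sub_le _ _).trans_lt j.2⟩)))) * ρ.agf u else 0 := by
    intro i
    rw [Matrix.map_apply, phi_apply_eq, map_add, mul_add, Function.comp_apply]
    congr 1
    · split_ifs <;> simp
    · by_cases hi : i = ρ.lastIdx
      · rw [if_pos hi, if_pos hi, hi, untwist_srow_last, map_mul]
        linear_combination (polyToPowerSeries Fq (if (j : ℕ) = 0 then
          Polynomial.X - Polynomial.C (thetaBar Fq) else Polynomial.C (-((frobKbar Fq).symm^[j]
          (ρ.κ ⟨j - 1, (Nat.sub_le _ _).trans_lt j.2⟩)))) * ρ.agf u) * hlead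
      · rw [if_neg hi, if_neg hi, map_zero, mul_zero]
  rw [Finset.sum_congr rfl fun i _ => h1 i, Finset.sum_add_distrib, Finset.sum_ite_eq',
    if_pos (Finset.mem_univ _)]
  by_cases hj : (j : ℕ) = 0
  · have hj' : j = ρ.zeroIdx := Fin.ext hj
    rw [if_pos hj, if_pos hj, Finset.sum_eq_zero, hj', srow_zeroIdx, map_sub, polyToPowerSeries_X,
      polyToPowerSeries_C]
    · simp [thetaBar]
    · intro i _
      rw [if_neg (by omega)]
  · rw [if_neg hj, if_neg hj, sub_zero, polyToPowerSeries_C]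
    obtain ⟨i, hi⟩ : ∃ i : Fin ρ.rank, (i : ℕ) + 1 = j := ⟨⟨j - 1, by omega⟩, by simp only; omega⟩
    have hi' : (⟨j - 1, (Nat.sub_le _ _).trans_lt j.2⟩ : Fin ρ.rank) = i :=
      Fin.ext (by simp only; omega)
    rw [Finset.sum_eq_single i, if_pos hi, untwist_srow, hi']
    · have h2 : ∀ l : Fin ρ.rank, (if i ≤ l then PowerSeries.C (ρ.rootCoeff (i + 1) l) *
          PowerSeries.map (frobPow Fq ((l : ℕ) - i)) (ρ.agf u) else 0) =
          (if l = i then PowerSeries.C (ρ.rootCoeff j i) * ρ.agf u else 0) +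
          (if j ≤ l then PowerSeries.C (ρ.rootCoeff j l) *
            PowerSeries.map (frobPow Fq ((l : ℕ) + 1 - j)) (ρ.agf u) else 0) := by
        intro l
        rw [hi]
        rcases lt_trichotomy l i with h | h | h
        · have h' : (l : ℕ) < i := h
          rw [if_neg (not_le.2 h), if_neg h.ne, if_neg, zero_add]
          intro h3
          have : (j : ℕ) ≤ l := h3
          omega
        · rw [if_pos h.ge, if_pos h, if_neg, add_zero, h, Nat.sub_self, map_frobPow_zero]
          intro h3
          have : (j : ℕ) ≤ l := h3
          rw [h] at this
          omega
        · have h' : (i : ℕ) < l := h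
          have h4 : (l : ℕ) + 1 - j = l - i := by omega
          rw [if_pos h.le, if_neg h.ne', if_pos, zero_add, h4]
          change (j : ℕ) ≤ l
          omega
      rw [Finset.sum_congr rfl fun l _ => h2 l, Finset.sum_add_distrib, Finset.sum_ite_eq',
        if_pos (Finset.mem_univ _), ← srow_apply]
      simp only [rootCoeff]
      push_cast
      rw [map_neg]
      ring
    · intro l _ hl
      rw [if_neg]
      intro h3
      exact hl (Fin.ext (by omega))
    · simp

lemma agf_aeval_mul (g : Fq[X]) {z : CInf Fq} (hz : z ∈ ρ.lattice) :
    ρ.Exp (Polynomial.aeval (theta Fq) g * z) = 0 ∧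
      ρ.agf (Polynomial.aeval (theta Fq) g * z) = fqToPowerSeries Fq g * ρ.agf z := by
  induction g using Polynomial.induction_on with
  | C a =>
    rw [Polynomial.aeval_C, ← Algebra.smul_def, map_smul]
    refine ⟨?_, ?_⟩
    · have := ρ.expLin.map_smul a z
      rw [expLin_apply, expLin_apply, show ρ.Exp z = 0 from hz, smul_zero] at this
      exact this
    · ext m
      rw [PowerSeries.coeff_smul, fqToPowerSeries_apply, Polynomial.map_C, Polynomial.coe_C,
        PowerSeries.coeff_C_mul, Algebra.smul_def]
  | add g h hg hh =>
    rw [map_add, add_mul, map_add, map_add, hg.2, hh.2, add_mul]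
    refine ⟨?_, rfl⟩
    have := ρ.expLin.map_add (Polynomial.aeval (theta Fq) g * z)
      (Polynomial.aeval (theta Fq) h * z)
    simp only [expLin_apply] at this
    rw [this, hg.1, hh.1, add_zero]
  | monomial n a ih =>
    have h1 : Polynomial.aeval (theta Fq) (Polynomial.C a * Polynomial.X ^ (n + 1)) * z =
        theta Fq * (Polynomial.aeval (theta Fq) (Polynomial.C a * Polynomial.X ^ n) * z) := by
      simp only [map_mul, map_pow, Polynomial.aeval_X]
      ring
    have hX : fqToPowerSeries Fq Polynomial.X = PowerSeries.X := by
      rw [fqToPowerSeries_apply, Polynomial.map_X, Polynomial.coe_X]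
    rw [h1]
    refine ⟨?_, ?_⟩
    · rw [Exp_theta_mul, ih.1, mul_zero, zero_add]
      refine Finset.sum_eq_zero fun i _ => ?_
      rw [zero_pow (pow_ne_zero _ Fintype.card_ne_zero), mul_zero]
    · rw [agf_theta_mul, ih.1, ih.2, map_zero, add_zero, pow_succ]
      simp only [map_mul, hX]
      ring

lemma srow_aeval_mul (g : Fq[X]) {z : CInf Fq} (hz : z ∈ ρ.lattice) (j : Fin ρ.rank) :
    ρ.srow (Polynomial.aeval (theta Fq) g * z) j = fqToPowerSeries Fq g * ρ.srow z j := by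
  rw [srow_apply, srow_apply, (ρ.agf_aeval_mul g hz).2, Finset.mul_sum]
  refine Finset.sum_congr rfl fun i _ => ?_
  split_ifs
  · rw [map_mul, map_frobPow_fqToPowerSeries]
    ring
  · rw [mul_zero]

end Rows

end DrinfeldModule

/-- A nonzero subspace which is stable under a Frobenius map contains a nonzero fixed vector. -/
lemma exists_fixed_vector {K ι : Type*} [Field K] [Fintype ι] (φ : K →+* K)
    (V : Submodule K (ι → K)) (hφ : ∀ x ∈ V, φ ∘ x ∈ V) (hV : V ≠ ⊥) :
    ∃ x ∈ V, x ≠ 0 ∧ φ ∘ x = x := by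
  classical
  obtain ⟨y, hy, hy0⟩ := Submodule.exists_mem_ne_zero_of_ne_bot hV
  have hex : ∃ n : ℕ, ∃ x ∈ V, x ≠ 0 ∧ (Finset.univ.filter fun i => x i ≠ 0).card = n :=
    ⟨_, y, hy, hy0, rfl⟩
  obtain ⟨x, hx, hx0, hn⟩ := Nat.find_spec hex
  obtain ⟨i₀, hi₀⟩ := Function.ne_iff.1 hx0
  have hi₀' : x i₀ ≠ 0 := hi₀
  set z := (x i₀)⁻¹ • x with hz
  have hzV : z ∈ V := V.smul_mem _ hx
  have hz1 : z i₀ = 1 := by simp [hz, hi₀']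
  have hzsupp : ∀ i, z i ≠ 0 → x i ≠ 0 := by
    intro i hi h
    simp [hz, h] at hi
  refine ⟨z, hzV, fun h => by simp [h] at hz1, ?_⟩
  by_contra hne
  have hmem : φ ∘ z - z ∈ V := V.sub_mem (hφ z hzV) hzV
  have hlt : (Finset.univ.filter fun i => (φ ∘ z - z) i ≠ 0).card <
      (Finset.univ.filter fun i => x i ≠ 0).card := by
    refine Finset.card_lt_card ⟨fun i hi => ?_, fun h => ?_⟩
    · rw [Finset.mem_filter] at hi ⊢
      refine ⟨Finset.mem_univ _, hzsupp i fun h => hi.2 ?_⟩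
      simp [h]
    · have := h (Finset.mem_filter.2 ⟨Finset.mem_univ i₀, hi₀'⟩)
      simp [hz1] at this
  exact Nat.find_min hex (hn ▸ hlt) ⟨_, hmem, sub_ne_zero.2 hne, rfl⟩

section Constants

variable {Fq : Type u} [Field Fq] [Fintype Fq]

lemma pow_aeval (j : ℕ) (a : CInf Fq) (g : Fq[X]) :
    Polynomial.aeval a g ^ q Fq ^ j = Polynomial.aeval (a ^ q Fq ^ j) g := by
  have h := Polynomial.hom_eval₂ g (algebraMap Fq (CInf Fq)) (frobPow Fq j) a
  rw [frobPow_apply, frobPow_apply] at h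
  rw [Polynomial.aeval_def, h, Polynomial.aeval_def]
  congr 1
  ext c
  exact frobPow_algebraMap j c

lemma exists_aeval_eq {a : CInf Fq} (ha : IsIntegral Fq a) {x : CInf Fq}
    (hx : x ∈ IntermediateField.adjoin Fq {a}) :
    ∃ g : Fq[X], g.degree < (minpoly Fq a).degree ∧ Polynomial.aeval a g = x := by
  have h1 : x ∈ Algebra.adjoin Fq {a} := by
    rw [← IntermediateField.adjoin_simple_toSubalgebra_of_isAlgebraic ha.isAlgebraic]
    exact hx
  rw [Algebra.adjoin_singleton_eq_range_aeval] at h1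
  obtain ⟨g, hg⟩ := h1
  refine ⟨g %ₘ minpoly Fq a, Polynomial.degree_modByMonic_lt _ (minpoly.monic ha), ?_⟩
  rw [← hg]
  have := congrArg (Polynomial.aeval a) (Polynomial.modByMonic_add_div g (minpoly Fq a))
  rw [map_add, map_mul, minpoly.aeval, zero_mul, add_zero] at this
  exact this

lemma card_adjoin {a : CInf Fq} (ha : IsIntegral Fq a) :
    Nat.card (IntermediateField.adjoin Fq {a}) = q Fq ^ (minpoly Fq a).natDegree := by
  have := IntermediateField.adjoin.finiteDimensional ha
  have h := Module.natCard_eq_pow_finrank (K := Fq) (V := IntermediateField.adjoin Fq {a})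
  rwa [IntermediateField.adjoin.finrank ha, Nat.card_eq_fintype_card (α := Fq)] at h

lemma pow_card_adjoin {a : CInf Fq} (ha : IsIntegral Fq a) {x : CInf Fq}
    (hx : x ∈ IntermediateField.adjoin Fq {a}) :
    x ^ q Fq ^ (minpoly Fq a).natDegree = x := by
  have := IntermediateField.adjoin.finiteDimensional ha
  have : Finite (IntermediateField.adjoin Fq {a}) := Module.finite_of_finite Fq
  have : Fintype (IntermediateField.adjoin Fq {a}) := Fintype.ofFinite _
  rw [← card_adjoin ha, Nat.card_eq_fintype_card]
  exact congrArg Subtype.val (FiniteField.pow_card (⟨x, hx⟩ : IntermediateField.adjoin Fq {a}))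

lemma card_roots_pow_sub_le (N : ℕ) (hN : 1 < N) (s : Finset (CInf Fq))
    (hs : ∀ x ∈ s, x ^ N = x) : s.card ≤ N := by
  have hne : (Polynomial.X ^ N - Polynomial.X : (CInf Fq)[X]) ≠ 0 :=
    FiniteField.X_pow_card_sub_X_ne_zero _ hN
  have hdeg := FiniteField.X_pow_card_sub_X_natDegree_eq (CInf Fq) hN
  rw [← hdeg]
  refine Polynomial.card_le_degree_of_subset_roots ?_
  intro x hx
  rw [Finset.mem_val] at hx
  rw [Polynomial.mem_roots hne]
  simp [Polynomial.IsRoot, hs x hx]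

lemma mem_adjoin_of_pow_eq {a : CInf Fq} (ha : IsIntegral Fq a) {x : CInf Fq}
    (hx : x ^ q Fq ^ (minpoly Fq a).natDegree = x) : x ∈ IntermediateField.adjoin Fq {a} := by
  classical
  by_contra hmem
  have := IntermediateField.adjoin.finiteDimensional ha
  have hfin : Finite (IntermediateField.adjoin Fq {a}) := Module.finite_of_finite Fq
  have hfin' : (IntermediateField.adjoin Fq {a} : Set (CInf Fq)).Finite := hfin
  have hd : (minpoly Fq a).natDegree ≠ 0 := (minpoly.natDegree_pos ha).ne'
  have h1 := card_roots_pow_sub_le (q Fq ^ (minpoly Fq a).natDegree)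
    (Nat.one_lt_pow hd (one_lt_q Fq)) (insert x hfin'.toFinset) (by
      intro y hy
      rcases Finset.mem_insert.1 hy with rfl | hy
      · exact hx
      · exact pow_card_adjoin ha (hfin'.mem_toFinset.1 hy))
  rw [Finset.card_insert_of_notMem (fun h => hmem (hfin'.mem_toFinset.1 h)),
    ← Set.ncard_eq_toFinset_card _ hfin'] at h1
  have h2 : (IntermediateField.adjoin Fq {a} : Set (CInf Fq)).ncard =
    q Fq ^ (minpoly Fq a).natDegree := card_adjoin ha
  omega

lemma conjugates_injective {a : CInf Fq} (ha : IsIntegral Fq a) {i j : ℕ}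
    (hj : j < (minpoly Fq a).natDegree) (hij : i < j) : a ^ q Fq ^ i ≠ a ^ q Fq ^ j := by
  intro h
  have h1 : a ^ q Fq ^ (j - i) = a := by
    apply (frobPow Fq i).injective
    rw [frobPow_apply, frobPow_apply, ← pow_mul, ← pow_add, Nat.sub_add_cancel hij.le, h]
  have := IntermediateField.adjoin.finiteDimensional ha
  have hfin : Finite (IntermediateField.adjoin Fq {a}) := Module.finite_of_finite Fq
  have hfin' : (IntermediateField.adjoin Fq {a} : Set (CInf Fq)).Finite := hfin
  have h2 := card_roots_pow_sub_le (q Fq ^ (j - i)) (Nat.one_lt_pow (by omega) (one_lt_q Fq))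
    hfin'.toFinset (by
      intro y hy
      obtain ⟨g, -, rfl⟩ := exists_aeval_eq ha (hfin'.mem_toFinset.1 hy)
      rw [pow_aeval, h1])
  rw [← Set.ncard_eq_toFinset_card _ hfin'] at h2
  have h3 : (IntermediateField.adjoin Fq {a} : Set (CInf Fq)).ncard =
    q Fq ^ (minpoly Fq a).natDegree := card_adjoin ha
  rw [h3] at h2
  have := Nat.pow_lt_pow_right (one_lt_q Fq) (show j - i < (minpoly Fq a).natDegree by omega)
  omega

lemma norm_le_one_of_isIntegral {a : CInf Fq} (ha : IsIntegral Fq a) : ‖a‖ ≤ 1 := by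
  by_contra! h
  have h1 := pow_card_adjoin ha (IntermediateField.mem_adjoin_simple_self Fq a)
  have hd : (minpoly Fq a).natDegree ≠ 0 := (minpoly.natDegree_pos ha).ne'
  have h2 := pow_lt_pow_right₀ h (Nat.one_lt_pow hd (one_lt_q Fq))
  rw [pow_one, ← norm_pow, h1] at h2
  exact lt_irrefl _ h2

lemma aeval_theta_ne_zero {g : Fq[X]} (hg : g ≠ 0) : Polynomial.aeval (theta Fq) g ≠ 0 := by
  intro h
  have : IsAlgebraic Fq (theta Fq) := ⟨g, hg, h⟩
  exact (norm_le_one_of_isIntegral this.isIntegral).not_gt (one_lt_norm_theta Fq)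

variable (Fq) in
/-- `f ↦ f^{(-1)}` on the Tate algebra. -/
def tateUntwist : tate Fq →+* tate Fq :=
  ((powerSeriesUntwist Fq).comp (tate Fq).subtype).codRestrict _ fun f => untwist_mem_tate f.2

lemma coe_tateUntwist (f : tate Fq) :
    (tateUntwist Fq f : (CInf Fq)⟦X⟧) = powerSeriesUntwist Fq f := rfl

variable (Fq) in
/-- The inclusion of `k̄[t]` in the Tate algebra. -/
def polyToTate : (Kbar Fq)[X] →+* tate Fq :=
  (polyToPowerSeries Fq).codRestrict _ (polyToPowerSeries_mem 1)

lemma coe_polyToTate (f : (Kbar Fq)[X]) :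
    (polyToTate Fq f : (CInf Fq)⟦X⟧) = polyToPowerSeries Fq f := rfl

lemma evalAt_polyToTate (a : CInf Fq) (ha : ‖a‖ ≤ 1) (p : (Kbar Fq)[X]) :
    evalAt 1 a ha (polyToTate Fq p) = (p.map (algebraMap (Kbar Fq) (CInf Fq))).eval a :=
  evalAt_coe 1 a ha _ _

lemma norm_pow_le_one {a : CInf Fq} (ha : ‖a‖ ≤ 1) (n : ℕ) : ‖a ^ n‖ ≤ 1 := by
  rw [norm_pow]
  exact pow_le_one₀ (norm_nonneg _) ha

lemma evalAt_tateUntwist_pow (a : CInf Fq) (ha : ‖a‖ ≤ 1) (f : tate Fq) :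
    evalAt 1 a ha (tateUntwist Fq f) ^ q Fq = evalAt 1 (a ^ q Fq) (norm_pow_le_one ha _) f := by
  have h1 := ((summable_coeff_mul_pow ha (tateUntwist Fq f).2).hasSum.map (frobPow Fq 1)
    (continuous_frobPow 1)).tsum_eq
  rw [frobPow_apply, pow_one] at h1
  refine h1.symm.trans (tsum_congr fun m => ?_)
  rw [Function.comp_apply, frobPow_apply, pow_one, mul_pow, coe_tateUntwist, powerSeriesUntwist,
    PowerSeries.coeff_map, ← pow_mul, ← pow_mul, mul_comm m]
  congr 1
  exact frobC_symm_pow _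

/-- A solution of `c (t - θ) D^{(-1)} = D` in the Tate algebra is `Ω⁻¹` times a multiple of a
polynomial over `F_q`. -/
lemma exists_eq_of_untwist_eq {W W' D : (CInf Fq)⟦X⟧} (hW : W ∈ tate Fq) (hWW' : W * W' = 1)
    (hWu : powerSeriesUntwist Fq W = (PowerSeries.X - PowerSeries.C (theta Fq)) * W)
    (hD : D ∈ tate Fq) {c : CInf Fq} (hc : c ≠ 0)
    (hDu : powerSeriesUntwist Fq D * (PowerSeries.C c *
      (PowerSeries.X - PowerSeries.C (theta Fq))) = D) :
    ∃ (b : CInf Fq) (g : Fq[X]), b ≠ 0 ∧ D = PowerSeries.C b * W' * fqToPowerSeries Fq g := by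
  set G := D * W with hG
  have hGD : G * W' = D := by rw [hG, mul_assoc, hWW', mul_one]
  have hGT : G ∈ tate Fq := mul_mem hD hW
  have hGu : PowerSeries.C c * powerSeriesUntwist Fq G = G := by
    rw [hG, map_mul, hWu]
    linear_combination W * hDu
  by_cases h0 : G = 0
  · exact ⟨1, 0, one_ne_zero, by rw [← hGD, h0, map_zero]; ring⟩
  obtain ⟨m, hm⟩ : ∃ m, PowerSeries.coeff m G ≠ 0 := by
    by_contra! h
    exact h0 (PowerSeries.ext fun m => by rw [h m, map_zero])
  set b := PowerSeries.coeff m G with hb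
  have hbu : c * (frobC Fq).symm b = b := by
    have := congrArg (PowerSeries.coeff m) hGu
    rw [PowerSeries.coeff_C_mul, powerSeriesUntwist, PowerSeries.coeff_map] at this
    exact this
  have hH : powerSeriesUntwist Fq (PowerSeries.C b⁻¹ * G) = PowerSeries.C b⁻¹ * G := by
    have hcb : (frobC Fq).symm b⁻¹ = b⁻¹ * c := by
      rw [map_inv₀]
      nth_rewrite 2 [← hbu]
      field_simp
    rw [map_mul, powerSeriesUntwist_C, hcb, map_mul, mul_assoc, hGu]
  obtain ⟨g, hg⟩ := exists_fqToPowerSeries_eq (mul_mem (C_mem_restrictedRing _ _) hGT) hH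
  refine ⟨b, g, hm, ?_⟩
  rw [hg, ← hGD]
  have : PowerSeries.C b * PowerSeries.C b⁻¹ = (1 : (CInf Fq)⟦X⟧) := by
    rw [← map_mul, mul_inv_cancel₀ hm, map_one]
  linear_combination (-(G * W')) * this

end Constants

namespace DrinfeldModule

variable {Fq : Type u} [Field Fq] [Fintype Fq] (ρ : DrinfeldModule Fq)

lemma exists_phi_det_eq : ∃ c : Kbar Fq, c ≠ 0 ∧
    ρ.phi.det = Polynomial.C c * (Polynomial.X - Polynomial.C (thetaBar Fq)) := by
  let M : Matrix (Fin ρ.rank) (Fin ρ.rank) (Kbar Fq) := fun i j =>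
    if (i : ℕ) + 1 < ρ.rank then
      if (j : ℕ) = i + 1 then 1 else 0
    else if (j : ℕ) = 0 then ((frobKbar Fq).symm^[ρ.rank] ρ.lead)⁻¹
    else -((frobKbar Fq).symm^[j] (ρ.κ ⟨j - 1, (Nat.sub_le _ _).trans_lt j.2⟩)) *
        ((frobKbar Fq).symm^[ρ.rank] ρ.lead)⁻¹
  have h1 : ρ.phi = Matrix.updateCol (M.map Polynomial.C) ρ.zeroIdx
      ((Polynomial.X - Polynomial.C (thetaBar Fq)) • fun i => M.map Polynomial.C i ρ.zeroIdx) := by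
    ext1 i j
    rw [Matrix.updateCol_apply]
    by_cases hj : j = ρ.zeroIdx
    · rw [if_pos hj, Pi.smul_apply, smul_eq_mul, Matrix.map_apply, hj]
      by_cases hi : (i : ℕ) + 1 < ρ.rank <;> simp [phi, M, hi, zeroIdx]
    · have hj' : (j : ℕ) ≠ 0 := fun h => hj (Fin.ext h)
      rw [if_neg hj, Matrix.map_apply]
      by_cases hi : (i : ℕ) + 1 < ρ.rank
      · by_cases hij : (j : ℕ) = i + 1 <;> simp [phi, M, hi, hij]
      · simp [phi, M, hi, hj']
  have h2 : ρ.phi.det = Polynomial.C M.det * (Polynomial.X - Polynomial.C (thetaBar Fq)) := by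
    rw [h1, Matrix.det_updateCol_smul]
    have : Matrix.updateCol (M.map Polynomial.C) ρ.zeroIdx
        (fun i => M.map Polynomial.C i ρ.zeroIdx) = M.map Polynomial.C :=
      Matrix.updateCol_eq_self _ _
    rw [this, ← RingHom.mapMatrix_apply, ← RingHom.map_det, mul_comm]
  refine ⟨M.det, fun h => ρ.phi_det_ne_zero ?_, h2⟩
  rw [h2, h, map_zero, zero_mul]

section Lattice

variable {ρ} {ω : Fin ρ.rank → CInf Fq}

lemma IsPeriodBasis.mem_lattice (hω : ρ.IsPeriodBasis ω) (i : Fin ρ.rank) : ω i ∈ ρ.lattice := by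
  rw [← hω.2]
  exact Submodule.subset_span ⟨i, rfl⟩

lemma IsPeriodBasis.exists_eq_sum (hω : ρ.IsPeriodBasis ω) {z : CInf Fq} (hz : z ∈ ρ.lattice) :
    ∃ g : Fin ρ.rank → Fq[X], z = ∑ i, Polynomial.aeval (theta Fq) (g i) * ω i := by
  rw [← hω.2, SetLike.mem_coe, Submodule.mem_span_range_iff_exists_fun] at hz
  obtain ⟨c, hc⟩ := hz
  have h1 : ∀ i, ∃ g : Fq[X], Polynomial.aeval (theta Fq) g = (c i : CInf Fq) := by
    intro i
    have h2 : (c i : CInf Fq) ∈ Algebra.adjoin Fq {theta Fq} := (c i).2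
    rw [Algebra.adjoin_singleton_eq_range_aeval] at h2
    exact h2
  choose g hg using h1
  refine ⟨g, ?_⟩
  rw [← hc]
  refine Finset.sum_congr rfl fun i _ => ?_
  rw [hg]
  rfl

lemma IsPeriodBasis.eq_zero_of_sum_eq_zero (hω : ρ.IsPeriodBasis ω) {g : Fin ρ.rank → Fq[X]}
    (hg : ∑ i, Polynomial.aeval (theta Fq) (g i) * ω i = 0) (i : Fin ρ.rank) : g i = 0 := by
  have h1 := Fintype.linearIndependent_iff.1 hω.1 (fun i => ⟨Polynomial.aeval (theta Fq) (g i), by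
    rw [polyRing, Algebra.adjoin_singleton_eq_range_aeval]; exact ⟨g i, rfl⟩⟩) hg i
  by_contra h
  exact aeval_theta_ne_zero h (congrArg Subtype.val h1)

lemma IsPeriodBasis.sum_mem_lattice (hω : ρ.IsPeriodBasis ω) (g : Fin ρ.rank → Fq[X]) :
    ∑ i, Polynomial.aeval (theta Fq) (g i) * ω i ∈ ρ.lattice := by
  have h : ρ.expLin (∑ i, Polynomial.aeval (theta Fq) (g i) * ω i) = 0 := by
    rw [map_sum]
    exact Finset.sum_eq_zero fun i _ => (ρ.agf_aeval_mul (g i) (hω.mem_lattice i)).1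
  exact h

end Lattice

end DrinfeldModule

namespace DrinfeldModule

variable {Fq : Type u} [Field Fq] [Fintype Fq] (ρ : DrinfeldModule Fq)

/-- The row vector `s_u` over the Tate algebra. -/
def tateRow (u : CInf Fq) (j : Fin ρ.rank) : tate Fq := ⟨ρ.srow u j, ρ.srow_mem_tate u j⟩

lemma tateRow_twist {u : CInf Fq} (hu : ρ.Exp u = 0) :
    (tateUntwist Fq ∘ ρ.tateRow u) ᵥ* ρ.phi.map (polyToTate Fq) = ρ.tateRow u := by
  funext j
  apply Subtype.ext
  have h := congrFun (ρ.srow_twist u) j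
  rw [hu, Pi.sub_apply, map_zero, ite_self, sub_zero] at h
  rw [Matrix.vecMul, dotProduct] at h ⊢
  refine Eq.trans ?_ h
  rw [AddSubmonoidClass.coe_finsetSum]
  rfl

/-- The matrix with the rows `s_{ω_i}`. -/
def periodMatrix (ω : Fin ρ.rank → CInf Fq) : Matrix (Fin ρ.rank) (Fin ρ.rank) (tate Fq) :=
  Matrix.of fun i => ρ.tateRow (ω i)

lemma periodMatrix_twist {ω : Fin ρ.rank → CInf Fq} (hω : ρ.IsPeriodBasis ω) :
    (ρ.periodMatrix ω).map (tateUntwist Fq) * ρ.phi.map (polyToTate Fq) = ρ.periodMatrix ω := by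
  ext1 i j
  exact congrFun (ρ.tateRow_twist (hω.mem_lattice i)) j

lemma isUnit_phi_eval {b : CInf Fq} (hb : ‖b‖ ≤ 1) :
    IsUnit ((ρ.phi.map (polyToTate Fq)).map (evalAt 1 b hb)) := by
  rw [Matrix.isUnit_iff_isUnit_det, isUnit_iff_ne_zero, ← RingHom.mapMatrix_apply,
    ← RingHom.mapMatrix_apply, ← RingHom.map_det, ← RingHom.map_det]
  obtain ⟨c, hc, h⟩ := ρ.exists_phi_det_eq
  rw [h, evalAt_polyToTate]
  simp only [Polynomial.map_mul, Polynomial.map_C, Polynomial.map_sub, Polynomial.map_X,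
    Polynomial.eval_mul, Polynomial.eval_C, Polynomial.eval_sub, Polynomial.eval_X]
  refine mul_ne_zero (by simpa using hc) (sub_ne_zero.2 ?_)
  rintro rfl
  exact hb.not_gt (one_lt_norm_theta Fq)

lemma vecMul_periodMatrix_eval_pow {ω : Fin ρ.rank → CInf Fq} (hω : ρ.IsPeriodBasis ω)
    {b : CInf Fq} (hb : ‖b‖ ≤ 1) {x : Fin ρ.rank → CInf Fq}
    (hx : x ᵥ* (ρ.periodMatrix ω).map (evalAt 1 b hb) = 0) :
    (fun i => x i ^ q Fq) ᵥ*
      (ρ.periodMatrix ω).map (evalAt 1 (b ^ q Fq) (norm_pow_le_one hb _)) = 0 := by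
  have h1 : (ρ.periodMatrix ω).map (evalAt 1 b hb) =
      ((ρ.periodMatrix ω).map (tateUntwist Fq)).map (evalAt 1 b hb) *
        (ρ.phi.map (polyToTate Fq)).map (evalAt 1 b hb) := by
    rw [← Matrix.map_mul, periodMatrix_twist _ hω]
  rw [h1, ← Matrix.vecMul_vecMul] at hx
  have h2 : x ᵥ* ((ρ.periodMatrix ω).map (tateUntwist Fq)).map (evalAt 1 b hb) = 0 :=
    Matrix.vecMul_injective_of_isUnit (ρ.isUnit_phi_eval hb) (hx.trans (Matrix.zero_vecMul _).symm)
  funext j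
  have h3 := congrArg (frobPow Fq 1) (congrFun h2 j)
  rw [Matrix.vecMul, dotProduct, map_sum, Pi.zero_apply, map_zero] at h3
  rw [Matrix.vecMul, dotProduct, Pi.zero_apply]
  refine Eq.trans (Finset.sum_congr rfl fun i _ => ?_) h3
  rw [Matrix.map_apply, Matrix.map_apply, Matrix.map_apply, frobPow_apply, pow_one, mul_pow,
    evalAt_tateUntwist_pow]

lemma vecMul_periodMatrix_eval_pow_pow {ω : Fin ρ.rank → CInf Fq} (hω : ρ.IsPeriodBasis ω)
    {a : CInf Fq} (ha : ‖a‖ ≤ 1) {x : Fin ρ.rank → CInf Fq}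
    (hx : x ᵥ* (ρ.periodMatrix ω).map (evalAt 1 a ha) = 0) (j : ℕ) :
    ∀ (b : CInf Fq) (hb : ‖b‖ ≤ 1), b = a ^ q Fq ^ j →
      (fun i => x i ^ q Fq ^ j) ᵥ* (ρ.periodMatrix ω).map (evalAt 1 b hb) = 0 := by
  induction j with
  | zero =>
    intro b hb h
    obtain rfl : b = a := by simpa using h
    simpa using hx
  | succ j ih =>
    intro b hb h
    have h1 := ρ.vecMul_periodMatrix_eval_pow hω _ (ih _ (norm_pow_le_one ha (q Fq ^ j)) rfl)
    simp only [← pow_mul, ← pow_succ] at h1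
    subst h
    exact h1

/-- If `p ∈ F_q[t]` is the minimal polynomial of `a` and the generating function of `λ` vanishes
at all conjugates of `a`, then `λ` is divisible by `p` in the period lattice. -/
lemma div_mem_lattice_of_agf_eval_eq_zero {a : CInf Fq} (ha : IsIntegral Fq a) {z : CInf Fq}
    (hz : ∀ (j : ℕ) (b : CInf Fq) (hb : ‖b‖ ≤ 1), b = a ^ q Fq ^ j →
      evalAt 1 b hb ⟨_, ρ.agf_mem_tate z⟩ = 0) :
    z / Polynomial.aeval (theta Fq) (minpoly Fq a) ∈ ρ.lattice := by
  set p := minpoly Fq a with hp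
  have hpm : p.Monic := minpoly.monic ha
  have hp0 : Polynomial.aeval (theta Fq) p ≠ 0 := aeval_theta_ne_zero hpm.ne_zero
  have hθ := theta_ne_zero Fq
  set v := z / Polynomial.aeval (theta Fq) p with hv
  have hzv : z = Polynomial.aeval (theta Fq) p * v := by rw [hv, mul_div_cancel₀ _ hp0]
  set d := p.natDegree with hd
  have hd0 : 0 < d := minpoly.natDegree_pos ha
  set P : (CInf Fq)⟦X⟧ := fqToPowerSeries Fq p * ρ.agf v - ρ.agf z with hP
  have h1 : ∀ m, PowerSeries.coeff m (fqToPowerSeries Fq p * ρ.agf v) =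
      ∑ n ∈ Finset.range (d + 1), if n ≤ m then
        ρ.expLin (p.coeff n • (theta Fq ^ n * v / theta Fq ^ (m + 1))) else 0 := by
    intro m
    have h2 : fqToPowerSeries Fq p = ∑ n ∈ Finset.range (d + 1),
        PowerSeries.C (algebraMap Fq (CInf Fq) (p.coeff n)) * PowerSeries.X ^ n := by
      conv_lhs => rw [p.as_sum_range_C_mul_X_pow, map_sum]
      refine Finset.sum_congr rfl fun n _ => ?_
      rw [fqToPowerSeries_apply]
      simp
    rw [h2, Finset.sum_mul, map_sum]
    refine Finset.sum_congr rfl fun n _ => ?_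
    rw [mul_assoc, PowerSeries.coeff_C_mul, PowerSeries.coeff_X_pow_mul', mul_ite, mul_zero]
    split_ifs with hn
    · have h3 : m + 1 = n + (m - n + 1) := by omega
      rw [map_smul, Algebra.smul_def, coeff_agf, expLin_apply, h3, pow_add _ n,
        mul_div_mul_left _ _ (pow_ne_zero _ hθ)]
    · rfl
  have h3 : ∀ m, PowerSeries.coeff m (ρ.agf z) = ∑ n ∈ Finset.range (d + 1),
        ρ.expLin (p.coeff n • (theta Fq ^ n * v / theta Fq ^ (m + 1))) := by
    intro m
    rw [coeff_agf, ← expLin_apply, ← map_sum, hzv, Polynomial.aeval_eq_sum_range, Finset.sum_mul,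
      Finset.sum_div]
    congr 1
    refine Finset.sum_congr rfl fun n _ => ?_
    rw [smul_mul_assoc, smul_div_assoc]
  have h4 : ∀ m, d ≤ m → PowerSeries.coeff m P = 0 := by
    intro m hm
    rw [hP, map_sub, h1, h3, sub_eq_zero]
    refine Finset.sum_congr rfl fun n hn => ?_
    rw [if_pos ((Nat.lt_succ_iff.1 (Finset.mem_range.1 hn)).trans hm)]
  have h5 : PowerSeries.coeff (d - 1) P = - ρ.Exp v := by
    rw [hP, map_sub, h1, h3, Finset.sum_range_succ, Finset.sum_range_succ _ d,
      if_neg (by omega), Nat.sub_add_cancel hd0, hpm.coeff_natDegree, one_smul,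
      mul_div_cancel_left₀ _ (pow_ne_zero _ hθ), expLin_apply]
    rw [Finset.sum_congr rfl fun n hn => if_pos (show n ≤ d - 1 by
      have := Finset.mem_range.1 hn; omega)]
    ring
  have hPtr : P = (PowerSeries.trunc d P : (CInf Fq)[X]) := by
    ext m
    rw [Polynomial.coeff_coe, PowerSeries.coeff_trunc]
    split_ifs with hm
    · rfl
    · exact h4 m (not_lt.1 hm)
  have hconj : ∀ j, ‖a ^ q Fq ^ j‖ ≤ 1 := fun j => norm_pow_le_one (norm_le_one_of_isIntegral ha) _
  have hroot : ∀ j, (PowerSeries.trunc d P).eval (a ^ q Fq ^ j) = 0 := by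
    intro j
    have hmem : (PowerSeries.trunc d P : (CInf Fq)⟦X⟧) ∈ restrictedRing Fq 1 :=
      coe_mem_restrictedRing 1 _
    rw [← evalAt_coe 1 _ (hconj j) _ hmem]
    have h6 : (⟨_, hmem⟩ : tate Fq) = ⟨_, fqToPowerSeries_mem 1 p⟩ * ⟨_, ρ.agf_mem_tate v⟩ -
        ⟨_, ρ.agf_mem_tate z⟩ := Subtype.ext hPtr.symm
    rw [h6, map_sub, map_mul, hz j _ _ rfl, evalAt_fqToPowerSeries, ← pow_aeval, hp, minpoly.aeval,
      zero_pow (pow_ne_zero _ Fintype.card_ne_zero), zero_mul, sub_zero]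
  have hinj : Function.Injective fun j : Fin d => a ^ q Fq ^ (j : ℕ) := by
    intro i j hij
    by_contra hne
    rcases lt_or_gt_of_ne hne with h | h
    · exact conjugates_injective ha j.2 h hij
    · exact conjugates_injective ha i.2 h hij.symm
  have hzero : PowerSeries.trunc d P = 0 := by
    refine Polynomial.eq_zero_of_degree_lt_of_eval_index_eq_zero (s := Finset.univ)
      (v := fun j : Fin d => a ^ q Fq ^ (j : ℕ)) hinj.injOn ?_ fun j _ => hroot j
    rw [Finset.card_univ, Fintype.card_fin]
    exact PowerSeries.degree_trunc_lt P d
  have hP0 : P = 0 := by rw [hPtr, hzero, Polynomial.coe_zero]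
  rw [hP0, map_zero] at h5
  exact neg_eq_zero.1 h5.symm

/-- The determinant of the period matrix has no zeros in the algebraic closure of `F_q`. -/
lemma det_periodMatrix_eval_ne_zero {ω : Fin ρ.rank → CInf Fq} (hω : ρ.IsPeriodBasis ω)
    {a : CInf Fq} (ha : IsIntegral Fq a) :
    evalAt 1 a (norm_le_one_of_isIntegral ha) (ρ.periodMatrix ω).det ≠ 0 := by
  intro h0
  set p := minpoly Fq a with hp
  have ha1 := norm_le_one_of_isIntegral ha
  rw [RingHom.map_det, RingHom.mapMatrix_apply] at h0
  set V : Submodule (CInf Fq) (Fin ρ.rank → CInf Fq) :=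
    LinearMap.ker (Matrix.vecMulLinear ((ρ.periodMatrix ω).map (evalAt 1 a ha1))) with hV
  have hmem : ∀ x, x ∈ V ↔ x ᵥ* (ρ.periodMatrix ω).map (evalAt 1 a ha1) = 0 := fun x =>
    LinearMap.mem_ker
  have hVbot : V ≠ ⊥ := by
    obtain ⟨v, hv, hv0⟩ := Matrix.exists_vecMul_eq_zero_iff.2 h0
    intro h
    have : v ∈ V := (hmem v).2 hv0
    rw [h, Submodule.mem_bot] at this
    exact hv this
  obtain ⟨x, hxV, hx0, hxf⟩ := exists_fixed_vector (frobPow Fq p.natDegree) V (by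
    intro x hx
    rw [hmem] at hx ⊢
    have := ρ.vecMul_periodMatrix_eval_pow_pow hω ha1 hx p.natDegree a ha1
      (pow_card_adjoin ha (IntermediateField.mem_adjoin_simple_self Fq a)).symm
    simpa only [Function.comp_def, frobPow_apply] using this) hVbot
  rw [hmem] at hxV
  have hxL : ∀ i, x i ∈ IntermediateField.adjoin Fq {a} := by
    intro i
    refine mem_adjoin_of_pow_eq ha ?_
    have := congrFun hxf i
    rwa [Function.comp_apply, frobPow_apply] at this
  choose g hgdeg hg using fun i => exists_aeval_eq ha (hxL i)
  set z := ∑ i, Polynomial.aeval (theta Fq) (g i) * ω i with hz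
  have hzrow : ∀ j, ρ.tateRow z j =
      ∑ i, ⟨_, fqToPowerSeries_mem 1 (g i)⟩ * ρ.periodMatrix ω i j := by
    intro j
    apply Subtype.ext
    rw [AddSubmonoidClass.coe_finsetSum]
    change ρ.srow z j = ∑ i, fqToPowerSeries Fq (g i) * ρ.srow (ω i) j
    rw [hz, map_sum, Finset.sum_apply]
    exact Finset.sum_congr rfl fun i _ => ρ.srow_aeval_mul (g i) (hω.mem_lattice i) j
  have hev : ∀ (j : ℕ) (b : CInf Fq) (hb : ‖b‖ ≤ 1), b = a ^ q Fq ^ j →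
      ∀ l, evalAt 1 b hb (ρ.tateRow z l) = 0 := by
    intro j b hb h l
    have h1 := congrFun (ρ.vecMul_periodMatrix_eval_pow_pow hω ha1 hxV j b hb h) l
    rw [Matrix.vecMul, dotProduct, Pi.zero_apply] at h1
    rw [hzrow, map_sum]
    refine Eq.trans (Finset.sum_congr rfl fun i _ => ?_) h1
    rw [map_mul, evalAt_fqToPowerSeries, Matrix.map_apply, ← hg, pow_aeval, ← h]
  have hagf : ∀ (j : ℕ) (b : CInf Fq) (hb : ‖b‖ ≤ 1), b = a ^ q Fq ^ j →
      evalAt 1 b hb ⟨_, ρ.agf_mem_tate z⟩ = 0 := by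
    intro j b hb h
    have h1 := evalAt_tateUntwist_pow b hb (ρ.tateRow z ρ.lastIdx)
    rw [hev (j + 1) _ (norm_pow_le_one hb _) (by rw [h, ← pow_mul, ← pow_succ])] at h1
    have h2 : tateUntwist Fq (ρ.tateRow z ρ.lastIdx) =
        ⟨_, C_mem_restrictedRing 1 (ρ.rootCoeff ρ.rank ρ.lastIdx)⟩ * ⟨_, ρ.agf_mem_tate z⟩ :=
      Subtype.ext (ρ.untwist_srow_last z)
    rw [h2, map_mul, evalAt_C] at h1
    exact (mul_eq_zero.1 (pow_eq_zero_iff (Fintype.card_ne_zero)|>.1 h1)).resolve_left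
      (ρ.rootCoeff_last_ne_zero _)
  obtain ⟨e, he⟩ := hω.exists_eq_sum (ρ.div_mem_lattice_of_agf_eval_eq_zero ha hagf)
  have hp0 : Polynomial.aeval (theta Fq) p ≠ 0 := aeval_theta_ne_zero (minpoly.monic ha).ne_zero
  rw [div_eq_iff hp0, hz, Finset.sum_mul] at he
  have h5 := hω.eq_zero_of_sum_eq_zero (g := fun i => g i - e i * p) (by
    rw [← sub_eq_zero, ← Finset.sum_sub_distrib] at he
    refine Eq.trans (Finset.sum_congr rfl fun i _ => ?_) he
    rw [map_sub, map_mul]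
    ring)
  apply hx0
  funext i
  have h6 : g i = e i * p := sub_eq_zero.1 (h5 i)
  have h7 : g i = 0 := Polynomial.eq_zero_of_dvd_of_degree_lt ⟨e i, h6.trans (mul_comm _ _)⟩
    (hgdeg i)
  rw [← hg, h7, map_zero, Pi.zero_apply]

lemma isUnit_det_periodMatrix {ω : Fin ρ.rank → CInf Fq} (hω : ρ.IsPeriodBasis ω) :
    IsUnit (ρ.periodMatrix ω).det := by
  obtain ⟨W, W', hW, hW', hWW', hWu⟩ := exists_omega Fq
  obtain ⟨c, hc, hdet⟩ := ρ.exists_phi_det_eq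
  have h1 := congrArg Matrix.det (ρ.periodMatrix_twist hω)
  rw [Matrix.det_mul, ← RingHom.mapMatrix_apply, ← RingHom.map_det, ← RingHom.mapMatrix_apply,
    ← RingHom.map_det, hdet] at h1
  set D := (ρ.periodMatrix ω).det with hD
  have h2 : powerSeriesUntwist Fq (D : (CInf Fq)⟦X⟧) * (PowerSeries.C (c : CInf Fq) *
      (PowerSeries.X - PowerSeries.C (theta Fq))) = (D : (CInf Fq)⟦X⟧) := by
    have := congrArg Subtype.val h1
    rw [Subring.coe_mul, coe_tateUntwist, coe_polyToTate, map_mul, map_sub, polyToPowerSeries_C,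
      polyToPowerSeries_C, polyToPowerSeries_X] at this
    exact this
  obtain ⟨b, g, hb, hg⟩ := exists_eq_of_untwist_eq hW hWW' hWu D.2
    (c := (c : CInf Fq)) (by simpa using hc) h2
  have hDT : D = ⟨_, C_mem_restrictedRing 1 b⟩ * ⟨W', hW'⟩ * ⟨_, fqToPowerSeries_mem 1 g⟩ :=
    Subtype.ext hg
  have hroot : ∀ (a : CInf Fq), IsIntegral Fq a → Polynomial.aeval a g ≠ 0 := by
    intro a ha h
    apply ρ.det_periodMatrix_eval_ne_zero hω ha
    rw [← hD, hDT, map_mul, evalAt_fqToPowerSeries, h, mul_zero]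
  have hg0 : g ≠ 0 := by
    rintro rfl
    exact hroot 0 isIntegral_zero (map_zero _)
  have hgdeg : g.degree = 0 := by
    by_contra hdeg
    have hdeg' : (g.map (algebraMap Fq (KInfAlg Fq))).degree ≠ 0 := by
      rwa [Polynomial.degree_map]
    obtain ⟨y, hy⟩ := IsAlgClosed.exists_root _ hdeg'
    have h3 : Polynomial.aeval (algToCInf Fq y) g = 0 := by
      rw [Polynomial.IsRoot, Polynomial.eval_map] at hy
      have := congrArg (algToCInf Fq) hy
      rw [Polynomial.hom_eval₂, map_zero] at this
      exact this
    exact hroot _ (IsAlgebraic.isIntegral ⟨g, hg0, h3⟩) h3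
  obtain ⟨g₀, hg₀⟩ : ∃ g₀, g = Polynomial.C g₀ := ⟨_, Polynomial.eq_C_of_degree_eq_zero hgdeg⟩
  have hg₀0 : g₀ ≠ 0 := by rintro rfl; exact hg0 (by rw [hg₀, map_zero])
  have hCunit : ∀ x : CInf Fq, x ≠ 0 → IsUnit (⟨_, C_mem_restrictedRing 1 x⟩ : tate Fq) := by
    intro x hx
    refine IsUnit.of_mul_eq_one ⟨_, C_mem_restrictedRing 1 x⁻¹⟩ (Subtype.ext ?_)
    rw [Subring.coe_mul, ← map_mul, mul_inv_cancel₀ hx, map_one]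
    rfl
  rw [hDT]
  refine ((hCunit b hb).mul ?_).mul ?_
  · exact IsUnit.of_mul_eq_one ⟨W, hW⟩ (Subtype.ext ((mul_comm _ _).trans hWW'))
  · have h4 : (⟨_, fqToPowerSeries_mem 1 g⟩ : tate Fq) =
        ⟨_, C_mem_restrictedRing 1 (algebraMap Fq (CInf Fq) g₀)⟩ := by
      apply Subtype.ext
      change fqToPowerSeries Fq g = _
      rw [hg₀, fqToPowerSeries_apply, Polynomial.map_C, Polynomial.coe_C]
    rw [h4]
    exact hCunit _ (by simpa using hg₀0)

end DrinfeldModule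

section Free

variable {Fq : Type u} [Field Fq] [Fintype Fq]
variable {ι κ : Type} [Fintype ι] [Fintype κ]

lemma polyUntwist_eq_map (f : (Kbar Fq)[X]) :
    polyUntwist Fq f = f.map ((frobKbar Fq).symm : Kbar Fq →+* Kbar Fq) := rfl

@[simp]
lemma polyUntwist_X : polyUntwist Fq Polynomial.X = Polynomial.X := by
  simp [polyUntwist_eq_map]

@[simp]
lemma polyUntwist_C (c : Kbar Fq) :
    polyUntwist Fq (Polynomial.C c) = Polynomial.C ((frobKbar Fq).symm c) := by
  simp [polyUntwist_eq_map]

lemma degree_polyUntwist (f : (Kbar Fq)[X]) : (polyUntwist Fq f).degree = f.degree := by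
  rw [polyUntwist_eq_map, Polynomial.degree_map]

/-- There is a finite family whose `σ`-orbits form a basis over `k̄`. -/
def IsSigmaFree (Φ : Matrix ι ι (Kbar Fq)[X]) : Prop :=
  ∃ (E : Type) (_ : Fintype E) (c : E → ι → (Kbar Fq)[X]),
    LinearIndependent (Kbar Fq) (fun p : ℕ × E => (polySigma Φ)^[p.1] (c p.2)) ∧
    Submodule.span (Kbar Fq) (Set.range fun p : ℕ × E => (polySigma Φ)^[p.1] (c p.2)) = ⊤

lemma IsSigmaFree.exists_fin {Φ : Matrix ι ι (Kbar Fq)[X]} (h : IsSigmaFree Φ) :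
    ∃ (e : ℕ) (c : Fin e → ι → (Kbar Fq)[X]),
    LinearIndependent (Kbar Fq) (fun p : ℕ × Fin e => (polySigma Φ)^[p.1] (c p.2)) ∧
    Submodule.span (Kbar Fq) (Set.range fun p : ℕ × Fin e => (polySigma Φ)^[p.1] (c p.2)) = ⊤ := by
  obtain ⟨E, hE, c, h1, h2⟩ := h
  let f := (Equiv.refl ℕ).prodCongr (Fintype.equivFin E).symm
  refine ⟨Fintype.card E, c ∘ (Fintype.equivFin E).symm, h1.comp f f.injective, ?_⟩
  rw [← h2]
  congr 1
  exact f.surjective.range_comp (fun p : ℕ × E => (polySigma Φ)^[p.1] (c p.2))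

/-- An action of `σ` which raises the degree by a constant is free. -/
lemma isSigmaFree_of_degree (Φ : Matrix ι ι (Kbar Fq)[X])
    (ψ : (ι → (Kbar Fq)[X]) →ₗ[Kbar Fq] (Kbar Fq)[X]) (hinj : Function.Injective ψ)
    (hsurj : Function.Surjective ψ) (N : ℕ) (hN : 0 < N)
    (hdeg : ∀ x, (ψ (polySigma Φ x)).degree = (ψ x).degree + N) : IsSigmaFree Φ := by
  have : NeZero N := ⟨hN.ne'⟩
  choose c hc using fun j : Fin N => hsurj (Polynomial.X ^ (j : ℕ))
  have h1 : ∀ (p : ℕ × Fin N), (ψ ((polySigma Φ)^[p.1] (c p.2))).degree =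
      ((p.2 : ℕ) + p.1 * N : ℕ) := by
    rintro ⟨m, j⟩
    induction m with
    | zero => simp [hc]
    | succ m ih =>
      simp only at ih
      simp only [Function.iterate_succ_apply', hdeg, ih]
      rw [add_mul, one_mul, ← add_assoc]
      exact_mod_cast rfl
  let S : Polynomial.Sequence (Kbar Fq) :=
    { elems' := fun w => ψ ((polySigma Φ)^[((Nat.divModEquiv N) w).1] (c ((Nat.divModEquiv N) w).2))
      degree_eq' := fun w => by
        rw [h1]
        congr 1
        have := (Nat.divModEquiv N).symm_apply_apply w
        rw [Nat.divModEquiv_symm_apply] at this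
        rw [add_comm]
        exact this }
  have hS : (fun p : ℕ × Fin N => ψ ((polySigma Φ)^[p.1] (c p.2))) =
      (fun w => S w) ∘ (Nat.divModEquiv N).symm := by
    funext p
    change _ = ψ _
    rw [Equiv.apply_symm_apply]
  refine ⟨Fin N, inferInstance, c, ?_, ?_⟩
  · refine LinearIndependent.of_comp ψ ?_
    change LinearIndependent _ fun p : ℕ × Fin N => ψ ((polySigma Φ)^[p.1] (c p.2))
    rw [hS]
    exact S.linearIndependent.comp _ (Nat.divModEquiv N).symm.injective
  · have h2 := S.span fun i => isUnit_iff_ne_zero.2 (Polynomial.leadingCoeff_ne_zero.2 (S.ne_zero i))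
    rw [← (Nat.divModEquiv N).symm.surjective.range_comp, ← hS] at h2
    refine Submodule.map_injective_of_injective hinj ?_
    rw [Submodule.map_span, ← Set.range_comp, Submodule.map_top, LinearMap.range_eq_top.2 hsurj]
    exact h2

lemma polySigma_reindex (Φ : Matrix ι ι (Kbar Fq)[X]) (e : κ ≃ ι) (x : ι → (Kbar Fq)[X]) :
    polySigma (Φ.submatrix e e) (x ∘ e) = polySigma Φ x ∘ e := by
  rw [polySigma, polySigma, ← Function.comp_assoc]
  funext j
  simp only [Matrix.vecMul, dotProduct, Function.comp_apply, Matrix.submatrix_apply]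
  exact e.sum_comp fun i => polyUntwist Fq (x i) * Φ i (e j)

lemma IsSigmaFree.reindex {Φ : Matrix ι ι (Kbar Fq)[X]} (h : IsSigmaFree Φ) (e : κ ≃ ι) :
    IsSigmaFree (Φ.submatrix e e) := by
  obtain ⟨E, hE, c, h1, h2⟩ := h
  let L := LinearEquiv.funCongrLeft (Kbar Fq) (Kbar Fq)[X] e
  have h3 : ∀ m x, (polySigma (Φ.submatrix e e))^[m] (x ∘ e) = L ((polySigma Φ)^[m] x) := by
    intro m
    induction m with
    | zero => intro x; rfl
    | succ m ih =>
      intro x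
      rw [Function.iterate_succ_apply', ih, Function.iterate_succ_apply']
      exact polySigma_reindex Φ e _
  have h4 : (fun p : ℕ × E => (polySigma (Φ.submatrix e e))^[p.1] (c p.2 ∘ e)) =
      L ∘ (fun p : ℕ × E => (polySigma Φ)^[p.1] (c p.2)) := by
    funext p
    exact h3 _ _
  refine ⟨E, hE, fun j => c j ∘ e, ?_, ?_⟩
  · rw [h4]
    exact h1.map' L.toLinearMap L.ker
  · rw [h4, Set.range_comp]
    have := congrArg (Submodule.map L.toLinearMap) h2
    rw [Submodule.map_span, Submodule.map_top, LinearEquiv.range] at this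
    exact this

lemma polySigma_fromBlocks (A : Matrix ι ι (Kbar Fq)[X]) (B : Matrix ι κ (Kbar Fq)[X])
    (D : Matrix κ κ (Kbar Fq)[X]) (x : ι → (Kbar Fq)[X]) (y : κ → (Kbar Fq)[X]) :
    polySigma (Matrix.fromBlocks A B 0 D) (Sum.elim x y) =
      Sum.elim (polySigma A x) ((polyUntwist Fq ∘ x) ᵥ* B + polySigma D y) := by
  rw [polySigma, Sum.comp_elim, Matrix.vecMul_fromBlocks]
  simp [polySigma]

lemma IsSigmaFree.fromBlocks {A : Matrix ι ι (Kbar Fq)[X]} (B : Matrix ι κ (Kbar Fq)[X])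
    {D : Matrix κ κ (Kbar Fq)[X]} (hA : IsSigmaFree A) (hD : IsSigmaFree D) :
    IsSigmaFree (Matrix.fromBlocks A B 0 D) := by
  obtain ⟨E, hE, c, hc1, hc2⟩ := hA
  obtain ⟨F, hF, d, hd1, hd2⟩ := hD
  set σ := polySigma (Matrix.fromBlocks A B 0 D) with hσ
  let P : (ι ⊕ κ → (Kbar Fq)[X]) →ₗ[Kbar Fq] (ι → (Kbar Fq)[X]) := LinearMap.funLeft _ _ Sum.inl
  let J : (κ → (Kbar Fq)[X]) →ₗ[Kbar Fq] (ι ⊕ κ → (Kbar Fq)[X]) :=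
    { toFun := fun y => Sum.elim 0 y
      map_add' := fun x y => by
        funext i
        rcases i with i | i <;> simp
      map_smul' := fun a x => by
        funext i
        rcases i with i | i <;> simp }
  have hJinj : Function.Injective J := fun x y h => by
    funext i
    exact congrFun h (Sum.inr i)
  have hPσ : ∀ m x, P (σ^[m] x) = (polySigma A)^[m] (P x) := by
    intro m
    induction m with
    | zero => intro x; rfl
    | succ m ih =>
      intro x
      rw [Function.iterate_succ_apply', Function.iterate_succ_apply', ← ih]
      generalize σ^[m] x = z
      have := polySigma_fromBlocks A B D (z ∘ Sum.inl) (z ∘ Sum.inr)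
      rw [Sum.elim_comp_inl_inr] at this
      rw [hσ, this]
      rfl
  have hJσ : ∀ m y, σ^[m] (J y) = J ((polySigma D)^[m] y) := by
    intro m
    induction m with
    | zero => intro y; rfl
    | succ m ih =>
      intro y
      rw [Function.iterate_succ_apply', Function.iterate_succ_apply', ih]
      refine (polySigma_fromBlocks A B D 0 _).trans ?_
      have h0 : polyUntwist Fq ∘ (0 : ι → (Kbar Fq)[X]) = 0 := by funext i; simp
      rw [polySigma, h0, Matrix.zero_vecMul, Matrix.zero_vecMul, zero_add]
      rfl
  let v : ℕ × E → ι ⊕ κ → (Kbar Fq)[X] := fun p => σ^[p.1] (Sum.elim (c p.2) 0)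
  let w : ℕ × F → ι ⊕ κ → (Kbar Fq)[X] := fun p => σ^[p.1] (J (d p.2))
  have hv : P ∘ v = fun p : ℕ × E => (polySigma A)^[p.1] (c p.2) := by
    funext p
    exact hPσ _ _
  have hw : w = J ∘ fun p : ℕ × F => (polySigma D)^[p.1] (d p.2) := by
    funext p
    exact hJσ _ _
  have hPJ : ∀ y, P (J y) = 0 := fun y => rfl
  have hspanw : Submodule.span (Kbar Fq) (Set.range w) = LinearMap.range J := by
    rw [hw, Set.range_comp, ← Submodule.map_span, hd2, Submodule.map_top]
  have hspanv : (Submodule.span (Kbar Fq) (Set.range v)).map P = ⊤ := by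
    rw [Submodule.map_span, ← Set.range_comp, hv, hc2]
  have hli : LinearIndependent (Kbar Fq) (Sum.elim v w) := by
    refine LinearIndependent.sum_type ?_ ?_ ?_
    · refine LinearIndependent.of_comp P ?_
      rw [hv]
      exact hc1
    · rw [hw]
      exact hd1.map' J (LinearMap.ker_eq_bot.2 hJinj)
    · rw [Submodule.disjoint_def, hspanw]
      rintro x hx ⟨y, rfl⟩
      obtain ⟨a, ha⟩ := (Finsupp.mem_span_range_iff_exists_finsupp).1 hx
      have h1 : Finsupp.linearCombination (Kbar Fq) (P ∘ v) a = 0 := by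
        rw [← hPJ y, ← ha, Finsupp.linearCombination_apply, map_finsuppSum]
        simp
      rw [hv] at h1
      have h2 := linearIndependent_iff.1 hc1 a h1
      rw [← ha, h2, Finsupp.sum_zero_index]
  have hsp : Submodule.span (Kbar Fq) (Set.range (Sum.elim v w)) = ⊤ := by
    rw [Set.Sum.elim_range, Submodule.span_union, eq_top_iff]
    intro x _
    have h1 : P x ∈ (Submodule.span (Kbar Fq) (Set.range v)).map P := by rw [hspanv]; trivial
    obtain ⟨y, hy, hyx⟩ := h1
    rw [← add_sub_cancel y x]
    refine Submodule.add_mem_sup hy ?_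
    rw [hspanw]
    refine ⟨(x - y) ∘ Sum.inr, ?_⟩
    funext i
    rcases i with i | i
    · have := congrFun hyx i
      change 0 = x (Sum.inl i) - y (Sum.inl i)
      exact (sub_eq_zero.2 this.symm).symm
    · rfl
  let f : ℕ × (E ⊕ F) ≃ (ℕ × E) ⊕ (ℕ × F) := Equiv.prodSumDistrib ℕ E F
  have hf : (fun p : ℕ × (E ⊕ F) => σ^[p.1] ((Sum.elim (fun j => Sum.elim (c j) 0)
      (fun j => J (d j)) : E ⊕ F → ι ⊕ κ → (Kbar Fq)[X]) p.2)) = Sum.elim v w ∘ f := by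
    funext p
    rcases p with ⟨m, j | j⟩ <;> rfl
  refine ⟨E ⊕ F, inferInstance, Sum.elim (fun j => Sum.elim (c j) 0) (fun j => J (d j)), ?_, ?_⟩
  · rw [hf]
    exact hli.comp _ f.injective
  · rw [hf, f.surjective.range_comp, hsp]

lemma exists_polySigma_eq [DecidableEq ι] {Φ : Matrix ι ι (Kbar Fq)[X]} {c : Kbar Fq} (hc : c ≠ 0) {s : ℕ}
    (hdet : Φ.det = Polynomial.C c * (Polynomial.X - Polynomial.C (thetaBar Fq)) ^ s)
    (x : ι → (Kbar Fq)[X]) : ∃ y : ι → (Kbar Fq)[X],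
      polySigma Φ y = (Polynomial.X - Polynomial.C (thetaBar Fq)) ^ s • x := by
  refine ⟨(polyUntwist Fq).symm ∘ (Polynomial.C c⁻¹ • x ᵥ* Φ.adjugate), ?_⟩
  rw [polySigma, ← Function.comp_assoc]
  have h1 : (polyUntwist Fq) ∘ (polyUntwist Fq).symm = id := by
    funext z
    simp
  rw [h1, Function.id_comp, Matrix.smul_vecMul, Matrix.vecMul_vecMul, Matrix.adjugate_mul, hdet,
    Matrix.vecMul_smul, Matrix.vecMul_one, smul_smul, ← mul_assoc, ← Polynomial.C_mul,
    inv_mul_cancel₀ hc, Polynomial.C_1, one_mul]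

end Free

section Weights

variable {Fq : Type u} [Field Fq] [Fintype Fq]

/-- The `k̄`-linear map `k̄[t]^r → k̄[z]` with `t^a m_i ↦ z^(ar+i)`. -/
def weightMap (Fq : Type u) [Field Fq] [Fintype Fq] (r : ℕ) :
    (Fin r → (Kbar Fq)[X]) →ₗ[Kbar Fq] (Kbar Fq)[X] where
  toFun x := ∑ i, Polynomial.expand (Kbar Fq) r (x i) * Polynomial.X ^ (i : ℕ)
  map_add' x y := by simp [add_mul, Finset.sum_add_distrib]
  map_smul' a x := by simp [Finset.smul_sum]

lemma weightMap_apply (r : ℕ) (x : Fin r → (Kbar Fq)[X]) :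
    weightMap Fq r x = ∑ i, Polynomial.expand (Kbar Fq) r (x i) * Polynomial.X ^ (i : ℕ) := rfl

lemma weightMap_smul (r : ℕ) (p : (Kbar Fq)[X]) (x : Fin r → (Kbar Fq)[X]) :
    weightMap Fq r (p • x) = Polynomial.expand (Kbar Fq) r p * weightMap Fq r x := by
  rw [weightMap_apply, weightMap_apply, Finset.mul_sum]
  refine Finset.sum_congr rfl fun i _ => ?_
  rw [Pi.smul_apply, smul_eq_mul, map_mul, mul_assoc]

/-- The degree of a sum of polynomials whose degrees are pairwise distinct modulo `r`. -/
lemma degree_sum_expand_mul {r : ℕ} (x R : Fin r → (Kbar Fq)[X]) (d : ℕ)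
    (hR : ∀ i, (R i).degree = ((i : ℕ) + d : ℕ)) :
    (∑ i, Polynomial.expand (Kbar Fq) r (x i) * R i).degree =
      Finset.univ.sup fun i => (Polynomial.expand (Kbar Fq) r (x i)).degree + ((i : ℕ) + d : ℕ) := by
  rw [Polynomial.degree_sum_eq_of_disjoint]
  · simp only [Polynomial.degree_mul, hR]
  · rintro i ⟨-, hi⟩ j ⟨-, hj⟩ hij h
    have hxi := left_ne_zero_of_mul hi
    have hxj := left_ne_zero_of_mul hj
    simp only [Function.comp_apply, Polynomial.degree_mul, hR] at h
    rw [Polynomial.degree_eq_natDegree hxi, Polynomial.degree_eq_natDegree hxj,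
      Polynomial.natDegree_expand, Polynomial.natDegree_expand] at h
    have h' : (x i).natDegree * r + (i + d) = (x j).natDegree * r + (j + d) := by exact_mod_cast h
    have h2 : (x i).natDegree * r + i = (x j).natDegree * r + j := by omega
    have h3 := congrArg (· % r) h2
    simp only [Nat.mul_add_mod', Nat.mod_eq_of_lt i.2, Nat.mod_eq_of_lt j.2] at h3
    exact hij (Fin.ext h3)

lemma degree_weightMap {r : ℕ} (x : Fin r → (Kbar Fq)[X]) :
    (weightMap Fq r x).degree =
      Finset.univ.sup fun i => (Polynomial.expand (Kbar Fq) r (x i)).degree + ((i : ℕ) + 0 : ℕ) :=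
  degree_sum_expand_mul x _ 0 fun i => by rw [Polynomial.degree_X_pow, add_zero]

lemma weightMap_injective {r : ℕ} (hr : 0 < r) : Function.Injective (weightMap Fq r) := by
  rw [injective_iff_map_eq_zero]
  intro x hx
  have h := degree_weightMap x
  rw [hx, Polynomial.degree_zero, eq_comm, Finset.sup_eq_bot_iff] at h
  funext i
  have h1 := h i (Finset.mem_univ i)
  rw [WithBot.add_eq_bot] at h1
  have h2 := h1.resolve_right (WithBot.natCast_ne_bot _)
  rw [Polynomial.degree_eq_bot, Polynomial.expand_eq_zero hr] at h2
  exact h2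

lemma weightMap_surjective {r : ℕ} (hr : 0 < r) : Function.Surjective (weightMap Fq r) := by
  rw [← LinearMap.range_eq_top, eq_top_iff]
  intro p _
  induction p using Polynomial.induction_on' with
  | add p q hp hq => exact add_mem (hp trivial) (hq trivial)
  | monomial w a =>
    refine ⟨Pi.single ⟨w % r, Nat.mod_lt _ hr⟩ (Polynomial.monomial (w / r) a), ?_⟩
    rw [weightMap_apply, Finset.sum_eq_single ⟨w % r, Nat.mod_lt _ hr⟩]
    · rw [Pi.single_eq_same, Polynomial.expand_monomial, Polynomial.monomial_mul_X_pow]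
      have h1 : w / r * r + w % r = w := by rw [mul_comm]; exact Nat.div_add_mod w r
      rw [h1]
    · intro i _ hi
      rw [Pi.single_eq_of_ne hi, map_zero, zero_mul]
    · simp

end Weights

namespace DrinfeldModule

variable {Fq : Type u} [Field Fq] [Fintype Fq] (ρ : DrinfeldModule Fq)

lemma degree_weightMap_phi_row (i : Fin ρ.rank) :
    (weightMap Fq ρ.rank fun j => ρ.phi i j).degree = ((i : ℕ) + 1 : ℕ) := by
  have hr := ρ.rank_pos
  rw [weightMap_apply]
  by_cases hi : (i : ℕ) + 1 < ρ.rank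
  · rw [Finset.sum_eq_single (⟨i + 1, hi⟩ : Fin ρ.rank)]
    · have : ρ.phi i ⟨i + 1, hi⟩ = 1 := by simp [phi, hi]
      rw [this, map_one, one_mul, Polynomial.degree_X_pow]
    · intro j _ hj
      have : ρ.phi i j = 0 := by
        rw [phi, if_pos hi, if_neg]
        exact fun h => hj (Fin.ext h)
      rw [this, map_zero, zero_mul]
    · simp
  · have hi' : (i : ℕ) + 1 = ρ.rank := by omega
    have hl : ((frobKbar Fq).symm^[ρ.rank] ρ.lead)⁻¹ ≠ 0 := by
      intro h
      apply ρ.rootCoeff_last_ne_zero ρ.rank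
      rw [inv_eq_zero] at h
      exact congrArg Subtype.val h
    rw [← Finset.add_sum_erase _ _ (Finset.mem_univ ρ.zeroIdx)]
    have h0 : (Polynomial.expand (Kbar Fq) ρ.rank (ρ.phi i ρ.zeroIdx) *
        Polynomial.X ^ (ρ.zeroIdx : ℕ)).degree = ((ρ.rank : ℕ) : WithBot ℕ) := by
      have h1 : ρ.phi i ρ.zeroIdx = (Polynomial.X - Polynomial.C (thetaBar Fq)) *
        Polynomial.C (((frobKbar Fq).symm^[ρ.rank] ρ.lead)⁻¹) := by
        rw [phi, if_neg hi]
        exact if_pos rfl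
      rw [h1, map_mul, map_sub, Polynomial.expand_X, Polynomial.expand_C, Polynomial.expand_C,
        Polynomial.degree_mul, Polynomial.degree_mul, Polynomial.degree_X_pow_sub_C hr,
        Polynomial.degree_C hl, Polynomial.degree_X_pow]
      simp [zeroIdx]
    have h2 : (∑ j ∈ Finset.univ.erase ρ.zeroIdx,
        Polynomial.expand (Kbar Fq) ρ.rank (ρ.phi i j) * Polynomial.X ^ (j : ℕ)).degree <
        ((ρ.rank : ℕ) : WithBot ℕ) := by
      refine (Polynomial.degree_sum_le _ _).trans_lt ?_
      rw [Finset.sup_lt_iff (WithBot.bot_lt_coe _)]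
      intro j hj
      have hj0 : (j : ℕ) ≠ 0 := fun h => (Finset.mem_erase.1 hj).1 (Fin.ext h)
      rw [phi, if_neg hi, if_neg hj0, Polynomial.expand_C]
      refine (Polynomial.degree_C_mul_X_pow_le _ _).trans_lt ?_
      exact_mod_cast j.2
    rw [Polynomial.degree_add_eq_left_of_degree_lt (by rw [h0]; exact h2), h0, hi']

lemma degree_weightMap_polySigma (x : Fin ρ.rank → (Kbar Fq)[X]) :
    (weightMap Fq ρ.rank (polySigma ρ.phi x)).degree = (weightMap Fq ρ.rank x).degree + 1 := by
  have hr := ρ.rank_pos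
  have h1 : polySigma ρ.phi x = ∑ l, polyUntwist Fq (x l) • fun j => ρ.phi l j := by
    rw [polySigma, Matrix.vecMul_eq_sum]
    rfl
  have h4 : weightMap Fq ρ.rank (polySigma ρ.phi x) = ∑ l, Polynomial.expand (Kbar Fq) ρ.rank
      (polyUntwist Fq (x l)) * weightMap Fq ρ.rank (fun j => ρ.phi l j) := by
    rw [h1, map_sum]
    exact Finset.sum_congr rfl fun l _ => weightMap_smul _ _ _
  rw [h4,
    degree_sum_expand_mul _ _ 1 fun i => ρ.degree_weightMap_phi_row i, degree_weightMap]
  have hmono : Monotone fun a : WithBot ℕ => a + 1 := fun a b h => by dsimp only; gcongr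
  have h2 := Finset.apply_sup_eq_sup_comp_of_linearOrder (s := (Finset.univ : Finset (Fin ρ.rank)))
    (f := fun i => (Polynomial.expand (Kbar Fq) ρ.rank (x i)).degree + ((i : ℕ) + 0 : ℕ))
    (fun a : WithBot ℕ => a + 1) hmono (by rfl)
  refine Eq.trans ?_ h2.symm
  refine Finset.sup_congr rfl fun i _ => ?_
  have h3 : (Polynomial.expand (Kbar Fq) ρ.rank (polyUntwist Fq (x i))).degree =
      (Polynomial.expand (Kbar Fq) ρ.rank (x i)).degree := by
    rw [polyUntwist_eq_map, ← Polynomial.map_expand, Polynomial.degree_map]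
  rw [h3, Function.comp_apply, add_zero, add_assoc]
  push_cast
  rfl

lemma isSigmaFree_smul_phi :
    IsSigmaFree ((Polynomial.X - Polynomial.C (thetaBar Fq)) • ρ.phi) := by
  have hr := ρ.rank_pos
  refine isSigmaFree_of_degree _ (weightMap Fq ρ.rank) (weightMap_injective hr)
    (weightMap_surjective hr) (ρ.rank + 1) (Nat.succ_pos _) fun x => ?_
  rw [polySigma, Matrix.vecMul_smul, weightMap_smul, Polynomial.degree_mul, map_sub,
    Polynomial.expand_X, Polynomial.expand_C, Polynomial.degree_X_pow_sub_C hr]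
  have := ρ.degree_weightMap_polySigma x
  rw [polySigma] at this
  rw [this]
  push_cast
  ring

end DrinfeldModule

section Free

variable {Fq : Type u} [Field Fq] [Fintype Fq]

lemma isSigmaFree_carlitz : IsSigmaFree
    ((Polynomial.X - Polynomial.C (thetaBar Fq)) • (1 : Matrix Unit Unit (Kbar Fq)[X])) := by
  refine isSigmaFree_of_degree _ (LinearMap.proj ()) ?_ ?_ 1 one_pos fun x => ?_
  · intro x y h
    funext i
    exact h
  · intro p
    exact ⟨fun _ => p, rfl⟩
  · rw [polySigma, Matrix.vecMul_smul, Matrix.vecMul_one, LinearMap.proj_apply,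
      LinearMap.proj_apply, Pi.smul_apply, smul_eq_mul, Polynomial.degree_mul,
      Polynomial.degree_X_sub_C, Function.comp_apply, degree_polyUntwist, add_comm]
    rfl

end Free

section Uniformizable

variable {Fq : Type u} [Field Fq] [Fintype Fq]
variable {ι κ : Type} [Fintype ι] [DecidableEq ι] [Fintype κ] [DecidableEq κ]

/-- `Ψ^{(-1)} = Φ Ψ` has an invertible solution over the Tate algebra. -/
def IsTateTrivial (Φ : Matrix ι ι (Kbar Fq)[X]) : Prop :=
  ∃ Ψ : Matrix ι ι (tate Fq), IsUnit Ψ ∧ Ψ.map (tateUntwist Fq) = Φ.map (polyToTate Fq) * Ψ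

lemma IsTateTrivial.isRigidAnalyticallyTrivial {Φ : Matrix ι ι (Kbar Fq)[X]}
    (h : IsTateTrivial Φ) : IsRigidAnalyticallyTrivial Φ := by
  obtain ⟨Ψ, ⟨U, rfl⟩, h1⟩ := h
  refine ⟨(U.val).map (tate Fq).subtype, (U⁻¹.val).map (tate Fq).subtype,
    fun i j => mem_tate.1 (U.val i j).2, fun i j => mem_tate.1 (U⁻¹.val i j).2, ?_, ?_, ?_⟩
  · rw [← Matrix.map_mul, Units.mul_inv]
    simp
  · rw [← Matrix.map_mul, Units.inv_mul]
    simp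
  · have h2 := congrArg (fun M : Matrix ι ι (tate Fq) => M.map (tate Fq).subtype) h1
    simp only [Matrix.map_mul, Matrix.map_map] at h2
    rw [Matrix.map_map]
    exact h2

lemma IsTateTrivial.reindex {Φ : Matrix ι ι (Kbar Fq)[X]} (h : IsTateTrivial Φ) (e : κ ≃ ι) :
    IsTateTrivial (Φ.submatrix e e) := by
  obtain ⟨Ψ, hΨ, h1⟩ := h
  refine ⟨Ψ.submatrix e e, ?_, ?_⟩
  · rw [Matrix.isUnit_iff_isUnit_det] at hΨ ⊢
    rwa [Matrix.det_submatrix_equiv_self]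
  · rw [← Matrix.submatrix_map, h1, ← Matrix.submatrix_map, Matrix.submatrix_mul_equiv]

lemma isTateTrivial_one : IsTateTrivial (1 : Matrix ι ι (Kbar Fq)[X]) :=
  ⟨1, isUnit_one, by rw [Matrix.map_one _ (map_zero _) (map_one _),
    Matrix.map_one _ (map_zero _) (map_one _), mul_one]⟩

lemma IsTateTrivial.smul {Φ : Matrix ι ι (Kbar Fq)[X]} (h : IsTateTrivial Φ) :
    IsTateTrivial ((Polynomial.X - Polynomial.C (thetaBar Fq)) • Φ) := by
  obtain ⟨Ψ, hΨ, h1⟩ := h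
  obtain ⟨W, W', hW, hW', hWW', hWu⟩ := exists_omega Fq
  have hWt : tateUntwist Fq ⟨W, hW⟩ =
      polyToTate Fq (Polynomial.X - Polynomial.C (thetaBar Fq)) * ⟨W, hW⟩ := by
    apply Subtype.ext
    rw [Subring.coe_mul, coe_tateUntwist, coe_polyToTate, map_sub, polyToPowerSeries_X,
      polyToPowerSeries_C]
    exact hWu
  have hu : IsUnit (⟨W, hW⟩ : tate Fq) := IsUnit.of_mul_eq_one ⟨W', hW'⟩ (Subtype.ext hWW')
  refine ⟨(⟨W, hW⟩ : tate Fq) • Ψ, ?_, ?_⟩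
  · rw [Matrix.isUnit_iff_isUnit_det] at hΨ ⊢
    rw [Matrix.det_smul]
    exact (hu.pow _).mul hΨ
  · have h2 : ∀ i j, tateUntwist Fq (Ψ i j) = (Φ.map (polyToTate Fq) * Ψ) i j :=
      fun i j => congrFun (congrFun h1 i) j
    have h3 : ((Polynomial.X - Polynomial.C (thetaBar Fq)) • Φ).map (polyToTate Fq) =
        polyToTate Fq (Polynomial.X - Polynomial.C (thetaBar Fq)) • Φ.map (polyToTate Fq) := by
      ext i j : 2
      exact map_mul _ _ _
    rw [h3, Matrix.smul_mul, Matrix.mul_smul, smul_smul, ← hWt]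
    ext i j : 2
    rw [Matrix.map_apply, Matrix.smul_apply, Matrix.smul_apply, smul_eq_mul, smul_eq_mul, map_mul,
      h2]

lemma IsTateTrivial.fromBlocks {A : Matrix ι ι (Kbar Fq)[X]} (B : Matrix ι κ (Kbar Fq)[X])
    {D : Matrix κ κ (Kbar Fq)[X]} (hA : IsTateTrivial A) (hD : IsTateTrivial D) :
    IsTateTrivial (Matrix.fromBlocks A B 0 D) := by
  obtain ⟨P, ⟨U, rfl⟩, hP⟩ := hA
  obtain ⟨R, hR, hR'⟩ := hD
  set τ := tateUntwist Fq
  set N : Matrix ι κ (tate Fq) := (U⁻¹.val).map τ * (B.map (polyToTate Fq) * R) with hN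
  have hZ : ∀ i j, ∃ z : tate Fq, τ z - z = N i j := by
    intro i j
    obtain ⟨x, hx, hx'⟩ := exists_untwist_sub_eq (N i j).2
    exact ⟨⟨x, hx⟩, Subtype.ext hx'⟩
  choose Z hZ using hZ
  set Z : Matrix ι κ (tate Fq) := Matrix.of Z with hZdef
  have hZ' : Z.map τ = Z + N := by
    ext i j : 2
    rw [Matrix.map_apply, Matrix.add_apply, ← hZ i j, hZdef, Matrix.of_apply, add_sub_cancel]
  have hU : U.val.map τ * (U⁻¹.val).map τ = 1 := by
    rw [← Matrix.map_mul, Units.mul_inv, Matrix.map_one _ (map_zero _) (map_one _)]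
  refine ⟨Matrix.fromBlocks U.val (U.val * Z) 0 R, ?_, ?_⟩
  · rw [Matrix.isUnit_iff_isUnit_det] at hR ⊢
    rw [Matrix.det_fromBlocks_zero₂₁]
    exact ((Matrix.isUnit_iff_isUnit_det _).1 U.isUnit).mul hR
  · rw [Matrix.fromBlocks_map, Matrix.fromBlocks_map, Matrix.fromBlocks_multiply, hP, hR',
      Matrix.map_mul, hZ', Matrix.mul_add, hN,
      ← Matrix.mul_assoc (U.val.map τ), hU, Matrix.one_mul, hP]
    simp [Matrix.mul_assoc]

/-- A sufficient criterion for a matrix to define a rigid analytically trivial dual `t`-motive,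
stable under extensions. -/
structure IsUniformizable (Φ : Matrix ι ι (Kbar Fq)[X]) : Prop where
  free : IsSigmaFree Φ
  det_eq : ∃ c : Kbar Fq, c ≠ 0 ∧ ∃ s : ℕ,
    Φ.det = Polynomial.C c * (Polynomial.X - Polynomial.C (thetaBar Fq)) ^ s
  trivial : IsTateTrivial Φ

lemma IsUniformizable.isDualTMotive {Φ : Matrix ι ι (Kbar Fq)[X]} (h : IsUniformizable Φ) :
    IsDualTMotive Φ := by
  obtain ⟨c, hc, s, hs⟩ := h.det_eq
  exact ⟨h.free.exists_fin, s, exists_polySigma_eq hc hs⟩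

lemma IsUniformizable.reindex {Φ : Matrix ι ι (Kbar Fq)[X]} (h : IsUniformizable Φ) (e : κ ≃ ι) :
    IsUniformizable (Φ.submatrix e e) :=
  ⟨h.free.reindex e, by rw [Matrix.det_submatrix_equiv_self]; exact h.det_eq, h.trivial.reindex e⟩

lemma IsUniformizable.fromBlocks {A : Matrix ι ι (Kbar Fq)[X]} (B : Matrix ι κ (Kbar Fq)[X])
    {D : Matrix κ κ (Kbar Fq)[X]} (hA : IsUniformizable A) (hD : IsUniformizable D) :
    IsUniformizable (Matrix.fromBlocks A B 0 D) := by
  refine ⟨hA.free.fromBlocks B hD.free, ?_, hA.trivial.fromBlocks B hD.trivial⟩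
  obtain ⟨c, hc, s, hs⟩ := hA.det_eq
  obtain ⟨d, hd, m, hm⟩ := hD.det_eq
  refine ⟨c * d, mul_ne_zero hc hd, s + m, ?_⟩
  rw [Matrix.det_fromBlocks_zero₂₁, hs, hm, Polynomial.C_mul]
  ring

lemma IsUniformizable.isTMotive {Φ : Matrix ι ι (Kbar Fq)[X]} (h : IsUniformizable Φ)
    (h0 : Φ.det ≠ 0) : IsTMotive Fq (matObj (toGL Φ h0)) :=
  .of_dual Φ h.isDualTMotive h.trivial.isRigidAnalyticallyTrivial _ rfl

lemma isUniformizable_carlitz : IsUniformizable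
    ((Polynomial.X - Polynomial.C (thetaBar Fq)) • (1 : Matrix Unit Unit (Kbar Fq)[X])) where
  free := isSigmaFree_carlitz
  det_eq := ⟨1, one_ne_zero, 1, by simp⟩
  trivial := isTateTrivial_one.smul

/-- The first row and the remaining rows. -/
def finSuccProdEquiv (n : ℕ) (ι : Type) : Fin (n + 1) × ι ≃ ι ⊕ (Fin n × ι) where
  toFun p := Fin.cases (Sum.inl p.2) (fun a => Sum.inr (a, p.2)) p.1
  invFun := Sum.elim (fun i => (0, i)) (fun p => (p.1.succ, p.2))
  left_inv := by
    rintro ⟨a, i⟩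
    refine Fin.cases ?_ (fun a => ?_) a <;> rfl
  right_inv := by rintro (i | ⟨a, i⟩) <;> rfl

lemma dMatrix_succ {ι : Type} (n : ℕ) (Φ : Matrix ι ι (Kbar Fq)[X]) :
    dMatrix (n + 1) Φ = (Matrix.fromBlocks Φ
      (Matrix.of fun i y => Polynomial.hasseDeriv ((y.1 : ℕ) + 1) (Φ i y.2)) 0
      (dMatrix n Φ)).submatrix (finSuccProdEquiv (n + 1) ι) (finSuccProdEquiv (n + 1) ι) := by
  ext ⟨a, i⟩ ⟨b, j⟩ : 2
  refine Fin.cases ?_ (fun a => ?_) a <;> refine Fin.cases ?_ (fun b => ?_) b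
  · simp [dMatrix, finSuccProdEquiv]
  · simp [dMatrix, finSuccProdEquiv]
  · simp [dMatrix, finSuccProdEquiv]
  · simp [dMatrix, finSuccProdEquiv]

lemma isUniformizable_smul_dMatrix (p : (Kbar Fq)[X]) {Φ : Matrix ι ι (Kbar Fq)[X]}
    (h : IsUniformizable (p • Φ)) (n : ℕ) : IsUniformizable (p • dMatrix n Φ) := by
  induction n with
  | zero =>
    have : p • dMatrix 0 Φ = (p • Φ).submatrix (Equiv.uniqueProd ι (Fin 1))
        (Equiv.uniqueProd ι (Fin 1)) := by
      ext ⟨a, i⟩ ⟨b, j⟩ : 2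
      obtain rfl : a = b := Fin.ext (by omega)
      simp [dMatrix]
    rw [this]
    exact h.reindex _
  | succ n ih =>
    have h1 := (h.fromBlocks (p • Matrix.of fun (i : ι) (y : Fin (n + 1) × ι) =>
      Polynomial.hasseDeriv ((y.1 : ℕ) + 1) (Φ i y.2)) ih).reindex (finSuccProdEquiv (n + 1) ι)
    rw [dMatrix_succ]
    refine Eq.mp (congrArg IsUniformizable ?_) h1
    ext x y : 2
    rw [Matrix.smul_apply, Matrix.submatrix_apply, Matrix.submatrix_apply]
    generalize finSuccProdEquiv (n + 1) ι x = a
    generalize finSuccProdEquiv (n + 1) ι y = b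
    rcases a with a | a <;> rcases b with b | b <;> simp

end Uniformizable

namespace DrinfeldModule

variable {Fq : Type u} [Field Fq] [Fintype Fq] (ρ : DrinfeldModule Fq)

lemma isTateTrivial_phi {ω : Fin ρ.rank → CInf Fq} (hω : ρ.IsPeriodBasis ω) :
    IsTateTrivial ρ.phi := by
  obtain ⟨U, hU⟩ := (Matrix.isUnit_iff_isUnit_det _).2 (ρ.isUnit_det_periodMatrix hω)
  refine ⟨U⁻¹.val, U⁻¹.isUnit, ?_⟩
  have h1 := ρ.periodMatrix_twist hω
  rw [← hU] at h1
  have h2 : (U⁻¹.val).map (tateUntwist Fq) * U.val.map (tateUntwist Fq) = 1 := by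
    rw [← Matrix.map_mul, Units.inv_mul, Matrix.map_one _ (map_zero _) (map_one _)]
  calc (U⁻¹.val).map (tateUntwist Fq)
      = (U⁻¹.val).map (tateUntwist Fq) * (U.val.map (tateUntwist Fq) *
          ρ.phi.map (polyToTate Fq)) * U⁻¹.val := by rw [h1, mul_assoc, Units.mul_inv, mul_one]
    _ = _ := by rw [← mul_assoc, h2, one_mul]

lemma isUniformizable_smul_phi {ω : Fin ρ.rank → CInf Fq} (hω : ρ.IsPeriodBasis ω) :
    IsUniformizable ((Polynomial.X - Polynomial.C (thetaBar Fq)) • ρ.phi) where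
  free := ρ.isSigmaFree_smul_phi
  det_eq := by
    obtain ⟨c, hc, h⟩ := ρ.exists_phi_det_eq
    refine ⟨c, hc, Fintype.card (Fin ρ.rank) + 1, ?_⟩
    rw [Matrix.det_smul, h]
    ring
  trivial := (ρ.isTateTrivial_phi hω).smul

lemma isUniformizable_smul_ext {ω : Fin ρ.rank → CInf Fq} (hω : ρ.IsPeriodBasis ω) (n : ℕ)
    (α : Kbar Fq) : IsUniformizable ((Polynomial.X - Polynomial.C (thetaBar Fq)) •
      Matrix.fromBlocks (dMatrix n ρ.phi) 0 (ρ.hRow n α) (1 : Matrix Unit Unit (Kbar Fq)[X])) := by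
  have h1 := isUniformizable_carlitz.fromBlocks
    ((Polynomial.X - Polynomial.C (thetaBar Fq)) • ρ.hRow n α)
    (isUniformizable_smul_dMatrix _ (ρ.isUniformizable_smul_phi hω) n)
  have h2 := h1.reindex (Equiv.sumComm _ _)
  rw [Equiv.sumComm_apply, Matrix.fromBlocks_submatrix_sum_swap_sum_swap] at h2
  rw [Matrix.fromBlocks_smul, smul_zero]
  exact h2

lemma isTMotive_ext {ω : Fin ρ.rank → CInf Fq} (hω : ρ.IsPeriodBasis ω) (n : ℕ)
    (α : Kbar Fq) : IsTMotive Fq (ρ.extObj n α) := by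
  set p : (Kbar Fq)[X] := Polynomial.X - Polynomial.C (thetaBar Fq) with hp
  have hp0 : p ≠ 0 := Polynomial.X_sub_C_ne_zero _
  set E := Matrix.fromBlocks (dMatrix n ρ.phi) 0 (ρ.hRow n α) (1 : Matrix Unit Unit (Kbar Fq)[X])
    with hE
  have hE0 : E.det ≠ 0 := by
    rw [hE, Matrix.det_fromBlocks_zero₁₂, Matrix.det_one, mul_one]
    exact dMatrix_det_ne_zero n _ ρ.phi_det_ne_zero
  have hpE : (p • E).det ≠ 0 := by
    rw [Matrix.det_smul]
    exact mul_ne_zero (pow_ne_zero _ hp0) hE0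
  have hp1 : (p • (1 : Matrix Unit Unit (Kbar Fq)[X])).det ≠ 0 := by simpa using hp0
  set c := toGL (p • (1 : Matrix Unit Unit (Kbar Fq)[X])) hp1 with hc
  have hT1 := (ρ.isUniformizable_smul_ext hω n α).isTMotive hpE
  have hTc : IsTMotive Fq (matObj c) := isUniformizable_carlitz.isTMotive hp1
  have hten := IsTMotive.tensor _ _ hT1 (.dual _ hTc)
  have hcc : (c⁻¹).val () () * algebraMap (Kbar Fq)[X] (Kt Fq) p = 1 := by
    have h1 := congrFun (congrFun c.inv_mul ()) ()
    rw [Matrix.mul_apply, Fintype.sum_unique] at h1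
    have h2 : c.val () () = algebraMap (Kbar Fq)[X] (Kt Fq) p := by
      rw [hc, toGL_val]
      simp
    rw [← h2]
    simpa using h1
  refine .sub (ModuleCat.ofHom (matMap _ _
    (Matrix.of fun i (y : _ × Unit) => if i = y.1 then 1 else 0) ?_)) ?_ hten
  · ext i ⟨j, v⟩
    rw [Matrix.mul_apply, Matrix.mul_apply, Finset.sum_eq_single (i, ()), Finset.sum_eq_single j]
    · simp only [Matrix.map_apply, Matrix.of_apply, if_true, map_one, one_mul, mul_one]
      change algebraMap (Kbar Fq)[X] (Kt Fq) (p * E i j) * (c⁻¹).val () () =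
        algebraMap (Kbar Fq)[X] (Kt Fq) (E i j)
      rw [map_mul, mul_comm, ← mul_assoc, hcc, one_mul]
    · intro b _ hb
      simp [hb]
    · simp
    · rintro ⟨b, _⟩ _ hb
      have : i ≠ b := fun h => hb (by rw [h])
      simp [this]
    · simp
  · rw [ModuleCat.mono_iff_injective]
    intro x y h
    funext i
    have h1 := congrFun h (i, ())
    have h2 : ∀ z : (Fin (n + 1) × Fin ρ.rank) ⊕ Unit → Kt Fq, (z ᵥ* Matrix.of fun i
        (y : ((Fin (n + 1) × Fin ρ.rank) ⊕ Unit) × Unit) => if i = y.1 then 1 else 0) (i, ()) =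
        z i := by
      intro z
      rw [Matrix.vecMul, dotProduct, Finset.sum_eq_single i]
      · simp
      · intro b _ hb
        simp [hb]
      · simp
    exact (h2 x).symm.trans (h1.trans (h2 y))

lemma isTMotive_prol {ω : Fin ρ.rank → CInf Fq} (hω : ρ.IsPeriodBasis ω) (n : ℕ) :
    IsTMotive Fq (ρ.prol n) := by
  refine .sub (ρ.extIncl n 0) ?_ (ρ.isTMotive_ext hω n 0)
  rw [ModuleCat.mono_iff_injective]
  intro x y h
  have h' := ((ρ.extIncl_apply n 0 x).symm.trans h).trans (ρ.extIncl_apply n 0 y)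
  funext i
  exact congrFun h' (Sum.inl i)

lemma prolProj_apply (n : ℕ) (x : Fin (n + 1) × Fin ρ.rank → Kt Fq) :
    (ρ.prolProj n).hom x = (fun j => x (0, j) : Fin ρ.rank → Kt Fq) := by
  change x ᵥ* _ = _
  funext j
  rw [Matrix.vecMul, dotProduct, Finset.sum_eq_single (0, j)]
  · simp
  · rintro ⟨a, i⟩ _ h
    rw [Matrix.of_apply, if_neg, mul_zero]
    rintro ⟨h1, h2⟩
    exact h (Prod.ext h1 h2)
  · simp

lemma isTMotive_motive {ω : Fin ρ.rank → CInf Fq} (hω : ρ.IsPeriodBasis ω) :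
    IsTMotive Fq ρ.motive := by
  refine .quot (ρ.prolProj 0) ?_ (ρ.isTMotive_prol hω 0)
  rw [ModuleCat.epi_iff_surjective]
  intro x
  exact ⟨(fun y => x y.2 : Fin 1 × Fin ρ.rank → Kt Fq), ρ.prolProj_apply 0 _⟩

end DrinfeldModule

lemma isTMotive_pi {Fq : Type u} [Field Fq] [Fintype Fq] {w : ℕ} (M : Fin w → SigmaMod Fq)
    (h : ∀ i, IsTMotive Fq (M i)) : IsTMotive Fq (ModuleCat.of (SigmaRing Fq) (∀ i, M i)) :=
  ObjectProperty.prop_of_isLimit_fan _ (ModuleCat.productConeIsLimit M) h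

namespace DrinfeldModule

variable {Fq : Type u} [Field Fq] [Fintype Fq] (ρ : DrinfeldModule Fq)

section FibreProduct

variable {w : ℕ} (n : ℕ) (α : Fin w → Kbar Fq)

/-- The fibre product of the `Y_{i,n}` over the unit object. -/
def fibreProduct : Submodule (SigmaRing Fq) (∀ i, ρ.extObj n (α i)) where
  carrier := {y | ∀ i j, (ρ.extProj n (α i)).hom (y i) = (ρ.extProj n (α j)).hom (y j)}
  add_mem' hx hy i j := by
    rw [Pi.add_apply, Pi.add_apply, map_add, map_add, hx i j, hy i j]
  zero_mem' i j := by
    rw [Pi.zero_apply, Pi.zero_apply, map_zero, map_zero]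
  smul_mem' a x hx i j := by
    rw [Pi.smul_apply, Pi.smul_apply, map_smul, map_smul, hx i j]

lemma extProj_extIncl (a : Kbar Fq) (x : ρ.prol n) :
    (ρ.extProj n a).hom ((ρ.extIncl n a).hom x) = 0 :=
  (congrArg (ρ.extProj n a).hom (ρ.extIncl_apply n a x)).trans (ρ.extProj_apply n a _)

/-- The kernel of the projection of the fibre product to the unit object. -/
def fibreIncl : (∀ _ : Fin w, ρ.prol n) →ₗ[SigmaRing Fq] ρ.fibreProduct n α :=
  (LinearMap.pi fun i => (ρ.extIncl n (α i)).hom ∘ₗ LinearMap.proj i).codRestrict _ fun x i j =>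
    (ρ.extProj_extIncl n (α i) (x i)).trans (ρ.extProj_extIncl n (α j) (x j)).symm

/-- The component of the fibre product in `Y_{i,n}`. -/
def fibreComponent (i : Fin w) : ρ.fibreProduct n α →ₗ[SigmaRing Fq] ρ.extObj n (α i) :=
  LinearMap.proj i ∘ₗ (ρ.fibreProduct n α).subtype

lemma fibreIncl_injective : Function.Injective (ρ.fibreIncl n α) := by
  intro x y h
  funext i
  have h1 := congrFun (congrArg Subtype.val h) i
  have h2 := ((ρ.extIncl_apply n (α i) (x i)).symm.trans h1).trans (ρ.extIncl_apply n (α i) (y i))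
  funext j
  exact congrFun h2 (Sum.inl j)

variable {n α}

/-- The extension `0 → P_n M_ρ ^ w → Z → 1 → 0` of `t`-motives, where `Z` is the fibre product of
the `Y_{i,n}` over the unit object. -/
abbrev fibreComplex (i₀ : Fin w) (hP : IsTMotive Fq (ModuleCat.of (SigmaRing Fq)
      (∀ _ : Fin w, ρ.prol n)))
    (hZ : IsTMotive Fq (ModuleCat.of (SigmaRing Fq) (ρ.fibreProduct n α))) :
    ShortComplex (TMot Fq) where
  X₁ := ⟨_, hP⟩
  X₂ := ⟨_, hZ⟩
  X₃ := unitT Fq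
  f := ObjectProperty.homMk (ModuleCat.ofHom (ρ.fibreIncl n α))
  g := ObjectProperty.homMk (ModuleCat.ofHom (ρ.fibreComponent n α i₀) ≫ ρ.extProj n (α i₀))
  zero := by
    ext i x
    exact ρ.extProj_extIncl n (α i₀) _

lemma fibreComplex_shortExact (i₀ : Fin w) (hP : IsTMotive Fq (ModuleCat.of (SigmaRing Fq)
      (∀ _ : Fin w, ρ.prol n)))
    (hZ : IsTMotive Fq (ModuleCat.of (SigmaRing Fq) (ρ.fibreProduct n α))) :
    (ρ.fibreComplex i₀ hP hZ).ShortExact := by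
  refine shortExact_of_modules _ ?_ (ρ.fibreIncl_injective n α) ?_
  · rintro ⟨y, hy⟩
    constructor
    · intro h
      have h' : ∀ i, (ρ.extProj n (α i)).hom (y i) = 0 := fun i => (hy i i₀).trans h
      refine ⟨fun i => (y i ∘ Sum.inl : Fin (n + 1) × Fin ρ.rank → Kt Fq), Subtype.ext ?_⟩
      funext i
      refine (ρ.extIncl_apply n (α i) _).trans ?_
      have h2 : (y i ∘ Sum.inr : Unit → Kt Fq) = 0 :=
        (ρ.extProj_apply n (α i) (y i)).symm.trans (h' i)
      funext j
      rcases j with j | j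
      · rfl
      · exact (congrFun h2 j).symm
    · rintro ⟨x, hx⟩
      rw [← hx]
      exact ρ.extProj_extIncl n (α i₀) (x i₀)
  · intro z
    refine ⟨⟨fun _ => (Sum.elim 0 z : (Fin (n + 1) × Fin ρ.rank) ⊕ Unit → Kt Fq), ?_⟩, ?_⟩
    · intro i j
      exact (ρ.extProj_apply n (α i) _).trans (ρ.extProj_apply n (α j) _).symm
    · exact ρ.extProj_apply n (α i₀) _

/-- If a linear combination of push-outs of the `Y_{i,n}` splits, then the corresponding
combination of the projections extends from `P_n M_ρ ^ w` to the fibre product. -/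
lemma exists_extension_of_sum_eq_zero (i₀ : Fin w) (hM : IsTMotive Fq ρ.motive)
    (hP : IsTMotive Fq (ρ.prol n)) (hY : ∀ i, IsTMotive Fq (ρ.extObj n (α i)))
    (e : Fin w → End (⟨ρ.motive, hM⟩ : TMot Fq))
    (h0 : ∑ i, ρ.pushClass n (α i) hP (hY i) hM (e i) = 0) :
    ∃ G : ρ.fibreProduct n α →ₗ[SigmaRing Fq] ρ.prol n, ∀ x : Fin w → ρ.prol n,
      G (ρ.fibreIncl n α x) = ∑ i, (ρ.prolEnd n ((IsTMotive Fq).ι.map (e i))).hom (x i) := by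
  have hPw : IsTMotive Fq (ModuleCat.of (SigmaRing Fq) (∀ _ : Fin w, ρ.prol n)) :=
    isTMotive_pi _ fun _ => hP
  have hZ : IsTMotive Fq (ModuleCat.of (SigmaRing Fq) (ρ.fibreProduct n α)) := by
    refine .sub (ModuleCat.ofHom (ρ.fibreProduct n α).subtype) ?_ (isTMotive_pi _ hY)
    rw [ModuleCat.mono_iff_injective]
    exact Subtype.val_injective
  have hS := ρ.fibreComplex_shortExact i₀ hPw hZ
  let pr : ∀ i : Fin w, (⟨_, hPw⟩ : TMot Fq) ⟶ ⟨ρ.prol n, hP⟩ := fun i =>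
    ObjectProperty.homMk (ModuleCat.ofHom (LinearMap.proj i))
  let T : ∀ i : Fin w, (⟨ρ.prol n, hP⟩ : TMot Fq) ⟶ ⟨ρ.prol n, hP⟩ := fun i =>
    ObjectProperty.homMk (ρ.prolEnd n ((IsTMotive Fq).ι.map (e i)))
  let φ : ∀ i : Fin w, ρ.fibreComplex i₀ hPw hZ ⟶ ρ.extComplex n (α i) hP (hY i) := fun i =>
    { τ₁ := pr i
      τ₂ := ObjectProperty.homMk (ModuleCat.ofHom (ρ.fibreComponent n α i))
      τ₃ := 𝟙 _
      comm₁₂ := rfl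
      comm₂₃ := by
        ext x
        exact x.2 i i₀ }
  have h1 : ∀ i, hS.extClass.comp (Abelian.Ext.mk₀ (pr i)) (add_zero 1) =
      ρ.extClass n (α i) hP (hY i) := by
    intro i
    have := ShortComplex.ShortExact.extClass_naturality hS
      (ρ.extComplex_shortExact n (α i) hP (hY i)) (φ i)
    exact this.trans (Abelian.Ext.mk₀_id_comp _)
  have h2 : hS.extClass.comp (Abelian.Ext.mk₀ (∑ i, pr i ≫ T i)) (add_zero 1) = 0 := by
    rw [Abelian.Ext.mk₀_sum, Abelian.Ext.comp_sum, ← h0]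
    refine Finset.sum_congr rfl fun i _ => ?_
    rw [← Abelian.Ext.mk₀_comp_mk₀, ← Abelian.Ext.comp_assoc_of_second_deg_zero, h1]
    rfl
  obtain ⟨g, hg⟩ := Abelian.Ext.contravariant_sequence_exact₁ hS _ _ _ h2
  obtain ⟨g, rfl⟩ := Abelian.Ext.addEquiv₀.symm.surjective g
  change (Abelian.Ext.mk₀ _).comp (Abelian.Ext.mk₀ g) _ = _ at hg
  rw [Abelian.Ext.mk₀_comp_mk₀] at hg
  have hg' := Abelian.Ext.addEquiv₀.symm.injective hg
  refine ⟨g.hom.hom, fun x => ?_⟩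
  have h3 := congrArg (fun m : (⟨_, hPw⟩ : TMot Fq) ⟶ ⟨ρ.prol n, hP⟩ =>
    ((IsTMotive Fq).ι.map m).hom x) hg'
  simp only [Functor.map_sum, ModuleCat.hom_sum, LinearMap.sum_apply] at h3
  exact h3

/-- The row vector `(α, 0, …, 0)` over `k̄(t)`. -/
def unitRow (n : ℕ) (a : Kbar Fq) : Fin (n + 1) × Fin ρ.rank → Kt Fq :=
  fun x => algebraMap (Kbar Fq)[X] (Kt Fq) (ρ.hRow n a () x)

/-- The last basis vector of `Y_{α,n}`, which lifts the basis vector of the unit object. -/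
def extLift (n : ℕ) (a : Kbar Fq) : ρ.extObj n a :=
  (Sum.elim 0 1 : (Fin (n + 1) × Fin ρ.rank) ⊕ Unit → Kt Fq)

lemma sigmaS_smul_extLift (n : ℕ) (a : Kbar Fq) :
    sigmaS Fq • ρ.extLift n a =
      (Sum.elim (ρ.unitRow n a) 1 : (Fin (n + 1) × Fin ρ.rank) ⊕ Unit → Kt Fq) := by
  refine (sigmaS_smul (ρ.extGL n a) _).trans ?_
  rw [extGL, toGL_val, Matrix.fromBlocks_map]
  have h1 : untwist Fq ∘ (Sum.elim 0 1 : (Fin (n + 1) × Fin ρ.rank) ⊕ Unit → Kt Fq) =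
      (Sum.elim 0 1 : (Fin (n + 1) × Fin ρ.rank) ⊕ Unit → Kt Fq) := by
    funext i
    rcases i with i | i <;> simp
  refine (congrArg (· ᵥ* _) h1).trans ?_
  rw [Matrix.vecMul_fromBlocks]
  congr 1
  · funext x
    simp [Matrix.vecMul, dotProduct, unitRow]
  · funext x
    simp

/-- If a linear combination of push-outs of the `Y_{i,n}` splits, then an equation over `k̄(t)` is
solvable. -/
lemma exists_sigma_smul_eq_of_sum_eq_zero (i₀ : Fin w) (hM : IsTMotive Fq ρ.motive)
    (hP : IsTMotive Fq (ρ.prol n)) (hY : ∀ i, IsTMotive Fq (ρ.extObj n (α i)))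
    (e : Fin w → End (⟨ρ.motive, hM⟩ : TMot Fq))
    (h0 : ∑ i, ρ.pushClass n (α i) hP (hY i) hM (e i) = 0) :
    ∃ γ : ρ.prol n, sigmaS Fq • γ =
      γ + ∑ i, (ρ.prolEnd n ((IsTMotive Fq).ι.map (e i))).hom (ρ.unitRow n (α i)) := by
  obtain ⟨G, hG⟩ := ρ.exists_extension_of_sum_eq_zero i₀ hM hP hY e h0
  let y : ρ.fibreProduct n α :=
    ⟨fun i => ρ.extLift n (α i), fun i j =>
      (ρ.extProj_apply n (α i) _).trans (ρ.extProj_apply n (α j) _).symm⟩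
  refine ⟨G y, ?_⟩
  refine Eq.trans ?_ (congrArg (G y + ·) (hG fun i => ρ.unitRow n (α i)))
  refine Eq.trans ?_ (map_add G y _)
  refine (G.map_smul (sigmaS Fq) y).symm.trans (congrArg G (Subtype.ext ?_))
  funext i
  refine (ρ.sigmaS_smul_extLift n (α i)).trans ?_
  refine Eq.trans ?_ (congrArg (fun z : ρ.extObj n (α i) => ρ.extLift n (α i) + z)
    (ρ.extIncl_apply n (α i) (ρ.unitRow n (α i)))).symm
  funext j
  rcases j with j | j
  · exact (zero_add _).symm
  · exact (add_zero _).symm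

end FibreProduct

end DrinfeldModule

section Denominators

variable {Fq : Type u} [Field Fq] [Fintype Fq]

lemma untwist_algebraMap (p : (Kbar Fq)[X]) :
    untwist Fq (algebraMap (Kbar Fq)[X] (Kt Fq) p) =
      algebraMap (Kbar Fq)[X] (Kt Fq) (polyUntwist Fq p) :=
  IsFractionRing.ringEquivOfRingEquiv_algebraMap _ _

/-- The polynomials inside `k̄(t)`. -/
abbrev polySubring (Fq : Type u) [Field Fq] [Fintype Fq] : Subring (Kt Fq) :=
  (algebraMap (Kbar Fq)[X] (Kt Fq)).range

lemma algebraMap_mem_polySubring (p : (Kbar Fq)[X]) :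
    algebraMap (Kbar Fq)[X] (Kt Fq) p ∈ polySubring Fq := ⟨p, rfl⟩

/-- The common denominators of a family of rational functions. -/
def denomIdeal {I : Type} (x : I → Kt Fq) : Ideal (Kbar Fq)[X] where
  carrier := {d | ∀ i, algebraMap (Kbar Fq)[X] (Kt Fq) d * x i ∈ polySubring Fq}
  add_mem' ha hb i := by
    rw [map_add, add_mul]
    exact add_mem (ha i) (hb i)
  zero_mem' i := by
    rw [map_zero, zero_mul]
    exact zero_mem _
  smul_mem' c d hd i := by
    rw [smul_eq_mul, map_mul, mul_assoc]
    exact mul_mem (algebraMap_mem_polySubring c) (hd i)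

lemma mem_denomIdeal {I : Type} {x : I → Kt Fq} {d : (Kbar Fq)[X]} : d ∈ denomIdeal x ↔
    ∀ i, algebraMap (Kbar Fq)[X] (Kt Fq) d * x i ∈ polySubring Fq := Iff.rfl

lemma polyUntwist_mem_denomIdeal {I : Type} {x : I → Kt Fq} {d : (Kbar Fq)[X]} :
    polyUntwist Fq d ∈ denomIdeal (fun i => untwist Fq (x i)) ↔ d ∈ denomIdeal x := by
  rw [mem_denomIdeal, mem_denomIdeal]
  refine forall_congr' fun i => ?_
  rw [← untwist_algebraMap, ← map_mul]
  constructor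
  · rintro ⟨p, hp⟩
    refine ⟨(polyUntwist Fq).symm p, (untwist Fq).injective ?_⟩
    rw [untwist_algebraMap, RingEquiv.apply_symm_apply]
    exact hp
  · rintro ⟨p, hp⟩
    exact ⟨polyUntwist Fq p, by rw [← untwist_algebraMap, hp]⟩

lemma exists_monic_span_eq {I : Ideal (Kbar Fq)[X]} (hI : I ≠ ⊥) :
    ∃ d : (Kbar Fq)[X], d.Monic ∧ I = Ideal.span {d} := by
  obtain ⟨g, hg⟩ := IsPrincipalIdealRing.principal I
  have hg0 : g ≠ 0 := by
    rintro rfl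
    exact hI (by rw [hg]; simp)
  refine ⟨g * Polynomial.C g.leadingCoeff⁻¹, Polynomial.monic_mul_leadingCoeff_inv hg0, ?_⟩
  rw [Ideal.span_singleton_mul_right_unit]
  · exact hg
  · exact Polynomial.isUnit_C.2 (isUnit_iff_ne_zero.2 (inv_ne_zero (by simpa using hg0)))

lemma eq_of_dvd_X_sub_C_mul {d d' : (Kbar Fq)[X]} (hd : d.Monic) (hd' : d'.Monic)
    (hdeg : d.natDegree = d'.natDegree) {a : Kbar Fq}
    (h1 : d' ∣ (Polynomial.X - Polynomial.C a) * d)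
    (h2 : d ∣ (Polynomial.X - Polynomial.C a) * d') : d = d' := by
  obtain ⟨e, he⟩ := h1
  obtain ⟨e', he'⟩ := h2
  have hXa := Polynomial.monic_X_sub_C a
  have hem : e.Monic := hd'.of_mul_monic_left (he ▸ hXa.mul hd)
  have hnat : e.natDegree = 1 := by
    have := congrArg Polynomial.natDegree he
    rw [hXa.natDegree_mul hd, hd'.natDegree_mul hem, Polynomial.natDegree_X_sub_C, hdeg] at this
    omega
  have hee : e * e' = (Polynomial.X - Polynomial.C a) ^ 2 := by
    refine mul_left_cancel₀ (mul_ne_zero hd.ne_zero hd'.ne_zero) ?_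
    linear_combination (-(d * e')) * he - ((Polynomial.X - Polynomial.C a) * d) * he'
  have heX := hem.eq_X_add_C hnat
  have hev := congrArg (Polynomial.eval (-e.coeff 0)) hee
  rw [Polynomial.eval_mul, heX] at hev
  simp at hev
  have hea : e = Polynomial.X - Polynomial.C a := by
    have ha : a = -e.coeff 0 :=
      (sub_eq_zero.1 ((pow_eq_zero_iff two_ne_zero).1 hev.symm)).symm
    rw [heX, ha]
    simp
  rw [hea, mul_comm d'] at he
  exact mul_left_cancel₀ hXa.ne_zero he

lemma exists_map_eq_of_polyUntwist_eq {d : (Kbar Fq)[X]} (h : polyUntwist Fq d = d) :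
    ∃ g : Fq[X], g.map (algebraMap Fq (Kbar Fq)) = d := by
  have hlift : d ∈ Polynomial.lifts (algebraMap Fq (Kbar Fq)) := by
    rw [Polynomial.lifts_iff_coeff_lifts]
    intro m
    have h1 := congrArg (fun p => Polynomial.coeff p m) h
    rw [polyUntwist_eq_map] at h1
    simp only [Polynomial.coeff_map] at h1
    have h2 : d.coeff m = frobKbar Fq (d.coeff m) := (RingEquiv.symm_apply_eq _).1 h1
    obtain ⟨b, hb⟩ := exists_algebraMap_eq_of_pow_eq (Fq := Fq) (x := (d.coeff m : CInf Fq))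
      (congrArg Subtype.val h2).symm
    exact ⟨b, Subtype.ext hb⟩
  obtain ⟨g, hg⟩ := hlift
  exact ⟨g, hg⟩

lemma polyUntwist_map (g : Fq[X]) : polyUntwist Fq (g.map (algebraMap Fq (Kbar Fq))) =
    g.map (algebraMap Fq (Kbar Fq)) := by
  rw [polyUntwist_eq_map, Polynomial.map_map]
  congr 1
  ext b : 1
  rw [RingHom.comp_apply]
  refine (RingEquiv.symm_apply_eq _).2 ?_
  change _ = (algebraMap Fq (Kbar Fq) b) ^ q Fq
  rw [← map_pow, FiniteField.pow_card]

/-- A finite family whose common denominator and that of its twist differ at most by a factor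
`t - θ` has a common denominator in `F_q[t]`. -/
lemma exists_denominator {I : Type} [Finite I] (x : I → Kt Fq)
    (h1 : ∀ d, d ∈ denomIdeal x → (Polynomial.X - Polynomial.C (thetaBar Fq)) * d ∈
      denomIdeal (fun i => untwist Fq (x i)))
    (h2 : ∀ d, d ∈ denomIdeal (fun i => untwist Fq (x i)) →
      (Polynomial.X - Polynomial.C (thetaBar Fq)) * d ∈ denomIdeal x) :
    ∃ g : Fq[X], g ≠ 0 ∧ ∀ i, ∃ p : (Kbar Fq)[X], algebraMap (Kbar Fq)[X] (Kt Fq) p =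
      algebraMap (Kbar Fq)[X] (Kt Fq) (g.map (algebraMap Fq (Kbar Fq))) * x i := by
  have hne : denomIdeal x ≠ ⊥ := by
    obtain ⟨b, hb⟩ := IsLocalization.exist_integer_multiples_of_finite
      (nonZeroDivisors (Kbar Fq)[X]) x
    intro h
    have hb' : (b : (Kbar Fq)[X]) ∈ denomIdeal x := fun i => by
      obtain ⟨p, hp⟩ := hb i
      exact ⟨p, by rw [hp, Algebra.smul_def]⟩
    rw [h, Ideal.mem_bot] at hb'
    exact nonZeroDivisors.coe_ne_zero b hb'
  obtain ⟨d, hd, hspan⟩ := exists_monic_span_eq hne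
  have hdmem : d ∈ denomIdeal x := by
    rw [hspan]
    exact Ideal.mem_span_singleton_self d
  have hd' : (polyUntwist Fq d).Monic := by
    rw [polyUntwist_eq_map]
    exact hd.map _
  have h3 : polyUntwist Fq d ∣ (Polynomial.X - Polynomial.C (thetaBar Fq)) * d := by
    have h4 := h1 d hdmem
    rw [← (polyUntwist Fq).apply_symm_apply ((Polynomial.X - Polynomial.C (thetaBar Fq)) * d),
      polyUntwist_mem_denomIdeal, hspan, Ideal.mem_span_singleton] at h4
    have h5 := map_dvd (polyUntwist Fq) h4
    rwa [RingEquiv.apply_symm_apply] at h5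
  have h4 : d ∣ (Polynomial.X - Polynomial.C (thetaBar Fq)) * polyUntwist Fq d := by
    rw [← Ideal.mem_span_singleton, ← hspan]
    exact h2 _ (polyUntwist_mem_denomIdeal.2 hdmem)
  have h5 := eq_of_dvd_X_sub_C_mul hd hd'
    (Polynomial.natDegree_eq_of_degree_eq (degree_polyUntwist d).symm) h3 h4
  obtain ⟨g, hg⟩ := exists_map_eq_of_polyUntwist_eq h5.symm
  refine ⟨g, ?_, fun i => ?_⟩
  · rintro rfl
    rw [Polynomial.map_zero] at hg
    exact hd.ne_zero hg.symm
  · rw [hg]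
    exact hdmem i

end Denominators

section Morphisms

variable {Fq : Type u} [Field Fq] [Fintype Fq]
variable {ι κ : Type} [Fintype ι] [DecidableEq ι] [Fintype κ] [DecidableEq κ]

/-- A morphism of pre-`t`-motives is given by a matrix. -/
lemma exists_eq_matMap {Φ : GL ι (Kt Fq)} {Φ' : GL κ (Kt Fq)}
    (f : MatMod Φ →ₗ[SigmaRing Fq] MatMod Φ') :
    ∃ (E : Matrix ι κ (Kt Fq)) (hE : E.map (untwist Fq) * Φ'.val = Φ.val * E),
      f = matMap Φ Φ' E hE := by
  let b : ι → MatMod Φ := fun i => (Pi.single i 1 : ι → Kt Fq)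
  let E : Matrix ι κ (Kt Fq) := Matrix.of fun i => (f (b i) : κ → Kt Fq)
  have hsum : ∀ x : ι → Kt Fq, (f x : κ → Kt Fq) = x ᵥ* E := by
    intro x
    have h1 : (x : MatMod Φ) = ∑ i, constS Fq (x i) • b i := by
      have h2 : ∀ i, constS Fq (x i) • b i = (Pi.single i (x i) : ι → Kt Fq) := by
        intro i
        rw [constS_smul]
        funext j
        by_cases hj : j = i
        · subst hj
          simp [b]
        · simp [b, hj]
      rw [Finset.sum_congr rfl fun i _ => h2 i]
      exact (Finset.univ_sum_single x).symm
    have h3 : f x = ∑ i, constS Fq (x i) • f (b i) := by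
      refine (congrArg f h1).trans ((map_sum f _ _).trans ?_)
      exact Finset.sum_congr rfl fun i _ => f.map_smul _ _
    rw [h3, Matrix.vecMul_eq_sum]
    refine Finset.sum_congr rfl fun i _ => ?_
    rw [constS_smul]
    rfl
  have hE : E.map (untwist Fq) * Φ'.val = Φ.val * E := by
    ext i j
    have h1 := f.map_smul (sigmaS Fq) (b i)
    rw [sigmaS_smul, sigmaS_smul] at h1
    have h2 := (hsum _).symm.trans h1
    have h3 : untwist Fq ∘ b i = (Pi.single i 1 : ι → Kt Fq) := by
      funext j
      by_cases hj : j = i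
      · subst hj
        simp [b]
      · simp [b, hj]
    have h4 : ((Pi.single i 1 : ι → Kt Fq) ᵥ* Φ.val) ᵥ* E =
        (untwist Fq ∘ (f (b i) : κ → Kt Fq)) ᵥ* Φ'.val := by
      rw [← h3]
      exact h2
    rw [Matrix.single_one_vecMul] at h4
    exact congrFun h4.symm j
  exact ⟨E, hE, LinearMap.ext hsum⟩

end Morphisms

namespace DrinfeldModule

variable {Fq : Type u} [Field Fq] [Fintype Fq] (ρ : DrinfeldModule Fq)

lemma phi_map_mul_adjugate : ∃ c : Kbar Fq, c ≠ 0 ∧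
    ρ.phi * (Polynomial.C c • ρ.phi.adjugate) =
      (Polynomial.X - Polynomial.C (thetaBar Fq)) • (1 : Matrix _ _ (Kbar Fq)[X]) ∧
    (Polynomial.C c • ρ.phi.adjugate) * ρ.phi =
      (Polynomial.X - Polynomial.C (thetaBar Fq)) • (1 : Matrix _ _ (Kbar Fq)[X]) := by
  obtain ⟨c, hc, h⟩ := ρ.exists_phi_det_eq
  have h1 : Polynomial.C c⁻¹ * ρ.phi.det = Polynomial.X - Polynomial.C (thetaBar Fq) := by
    rw [h, ← mul_assoc, ← Polynomial.C_mul, inv_mul_cancel₀ hc, Polynomial.C_1, one_mul]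
  refine ⟨c⁻¹, inv_ne_zero hc, ?_, ?_⟩
  · rw [Matrix.mul_smul, Matrix.mul_adjugate, smul_smul, h1]
  · rw [Matrix.smul_mul, Matrix.adjugate_mul, smul_smul, h1]

/-- The matrix `(t - θ) Φ_ρ⁻¹` is polynomial. -/
def phiCo : Matrix (Fin ρ.rank) (Fin ρ.rank) (Kbar Fq)[X] :=
  Polynomial.C (Classical.choose ρ.phi_map_mul_adjugate) • ρ.phi.adjugate

lemma phi_mul_phiCo : ρ.phi * ρ.phiCo =
    (Polynomial.X - Polynomial.C (thetaBar Fq)) • (1 : Matrix _ _ (Kbar Fq)[X]) :=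
  (Classical.choose_spec ρ.phi_map_mul_adjugate).2.1

lemma phiCo_mul_phi : ρ.phiCo * ρ.phi =
    (Polynomial.X - Polynomial.C (thetaBar Fq)) • (1 : Matrix _ _ (Kbar Fq)[X]) :=
  (Classical.choose_spec ρ.phi_map_mul_adjugate).2.2

/-- A polynomial solution of `x^{(-1)} Φ_ρ = x` vanishes. -/
lemma eq_zero_of_polySigma_eq {x : Fin ρ.rank → (Kbar Fq)[X]} (h : polySigma ρ.phi x = x) :
    x = 0 := by
  have h1 := ρ.degree_weightMap_polySigma x
  rw [h] at h1
  have h2 : weightMap Fq ρ.rank x = 0 := by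
    by_contra hne
    rw [Polynomial.degree_eq_natDegree hne] at h1
    have h3 : (weightMap Fq ρ.rank x).natDegree = (weightMap Fq ρ.rank x).natDegree + 1 := by
      exact_mod_cast h1
    omega
  exact weightMap_injective ρ.rank_pos (h2.trans (map_zero _).symm)

end DrinfeldModule

section Clearing

variable {Fq : Type u} [Field Fq] [Fintype Fq]
variable {ι κ : Type} [Fintype ι]

lemma vecMul_mem_polySubring {x : ι → Kt Fq} (hx : ∀ i, x i ∈ polySubring Fq)
    (B : Matrix ι κ (Kbar Fq)[X]) (j : κ) :
    (x ᵥ* B.map (algebraMap (Kbar Fq)[X] (Kt Fq))) j ∈ polySubring Fq :=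
  sum_mem fun i _ => mul_mem (hx i) (algebraMap_mem_polySubring _)

lemma mulVec_mem_polySubring {x : ι → Kt Fq} (hx : ∀ i, x i ∈ polySubring Fq)
    (B : Matrix κ ι (Kbar Fq)[X]) (j : κ) :
    (B.map (algebraMap (Kbar Fq)[X] (Kt Fq)) *ᵥ x) j ∈ polySubring Fq :=
  sum_mem fun i _ => mul_mem (algebraMap_mem_polySubring _) (hx i)

lemma mul_mul_mem_polySubring {E : Matrix ι ι (Kt Fq)} {d : Kt Fq}
    (hE : ∀ i j, d * E i j ∈ polySubring Fq) (A B : Matrix ι ι (Kbar Fq)[X]) (i j : ι) :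
    d * (A.map (algebraMap (Kbar Fq)[X] (Kt Fq)) * E * B.map (algebraMap (Kbar Fq)[X] (Kt Fq))) i j
      ∈ polySubring Fq := by
  have h1 : d * (A.map (algebraMap (Kbar Fq)[X] (Kt Fq)) * E *
      B.map (algebraMap (Kbar Fq)[X] (Kt Fq))) i j = ((fun l => d *
      (A.map (algebraMap (Kbar Fq)[X] (Kt Fq)) * E) i l) ᵥ*
        B.map (algebraMap (Kbar Fq)[X] (Kt Fq))) j := by
    rw [Matrix.mul_apply, Matrix.vecMul, dotProduct, Finset.mul_sum]
    exact Finset.sum_congr rfl fun l _ => (mul_assoc _ _ _).symm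
  rw [h1]
  refine vecMul_mem_polySubring (fun l => ?_) B j
  have h2 : d * (A.map (algebraMap (Kbar Fq)[X] (Kt Fq)) * E) i l =
      (A.map (algebraMap (Kbar Fq)[X] (Kt Fq)) *ᵥ fun m => d * E m l) i := by
    rw [Matrix.mul_apply, Matrix.mulVec, dotProduct, Finset.mul_sum]
    exact Finset.sum_congr rfl fun m _ => mul_left_comm _ _ _
  rw [h2]
  exact mulVec_mem_polySubring (fun m => hE m l) A i

lemma algebraMap_polySigma (Φ : Matrix ι ι (Kbar Fq)[X]) (y : ι → (Kbar Fq)[X]) :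
    algebraMap (Kbar Fq)[X] (Kt Fq) ∘ polySigma Φ y =
      (untwist Fq ∘ (algebraMap (Kbar Fq)[X] (Kt Fq) ∘ y)) ᵥ*
        Φ.map (algebraMap (Kbar Fq)[X] (Kt Fq)) := by
  have h1 : untwist Fq ∘ (algebraMap (Kbar Fq)[X] (Kt Fq) ∘ y) =
      algebraMap (Kbar Fq)[X] (Kt Fq) ∘ (polyUntwist Fq ∘ y) := by
    funext i
    exact untwist_algebraMap _
  rw [h1]
  funext j
  exact RingHom.map_vecMul _ _ _ j

end Clearing

namespace DrinfeldModule

variable {Fq : Type u} [Field Fq] [Fintype Fq] (ρ : DrinfeldModule Fq)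

lemma phi_map_mul_phiCo_map : ρ.phi.map (algebraMap (Kbar Fq)[X] (Kt Fq)) *
    ρ.phiCo.map (algebraMap (Kbar Fq)[X] (Kt Fq)) =
      algebraMap (Kbar Fq)[X] (Kt Fq) (Polynomial.X - Polynomial.C (thetaBar Fq)) • 1 := by
  rw [← Matrix.map_mul, phi_mul_phiCo]
  ext i j
  by_cases h : i = j
  · subst h
    simp
  · simp [h]

lemma phiCo_map_mul_phi_map : ρ.phiCo.map (algebraMap (Kbar Fq)[X] (Kt Fq)) *
    ρ.phi.map (algebraMap (Kbar Fq)[X] (Kt Fq)) =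
      algebraMap (Kbar Fq)[X] (Kt Fq) (Polynomial.X - Polynomial.C (thetaBar Fq)) • 1 := by
  rw [← Matrix.map_mul, phiCo_mul_phi]
  ext i j
  by_cases h : i = j
  · subst h
    simp
  · simp [h]

/-- Endomorphisms of `M_ρ` have a common denominator in `F_q[t]`. -/
lemma exists_clear_endomorphisms {w : ℕ} (E : Fin w → Matrix (Fin ρ.rank) (Fin ρ.rank) (Kt Fq))
    (hE : ∀ k, (E k).map (untwist Fq) * ρ.phi.map (algebraMap (Kbar Fq)[X] (Kt Fq)) =
      ρ.phi.map (algebraMap (Kbar Fq)[X] (Kt Fq)) * E k) :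
    ∃ (g : Fq[X]) (F : Fin w → Matrix (Fin ρ.rank) (Fin ρ.rank) (Kbar Fq)[X]), g ≠ 0 ∧
      (∀ k, (F k).map (algebraMap (Kbar Fq)[X] (Kt Fq)) =
        algebraMap (Kbar Fq)[X] (Kt Fq) (g.map (algebraMap Fq (Kbar Fq))) • E k) ∧
      ∀ k, (F k).map (polyUntwist Fq) * ρ.phi = ρ.phi * F k := by
  set alg := algebraMap (Kbar Fq)[X] (Kt Fq) with halg
  set P := ρ.phi.map alg with hP
  set Q := ρ.phiCo.map alg with hQ
  set p : (Kbar Fq)[X] := Polynomial.X - Polynomial.C (thetaBar Fq) with hp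
  have h1 : ∀ k, P * E k * Q = alg p • (E k).map (untwist Fq) := by
    intro k
    rw [← hE, Matrix.mul_assoc, phi_map_mul_phiCo_map, Matrix.mul_smul, Matrix.mul_one]
  have h2 : ∀ k, Q * (E k).map (untwist Fq) * P = alg p • E k := by
    intro k
    rw [Matrix.mul_assoc, hE, ← Matrix.mul_assoc, phiCo_map_mul_phi_map, Matrix.smul_mul,
      Matrix.one_mul]
  obtain ⟨g, hg, hF⟩ := exists_denominator
    (fun x : Fin w × Fin ρ.rank × Fin ρ.rank => E x.1 x.2.1 x.2.2) (by
      rintro d hd ⟨k, i, j⟩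
      have h3 := mul_mul_mem_polySubring (fun i j => hd (k, i, j)) ρ.phi ρ.phiCo i j
      rw [h1] at h3
      rw [map_mul, mul_comm (alg p), mul_assoc]
      exact h3) (by
      rintro d hd ⟨k, i, j⟩
      have h3 := mul_mul_mem_polySubring (E := (E k).map (untwist Fq))
        (fun i j => hd (k, i, j)) ρ.phiCo ρ.phi i j
      rw [h2] at h3
      rw [map_mul, mul_comm (alg p), mul_assoc]
      exact h3)
  choose F hF using hF
  have hFE : ∀ k, (Matrix.of fun i j => F (k, i, j)).map alg =
      alg (g.map (algebraMap Fq (Kbar Fq))) • E k := by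
    intro k
    ext i j
    exact hF (k, i, j)
  refine ⟨g, fun k => Matrix.of fun i j => F (k, i, j), hg, hFE, fun k => ?_⟩
  have hinj : Function.Injective alg := IsFractionRing.injective _ _
  refine Matrix.map_injective hinj ?_
  dsimp only
  rw [Matrix.map_mul, Matrix.map_mul, hFE, Matrix.mul_smul, ← hE, ← Matrix.smul_mul]
  congr 1
  ext i j
  rw [Matrix.map_apply, Matrix.map_apply, ← untwist_algebraMap, ← halg, Matrix.of_apply,
    hF, map_mul, halg, untwist_algebraMap, polyUntwist_map]
  rfl

/-- A solution of `x^{(-1)} Φ_ρ = x + η` with polynomial `η` has a denominator in `F_q[t]`. -/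
lemma exists_clear_solution {x : Fin ρ.rank → Kt Fq} {η : Fin ρ.rank → (Kbar Fq)[X]}
    (h : (untwist Fq ∘ x) ᵥ* ρ.phi.map (algebraMap (Kbar Fq)[X] (Kt Fq)) =
      x + algebraMap (Kbar Fq)[X] (Kt Fq) ∘ η) :
    ∃ (g : Fq[X]) (y : Fin ρ.rank → (Kbar Fq)[X]), g ≠ 0 ∧
      algebraMap (Kbar Fq)[X] (Kt Fq) ∘ y =
        algebraMap (Kbar Fq)[X] (Kt Fq) (g.map (algebraMap Fq (Kbar Fq))) • x ∧
      polySigma ρ.phi y = y + g.map (algebraMap Fq (Kbar Fq)) • η := by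
  set alg := algebraMap (Kbar Fq)[X] (Kt Fq) with halg
  set P := ρ.phi.map alg with hP
  set Q := ρ.phiCo.map alg with hQ
  set p : (Kbar Fq)[X] := Polynomial.X - Polynomial.C (thetaBar Fq) with hp
  obtain ⟨g, hg, hy⟩ := exists_denominator x (by
      intro d hd j
      have h1 : alg p • (untwist Fq ∘ x) = (x + alg ∘ η) ᵥ* Q := by
        rw [← h, Matrix.vecMul_vecMul, phi_map_mul_phiCo_map, Matrix.vecMul_smul,
          Matrix.vecMul_one]
      have h2 : alg (p * d) * untwist Fq (x j) = ((alg d • (x + alg ∘ η)) ᵥ* Q) j := by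
        rw [Matrix.smul_vecMul, ← h1, map_mul, mul_comm (alg p), mul_assoc]
        rfl
      rw [h2]
      refine vecMul_mem_polySubring (fun i => ?_) ρ.phiCo j
      rw [Pi.smul_apply, smul_eq_mul, Pi.add_apply, mul_add]
      exact add_mem (hd i) (mul_mem (algebraMap_mem_polySubring _)
        (algebraMap_mem_polySubring _))) (by
      intro d hd j
      have h1 : x j = ((untwist Fq ∘ x) ᵥ* P) j - alg (η j) := by
        rw [h]
        simp
      have h2 : alg d * ((untwist Fq ∘ x) ᵥ* P) j = ((alg d • (untwist Fq ∘ x)) ᵥ* P) j := by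
        rw [Matrix.smul_vecMul]
        rfl
      rw [map_mul, mul_assoc, h1, mul_sub, h2]
      exact mul_mem (algebraMap_mem_polySubring _) (sub_mem
        (vecMul_mem_polySubring (fun i => hd i) ρ.phi j)
        (mul_mem (algebraMap_mem_polySubring _) (algebraMap_mem_polySubring _))))
  choose y hy using hy
  have hyx : alg ∘ y = alg (g.map (algebraMap Fq (Kbar Fq))) • x := funext hy
  refine ⟨g, y, hg, hyx, ?_⟩
  have hinj : Function.Injective alg := IsFractionRing.injective _ _
  refine hinj.comp_left ?_
  dsimp only
  rw [algebraMap_polySigma, ← halg, hyx]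
  have h3 : untwist Fq ∘ (alg (g.map (algebraMap Fq (Kbar Fq))) • x) =
      alg (g.map (algebraMap Fq (Kbar Fq))) • (untwist Fq ∘ x) := by
    funext i
    rw [Function.comp_apply, Pi.smul_apply, Pi.smul_apply, smul_eq_mul, smul_eq_mul, map_mul, halg,
      untwist_algebraMap, polyUntwist_map]
    rfl
  rw [h3, Matrix.smul_vecMul, h, smul_add, ← hyx]
  funext i
  simp

/-- There are no nonzero morphisms from the unit object to `M_ρ`. -/
lemma eq_zero_of_untwist_vecMul_eq {x : Fin ρ.rank → Kt Fq}
    (h : (untwist Fq ∘ x) ᵥ* ρ.phi.map (algebraMap (Kbar Fq)[X] (Kt Fq)) = x) : x = 0 := by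
  obtain ⟨g, y, hg, hyx, hy⟩ := ρ.exists_clear_solution (x := x) (η := 0) (by
    rw [h]
    funext i
    simp)
  rw [smul_zero, add_zero] at hy
  have h0 := ρ.eq_zero_of_polySigma_eq hy
  have hg0 : algebraMap (Kbar Fq)[X] (Kt Fq) (g.map (algebraMap Fq (Kbar Fq))) ≠ 0 := by
    rw [Ne, FaithfulSMul.algebraMap_eq_zero_iff, Polynomial.map_eq_zero]
    exact hg
  funext i
  have h1 := congrFun hyx i
  rw [h0, Function.comp_apply, Pi.zero_apply, map_zero, Pi.smul_apply, smul_eq_mul] at h1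
  exact (mul_eq_zero.1 h1.symm).resolve_left hg0

end DrinfeldModule

namespace DrinfeldModule

variable {Fq : Type u} [Field Fq] [Fintype Fq] (ρ : DrinfeldModule Fq)

lemma prolEnd_unitRow (n : ℕ) (a : Kbar Fq) (E : Matrix (Fin ρ.rank) (Fin ρ.rank) (Kt Fq))
    (hE : E.map (untwist Fq) * ρ.motiveGL.val = ρ.motiveGL.val * E) :
    (ρ.prolEnd n (ModuleCat.ofHom (matMap _ _ E hE))).hom (ρ.unitRow n a) =
      (fun z => if z.1 = Fin.last n then
        algebraMap (Kbar Fq)[X] (Kt Fq) (Polynomial.C a) * E ρ.zeroIdx z.2 else 0 :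
        Fin (n + 1) × Fin ρ.rank → Kt Fq) := by
  refine (ρ.prolEnd_matMap n E hE _).trans ?_
  funext z
  rw [Matrix.vecMul, dotProduct, Finset.sum_eq_single (0, ρ.zeroIdx)]
  · simp [unitRow, hRow, zeroIdx]
  · rintro ⟨b, i⟩ _ hb
    have : ¬ ((b : ℕ) = 0 ∧ (i : ℕ) = 0) := fun h =>
      hb (Prod.ext (Fin.ext (by simpa using h.1)) (Fin.ext h.2))
    have h0 : ρ.unitRow n a (b, i) = 0 := by
      rw [unitRow, hRow, if_neg this, map_zero]
    rw [h0, zero_mul]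
  · simp

/-- In the first non-vanishing block, the action of `σ` on the prolongation is that of `M_ρ`. -/
lemma sigma_prol_apply {n : ℕ} {γ : Fin (n + 1) × Fin ρ.rank → Kt Fq} {b : Fin (n + 1)}
    (h : ∀ a < b, ∀ i, γ (a, i) = 0) (j : Fin ρ.rank) :
    ((untwist Fq ∘ γ) ᵥ* (ρ.prolGL n).val) (b, j) =
      ((untwist Fq ∘ fun i => γ (b, i)) ᵥ*
        ρ.phi.map (algebraMap (Kbar Fq)[X] (Kt Fq))) j := by
  rw [Matrix.vecMul, dotProduct, Fintype.sum_prod_type, Finset.sum_eq_single b]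
  · simp [Matrix.vecMul, dotProduct, prolGL, toGL_val, dMatrix]
  · intro a _ hab
    rcases lt_or_gt_of_ne hab with hlt | hgt
    · refine Finset.sum_eq_zero fun i _ => ?_
      rw [Function.comp_apply, h a hlt, map_zero, zero_mul]
    · refine Finset.sum_eq_zero fun i _ => ?_
      simp [prolGL, toGL_val, dMatrix, not_le.2 hgt]
  · simp

lemma exists_hom_eq_matMap (e : ρ.motive ⟶ ρ.motive) :
    ∃ (E : Matrix (Fin ρ.rank) (Fin ρ.rank) (Kt Fq))
      (hE : E.map (untwist Fq) * ρ.motiveGL.val = ρ.motiveGL.val * E),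
      e = ModuleCat.ofHom (matMap ρ.motiveGL ρ.motiveGL E hE) := by
  obtain ⟨E, hE, h⟩ := exists_eq_matMap (Φ := ρ.motiveGL) (Φ' := ρ.motiveGL) e.hom
  exact ⟨E, hE, ModuleCat.hom_ext h⟩

/-- A linear relation between the extension classes gives a solution of a `σ`-difference
equation over `k̄(t)`. -/
lemma exists_rational_relation {w n : ℕ} {α : Fin w → Kbar Fq} (i₀ : Fin w)
    (hM : IsTMotive Fq ρ.motive)
    (hP : IsTMotive Fq (ρ.prol n)) (hY : ∀ i, IsTMotive Fq (ρ.extObj n (α i)))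
    (e : Fin w → End (⟨ρ.motive, hM⟩ : TMot Fq))
    (h0 : ∑ i, ρ.pushClass n (α i) hP (hY i) hM (e i) = 0) :
    ∃ (E : Fin w → Matrix (Fin ρ.rank) (Fin ρ.rank) (Kt Fq)) (x : Fin ρ.rank → Kt Fq),
      (∀ k, (E k).map (untwist Fq) * ρ.phi.map (algebraMap (Kbar Fq)[X] (Kt Fq)) =
        ρ.phi.map (algebraMap (Kbar Fq)[X] (Kt Fq)) * E k) ∧
      ((untwist Fq ∘ x) ᵥ* ρ.phi.map (algebraMap (Kbar Fq)[X] (Kt Fq)) = x + fun j =>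
        ∑ k, algebraMap (Kbar Fq)[X] (Kt Fq) (Polynomial.C (α k)) * E k ρ.zeroIdx j) ∧
      ∀ k, E k = 0 → e k = 0 := by
  obtain ⟨γ, hγ⟩ := ρ.exists_sigma_smul_eq_of_sum_eq_zero i₀ hM hP hY e h0
  choose E hE hEe using fun k => ρ.exists_hom_eq_matMap ((IsTMotive Fq).ι.map (e k))
  let γ' : Fin (n + 1) × Fin ρ.rank → Kt Fq := γ
  have hγ' : (untwist Fq ∘ γ') ᵥ* (ρ.prolGL n).val = γ' + ∑ k,
      (fun z => if z.1 = Fin.last n then algebraMap (Kbar Fq)[X] (Kt Fq)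
        (Polynomial.C (α k)) * E k ρ.zeroIdx z.2 else 0 :
        Fin (n + 1) × Fin ρ.rank → Kt Fq) := by
    refine ((sigmaS_smul (ρ.prolGL n) γ).symm.trans hγ).trans ?_
    refine congrArg (fun z : ρ.prol n => γ + z) (Finset.sum_congr rfl fun k _ => ?_)
    rw [hEe k]
    exact ρ.prolEnd_unitRow n (α k) (E k) (hE k)
  have hzero : ∀ b : Fin (n + 1), b ≠ Fin.last n → ∀ i, γ' (b, i) = 0 := by
    intro b
    induction b using WellFoundedLT.induction with
    | ind b ih =>
      intro hb
      have hlt : ∀ a < b, ∀ i, γ' (a, i) = 0 := fun a ha =>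
        ih a ha (ha.trans_le (Fin.le_last b)).ne
      have h1 : (fun i => γ' (b, i)) = 0 := by
        refine ρ.eq_zero_of_untwist_vecMul_eq ?_
        funext j
        rw [← ρ.sigma_prol_apply hlt j, hγ']
        simp [hb]
      exact fun i => congrFun h1 i
  refine ⟨E, fun i => γ' (Fin.last n, i), hE, ?_, fun k hk => ?_⟩
  · funext j
    rw [← ρ.sigma_prol_apply (fun a ha => hzero a ha.ne) j, hγ']
    simp
  · have h2 : (IsTMotive Fq).ι.map (e k) = 0 := by
      rw [hEe k]
      ext v
      refine (congrArg (Matrix.vecMul (v : Fin ρ.rank → Kt Fq)) hk).trans ?_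
      exact Matrix.vecMul_zero _
    exact (IsTMotive Fq).ι.map_injective (h2.trans (Functor.map_zero _ _ _).symm)

/-- Clearing denominators in a `σ`-difference equation over `k̄(t)`. -/
lemma exists_polynomial_relation {w : ℕ} {α : Fin w → Kbar Fq}
    {E : Fin w → Matrix (Fin ρ.rank) (Fin ρ.rank) (Kt Fq)} {x : Fin ρ.rank → Kt Fq}
    (hE : ∀ k, (E k).map (untwist Fq) * ρ.phi.map (algebraMap (Kbar Fq)[X] (Kt Fq)) =
      ρ.phi.map (algebraMap (Kbar Fq)[X] (Kt Fq)) * E k)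
    (hx : (untwist Fq ∘ x) ᵥ* ρ.phi.map (algebraMap (Kbar Fq)[X] (Kt Fq)) = x + fun j =>
        ∑ k, algebraMap (Kbar Fq)[X] (Kt Fq) (Polynomial.C (α k)) * E k ρ.zeroIdx j) :
    ∃ (F : Fin w → Matrix (Fin ρ.rank) (Fin ρ.rank) (Kbar Fq)[X])
      (y : Fin ρ.rank → (Kbar Fq)[X]),
      (∀ k, (F k).map (polyUntwist Fq) * ρ.phi = ρ.phi * F k) ∧
      polySigma ρ.phi y = y + ∑ k, Polynomial.C (α k) • F k ρ.zeroIdx ∧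
      ∀ k, F k = 0 → E k = 0 := by
  set alg := algebraMap (Kbar Fq)[X] (Kt Fq) with halg
  obtain ⟨g, F, hg, hF, hFphi⟩ := ρ.exists_clear_endomorphisms E hE
  set G := g.map (algebraMap Fq (Kbar Fq)) with hG
  have hGun : untwist Fq (alg G) = alg G := by
    rw [halg, untwist_algebraMap, polyUntwist_map]
  have hG0 : G ≠ 0 := (Polynomial.map_ne_zero_iff (algebraMap Fq (Kbar Fq)).injective).2 hg
  have hinj : Function.Injective alg := IsFractionRing.injective _ _
  obtain ⟨g', y, hg', -, hy⟩ := ρ.exists_clear_solution (x := alg G • x)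
    (η := ∑ k, Polynomial.C (α k) • F k ρ.zeroIdx) (by
      have h1 : untwist Fq ∘ (alg G • x) = alg G • (untwist Fq ∘ x) := by
        funext i
        simp only [Function.comp_apply, Pi.smul_apply, smul_eq_mul, map_mul, hGun]
      rw [h1, Matrix.smul_vecMul, hx, smul_add]
      congr 1
      funext j
      rw [Pi.smul_apply, smul_eq_mul, Finset.mul_sum, Function.comp_apply, Finset.sum_apply,
        map_sum]
      refine Finset.sum_congr rfl fun k _ => ?_
      rw [Pi.smul_apply, smul_eq_mul, map_mul, mul_left_comm]
      congr 1
      exact (congrFun (congrFun (hF k) ρ.zeroIdx) j).symm)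
  set G' := g'.map (algebraMap Fq (Kbar Fq)) with hG'
  have hG'0 : G' ≠ 0 := (Polynomial.map_ne_zero_iff (algebraMap Fq (Kbar Fq)).injective).2 hg'
  have hfac : ∀ (c : (Kbar Fq)[X]) (M : Matrix (Fin ρ.rank) (Fin ρ.rank) (Kbar Fq)[X]),
      c ≠ 0 → c • M = 0 → M = 0 := by
    intro c M hc h
    refine Matrix.ext fun i j => ?_
    have h1 := congrFun (congrFun h i) j
    rw [Matrix.smul_apply, smul_eq_mul] at h1
    exact (mul_eq_zero.1 h1).resolve_left hc
  refine ⟨fun k => G' • F k, y, fun k => ?_, ?_, fun k hk => ?_⟩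
  · have h1 : (G' • F k).map (polyUntwist Fq) = G' • (F k).map (polyUntwist Fq) := by
      ext i j : 2
      rw [Matrix.map_apply, Matrix.smul_apply, Matrix.smul_apply, smul_eq_mul, smul_eq_mul,
        map_mul, polyUntwist_map, Matrix.map_apply]
    rw [h1, Matrix.smul_mul, hFphi, Matrix.mul_smul]
  · rw [hy, Finset.smul_sum]
    congr 1
    refine Finset.sum_congr rfl fun k _ => ?_
    rw [smul_comm]
    rfl
  · have hFk : F k = 0 := hfac G' (F k) hG'0 hk
    ext i j : 2
    have h1 := congrFun (congrFun (hF k) i) j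
    rw [hFk, Matrix.map_apply, Matrix.zero_apply, map_zero, Matrix.smul_apply, smul_eq_mul] at h1
    exact (mul_eq_zero.1 h1.symm).resolve_left
      fun h => hG0 (hinj (h.trans (map_zero _).symm))

end DrinfeldModule

lemma polyToPowerSeries_injective (Fq : Type u) [Field Fq] [Fintype Fq] :
    Function.Injective (polyToPowerSeries Fq) := by
  intro p p' h
  exact Polynomial.map_injective _ (algebraMap (Kbar Fq) (CInf Fq)).injective
    (Polynomial.coe_injective _ h)

lemma powerSeriesUntwist_polyToPowerSeries {Fq : Type u} [Field Fq] [Fintype Fq]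
    (p : (Kbar Fq)[X]) : powerSeriesUntwist Fq (polyToPowerSeries Fq p) =
      polyToPowerSeries Fq (polyUntwist Fq p) := by
  induction p using Polynomial.induction_on' with
  | add p p' h h' => rw [map_add, map_add, h, h', map_add, map_add]
  | monomial m a =>
    rw [← Polynomial.C_mul_X_pow_eq_monomial, map_mul, map_mul, map_mul, map_mul, map_pow, map_pow,
      map_pow, map_pow, polyToPowerSeries_X, powerSeriesUntwist_X, polyUntwist_X,
      polyToPowerSeries_X, polyUntwist_C, polyToPowerSeries_C, polyToPowerSeries_C,
      powerSeriesUntwist_C, coe_frobKbar_symm]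

/-- The value of a polynomial at `t = θ`. -/
def evalTheta (Fq : Type u) [Field Fq] [Fintype Fq] : (Kbar Fq)[X] →+* CInf Fq :=
  (algebraMap (Kbar Fq) (CInf Fq)).comp (Polynomial.evalRingHom (thetaBar Fq))

lemma evalTheta_X_sub_C (Fq : Type u) [Field Fq] [Fintype Fq] :
    evalTheta Fq (Polynomial.X - Polynomial.C (thetaBar Fq)) = 0 := by
  simp [evalTheta]

lemma evalTheta_C {Fq : Type u} [Field Fq] [Fintype Fq] (a : Kbar Fq) :
    evalTheta Fq (Polynomial.C a) = a := by
  simp [evalTheta]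

lemma evalAt_polyToPowerSeries {Fq : Type u} [Field Fq] [Fintype Fq] (p : (Kbar Fq)[X])
    (hp : polyToPowerSeries Fq p ∈ restrictedRing Fq ‖theta Fq‖) :
    evalAt ‖theta Fq‖ (theta Fq) le_rfl ⟨polyToPowerSeries Fq p, hp⟩ = evalTheta Fq p := by
  refine (evalAt_coe _ _ le_rfl _ _).trans ?_
  change (p.map (algebraMap (Kbar Fq) (CInf Fq))).eval (theta Fq) = _
  rw [Polynomial.eval_map]
  exact Polynomial.eval₂_at_apply (algebraMap (Kbar Fq) (CInf Fq)) (thetaBar Fq)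

namespace DrinfeldModule

variable {Fq : Type u} [Field Fq] [Fintype Fq] (ρ : DrinfeldModule Fq)

lemma evalTheta_phi_zeroIdx (i : Fin ρ.rank) : evalTheta Fq (ρ.phi i ρ.zeroIdx) = 0 := by
  rw [phi]
  split_ifs with h1 h2
  · simp [zeroIdx] at h2
  · exact map_zero _
  · rw [map_mul, evalTheta_X_sub_C, zero_mul]
  · rename_i h
    exact absurd rfl h

/-- The first column of an endomorphism is divisible by `t - θ` away from the diagonal. -/
lemma evalTheta_endomorphism {F : Matrix (Fin ρ.rank) (Fin ρ.rank) (Kbar Fq)[X]}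
    (hF : F.map (polyUntwist Fq) * ρ.phi = ρ.phi * F) {j : Fin ρ.rank} (hj : j ≠ ρ.zeroIdx) :
    evalTheta Fq (F j ρ.zeroIdx) = 0 := by
  have hj0 : (j : ℕ) ≠ 0 := fun h => hj (Fin.ext h)
  have hj1 : (j : ℕ) - 1 + 1 = j := by omega
  let i : Fin ρ.rank := ⟨j - 1, by omega⟩
  have h1 := congrArg (evalTheta Fq) (congrFun (congrFun hF i) ρ.zeroIdx)
  rw [Matrix.mul_apply, Matrix.mul_apply, map_sum, Finset.sum_eq_zero fun l _ => by
    rw [map_mul, evalTheta_phi_zeroIdx, mul_zero]] at h1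
  rw [Finset.sum_eq_single j] at h1
  · have h2 : ρ.phi i j = 1 := by
      rw [phi, if_pos (by simp only [i]; omega), if_pos hj1.symm]
    rw [h2, one_mul] at h1
    exact h1.symm
  · intro l _ hl
    have h2 : ρ.phi i l = 0 := by
      rw [phi, if_pos (by simp only [i]; omega), if_neg]
      intro h
      exact hl (Fin.ext (h.trans hj1))
    rw [h2, zero_mul]
  · simp

/-- A row over the Tate algebra with `ζ^{(-1)} Φ_ρ = ζ` is a combination of the rows of the period
matrix with coefficients in `F_q[t]`. -/
lemma exists_eq_sum_of_twist_eq {ω : Fin ρ.rank → CInf Fq} (hω : ρ.IsPeriodBasis ω)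
    {ζ : Fin ρ.rank → (CInf Fq)⟦X⟧} (hζ : ∀ j, ζ j ∈ tate Fq)
    (h : (powerSeriesUntwist Fq ∘ ζ) ᵥ* ρ.phi.map (polyToPowerSeries Fq) = ζ) :
    ∃ g : Fin ρ.rank → Fq[X], ∀ j, ζ j = ∑ i, fqToPowerSeries Fq (g i) * ρ.srow (ω i) j := by
  obtain ⟨U, hU⟩ := (Matrix.isUnit_iff_isUnit_det _).2 (ρ.isUnit_det_periodMatrix hω)
  let z : Fin ρ.rank → tate Fq := fun j => ⟨ζ j, hζ j⟩
  have hz : (tateUntwist Fq ∘ z) ᵥ* ρ.phi.map (polyToTate Fq) = z := by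
    funext j
    apply Subtype.ext
    have h1 := congrFun h j
    refine Eq.trans ?_ h1
    exact RingHom.map_vecMul (tate Fq).subtype (ρ.phi.map (polyToTate Fq)) (tateUntwist Fq ∘ z) j
  set δ := z ᵥ* U⁻¹.val with hδ
  have hδz : δ ᵥ* U.val = z := by
    rw [hδ, Matrix.vecMul_vecMul, Units.inv_mul, Matrix.vecMul_one]
  have hS := ρ.periodMatrix_twist hω
  rw [← hU] at hS
  have hfix : tateUntwist Fq ∘ δ = δ := by
    have h1 : (tateUntwist Fq ∘ δ) ᵥ* U.val.map (tateUntwist Fq) = tateUntwist Fq ∘ z := by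
      rw [← hδz]
      funext j
      exact (RingHom.map_vecMul (tateUntwist Fq) U.val δ j).symm
    have h2 : (tateUntwist Fq ∘ δ) ᵥ* U.val = δ ᵥ* U.val := by
      rw [hδz, ← hz, ← h1, Matrix.vecMul_vecMul, hS]
    have h3 := congrArg (· ᵥ* U⁻¹.val) h2
    simpa only [Matrix.vecMul_vecMul, Units.mul_inv, Matrix.vecMul_one] using h3
  choose g hg using fun i => exists_fqToPowerSeries_eq (δ i).2
    (congrArg Subtype.val (congrFun hfix i))
  refine ⟨g, fun j => ?_⟩
  have h1 := congrArg Subtype.val (congrFun hδz j)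
  refine h1.symm.trans ?_
  rw [Matrix.vecMul, dotProduct, AddSubmonoidClass.coe_finsetSum]
  refine Finset.sum_congr rfl fun i _ => ?_
  rw [Subring.coe_mul, hg, hU]
  rfl

/-- The solution over the Tate algebra attached to a polynomial solution of the
`σ`-difference equation, and its value at `t = θ`. -/
lemma exists_period_relation {ω : Fin ρ.rank → CInf Fq} (hω : ρ.IsPeriodBasis ω) {w : ℕ}
    {u : Fin w → CInf Fq} {α : Fin w → Kbar Fq} (hu : ∀ k, ρ.Exp (u k) = α k)
    {F : Fin w → Matrix (Fin ρ.rank) (Fin ρ.rank) (Kbar Fq)[X]} {y : Fin ρ.rank → (Kbar Fq)[X]}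
    (hF : ∀ k, (F k).map (polyUntwist Fq) * ρ.phi = ρ.phi * F k)
    (hy : polySigma ρ.phi y = y + ∑ k, Polynomial.C (α k) • F k ρ.zeroIdx) :
    ∃ g : Fin ρ.rank → Fq[X],
      (∀ j, polyToPowerSeries Fq (y j) +
        ∑ k, (ρ.srow (u k) ᵥ* (F k).map (polyToPowerSeries Fq)) j =
          ∑ i, fqToPowerSeries Fq (g i) * ρ.srow (ω i) j) ∧
      ∑ k, evalTheta Fq (F k ρ.zeroIdx ρ.zeroIdx) * u k =
        ∑ i, Polynomial.aeval (theta Fq) (g i) * ω i := by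
  set ι := polyToPowerSeries Fq with hι
  set Φ := ρ.phi.map ι with hΦ
  have hcomm : ∀ (x : Fin ρ.rank → (CInf Fq)⟦X⟧) k,
      (powerSeriesUntwist Fq ∘ (x ᵥ* (F k).map ι)) ᵥ* Φ =
        ((powerSeriesUntwist Fq ∘ x) ᵥ* Φ) ᵥ* (F k).map ι := by
    intro x k
    have h1 : powerSeriesUntwist Fq ∘ (x ᵥ* (F k).map ι) =
        (powerSeriesUntwist Fq ∘ x) ᵥ* ((F k).map (polyUntwist Fq)).map ι := by
      funext j
      refine (RingHom.map_vecMul _ _ _ j).trans ?_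
      refine congrArg (fun M => ((powerSeriesUntwist Fq ∘ x) ᵥ* M) j)
        (Matrix.ext fun a b => ?_)
      exact powerSeriesUntwist_polyToPowerSeries _
    rw [h1, Matrix.vecMul_vecMul, Matrix.vecMul_vecMul, ← Matrix.map_mul, ← Matrix.map_mul, hF]
  have hy' : (powerSeriesUntwist Fq ∘ (ι ∘ y)) ᵥ* Φ =
      ι ∘ y + ∑ k, PowerSeries.C (α k : CInf Fq) • (ι ∘ F k ρ.zeroIdx) := by
    have h1 : powerSeriesUntwist Fq ∘ (ι ∘ y) = ι ∘ (polyUntwist Fq ∘ y) := by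
      funext j
      exact powerSeriesUntwist_polyToPowerSeries _
    rw [h1]
    funext j
    refine (RingHom.map_vecMul ι ρ.phi (polyUntwist Fq ∘ y) j).symm.trans ?_
    refine (congrArg ι (congrFun hy j)).trans ?_
    rw [Pi.add_apply, map_add, Finset.sum_apply, map_sum, Pi.add_apply, Finset.sum_apply]
    congr 1
    refine Finset.sum_congr rfl fun k _ => ?_
    rw [Pi.smul_apply, smul_eq_mul, map_mul, hι, polyToPowerSeries_C]
    rfl
  have hs : ∀ k, (powerSeriesUntwist Fq ∘ (ρ.srow (u k) ᵥ* (F k).map ι)) ᵥ* Φ =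
      ρ.srow (u k) ᵥ* (F k).map ι - PowerSeries.C (α k : CInf Fq) • (ι ∘ F k ρ.zeroIdx) := by
    intro k
    rw [hcomm, ρ.srow_twist, Matrix.sub_vecMul, hu]
    congr 1
    funext j
    rw [Matrix.vecMul, dotProduct, Finset.sum_eq_single ρ.zeroIdx]
    · rw [if_pos (by rfl)]
      rfl
    · intro l _ hl
      have hl0 : ¬ (l : ℕ) = 0 := fun h => hl (Fin.ext h)
      rw [if_neg hl0, zero_mul]
    · simp
  set ζ := ι ∘ y + ∑ k, ρ.srow (u k) ᵥ* (F k).map ι with hζ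
  have hζtw : (powerSeriesUntwist Fq ∘ ζ) ᵥ* Φ = ζ := by
    have h1 : powerSeriesUntwist Fq ∘ ζ = powerSeriesUntwist Fq ∘ (ι ∘ y) +
        ∑ k, powerSeriesUntwist Fq ∘ (ρ.srow (u k) ᵥ* (F k).map ι) := by
      funext j
      rw [hζ]
      simp only [Function.comp_apply, Pi.add_apply, Finset.sum_apply, map_add, map_sum]
    rw [h1, Matrix.add_vecMul, Matrix.sum_vecMul, hy', Finset.sum_congr rfl fun k _ => hs k,
      Finset.sum_sub_distrib, hζ]
    abel
  have hζmem : ∀ j, ζ j ∈ tate Fq := by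
    intro j
    rw [hζ, Pi.add_apply, Finset.sum_apply]
    refine add_mem (polyToPowerSeries_mem 1 _) (sum_mem fun k _ => ?_)
    rw [Matrix.vecMul, dotProduct]
    refine sum_mem fun l _ => ?_
    exact mul_mem (ρ.srow_mem_tate _ _) (polyToPowerSeries_mem 1 _)
  obtain ⟨g, hg⟩ := ρ.exists_eq_sum_of_twist_eq hω hζmem hζtw
  have hg' : ∀ j, ι (y j) + ∑ k, (ρ.srow (u k) ᵥ* (F k).map ι) j =
      ∑ i, fqToPowerSeries Fq (g i) * ρ.srow (ω i) j := by
    intro j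
    rw [← hg j, hζ, Pi.add_apply, Finset.sum_apply]
    rfl
  refine ⟨g, hg', ?_⟩
  set R := restrictedRing Fq ‖theta Fq‖ with hR
  set ev := evalAt ‖theta Fq‖ (theta Fq) le_rfl with hev
  let pR : (Kbar Fq)[X] → R := fun p => ⟨ι p, polyToPowerSeries_mem _ p⟩
  let sR : CInf Fq → Fin ρ.rank → R := fun v j => ⟨ρ.srow v j, ρ.srow_mem_restrictedRing v j⟩
  let gR : Fq[X] → R := fun p => ⟨fqToPowerSeries Fq p, fqToPowerSeries_mem _ p⟩
  have h1 : pR (y ρ.zeroIdx) + ∑ k, ∑ l, sR (u k) l * pR (F k l ρ.zeroIdx) =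
      ∑ i, gR (g i) * sR (ω i) ρ.zeroIdx := by
    apply Subtype.ext
    rw [Subring.coe_add, AddSubmonoidClass.coe_finsetSum, AddSubmonoidClass.coe_finsetSum]
    refine Eq.trans ?_ (hg' ρ.zeroIdx)
    congr 1
    refine Finset.sum_congr rfl fun k _ => ?_
    rw [AddSubmonoidClass.coe_finsetSum]
    rfl
  have hevs : ∀ v, ev (sR v ρ.zeroIdx) = ρ.Exp v - v := fun v => ρ.evalAt_theta_srow v
  have hevp : ∀ p, ev (pR p) = evalTheta Fq p := fun p => evalAt_polyToPowerSeries p _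
  have hevg : ∀ p, ev (gR p) = Polynomial.aeval (theta Fq) p := fun p =>
    evalAt_fqToPowerSeries _ _ _ p
  have h2 := congrArg ev h1
  have hy0 : evalTheta Fq (y ρ.zeroIdx) =
      - ∑ k, (α k : CInf Fq) * evalTheta Fq (F k ρ.zeroIdx ρ.zeroIdx) := by
    have h3 := congrArg (evalTheta Fq) (congrFun hy ρ.zeroIdx)
    rw [polySigma, Matrix.vecMul, dotProduct, map_sum, Finset.sum_eq_zero fun l _ => by
      rw [map_mul, evalTheta_phi_zeroIdx, mul_zero], Pi.add_apply, map_add, Finset.sum_apply,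
      map_sum] at h3
    rw [eq_neg_iff_add_eq_zero, h3]
    congr 1
    refine Finset.sum_congr rfl fun k _ => ?_
    rw [Pi.smul_apply, smul_eq_mul, map_mul, evalTheta_C]
  have h4 : ∀ k, ∑ l, ev (sR (u k) l) * evalTheta Fq (F k l ρ.zeroIdx) =
      (α k - u k) * evalTheta Fq (F k ρ.zeroIdx ρ.zeroIdx) := by
    intro k
    rw [Finset.sum_eq_single ρ.zeroIdx, hevs, hu]
    · intro l _ hl
      rw [ρ.evalTheta_endomorphism (hF k) hl, mul_zero]
    · simp
  have h5 : ∀ i, ev (sR (ω i) ρ.zeroIdx) = - ω i := by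
    intro i
    have : ρ.Exp (ω i) = 0 := hω.mem_lattice i
    rw [hevs, this, zero_sub]
  simp only [map_add, map_sum, map_mul, hevp, hevg, h4, h5, hy0] at h2
  simp only [mul_neg, Finset.sum_neg_distrib, sub_mul, Finset.sum_sub_distrib] at h2
  rw [← neg_inj, ← h2, Finset.sum_congr rfl fun k _ =>
    mul_comm (evalTheta Fq (F k ρ.zeroIdx ρ.zeroIdx)) (u k)]
  ring

end DrinfeldModule

namespace DrinfeldModule

variable {Fq : Type u} [Field Fq] [Fintype Fq] (ρ : DrinfeldModule Fq)

lemma exists_period_relation_of_mem_lattice {ω : Fin ρ.rank → CInf Fq} (hω : ρ.IsPeriodBasis ω)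
    {F : Matrix (Fin ρ.rank) (Fin ρ.rank) (Kbar Fq)[X]}
    (hF : F.map (polyUntwist Fq) * ρ.phi = ρ.phi * F) {z : CInf Fq} (hz : z ∈ ρ.lattice) :
    ∃ g : Fin ρ.rank → Fq[X],
      (∀ j, (ρ.srow z ᵥ* F.map (polyToPowerSeries Fq)) j =
          ∑ i, fqToPowerSeries Fq (g i) * ρ.srow (ω i) j) ∧
      evalTheta Fq (F ρ.zeroIdx ρ.zeroIdx) * z =
        ∑ i, Polynomial.aeval (theta Fq) (g i) * ω i := by
  have h0 : polySigma ρ.phi 0 = 0 := by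
    have h1 : polyUntwist Fq ∘ (0 : Fin ρ.rank → (Kbar Fq)[X]) = 0 := by
      funext i
      simp
    rw [polySigma, h1, Matrix.zero_vecMul]
  obtain ⟨g, h1, h2⟩ := ρ.exists_period_relation hω (w := 1) (u := fun _ => z) (α := fun _ => 0)
    (F := fun _ => F) (y := 0) (fun _ => hz) (fun _ => hF) (by simp [h0])
  refine ⟨g, fun j => ?_, ?_⟩
  · have := h1 j
    rwa [Pi.zero_apply, map_zero, zero_add, Fin.sum_univ_one] at this
  · rwa [Fin.sum_univ_one] at h2

/-- Endomorphisms of `M_ρ` act on the period lattice. -/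
lemma evalTheta_mem_endSet {ω : Fin ρ.rank → CInf Fq} (hω : ρ.IsPeriodBasis ω)
    {F : Matrix (Fin ρ.rank) (Fin ρ.rank) (Kbar Fq)[X]}
    (hF : F.map (polyUntwist Fq) * ρ.phi = ρ.phi * F) :
    evalTheta Fq (F ρ.zeroIdx ρ.zeroIdx) ∈ ρ.endSet := by
  intro z hz
  obtain ⟨g, -, h⟩ := ρ.exists_period_relation_of_mem_lattice hω hF hz
  rw [h]
  exact hω.sum_mem_lattice g

lemma eq_zero_of_evalTheta_eq_zero {ω : Fin ρ.rank → CInf Fq} (hω : ρ.IsPeriodBasis ω)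
    {F : Matrix (Fin ρ.rank) (Fin ρ.rank) (Kbar Fq)[X]}
    (hF : F.map (polyUntwist Fq) * ρ.phi = ρ.phi * F)
    (h0 : evalTheta Fq (F ρ.zeroIdx ρ.zeroIdx) = 0) : F = 0 := by
  have h1 : ∀ k j, (ρ.srow (ω k) ᵥ* F.map (polyToPowerSeries Fq)) j = 0 := by
    intro k j
    obtain ⟨g, hg, h⟩ := ρ.exists_period_relation_of_mem_lattice hω hF (hω.mem_lattice k)
    rw [h0, zero_mul] at h
    rw [hg]
    refine Finset.sum_eq_zero fun i _ => ?_
    rw [hω.eq_zero_of_sum_eq_zero h.symm i, map_zero, zero_mul]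
  obtain ⟨U, hU⟩ := (Matrix.isUnit_iff_isUnit_det _).2 (ρ.isUnit_det_periodMatrix hω)
  have h2 : U.val * F.map (polyToTate Fq) = 0 := by
    refine Matrix.ext fun k j => Subtype.ext ?_
    rw [hU, Matrix.mul_apply, AddSubmonoidClass.coe_finsetSum]
    exact h1 k j
  have h3 : F.map (polyToTate Fq) = 0 := by
    rw [← Matrix.one_mul (F.map (polyToTate Fq)), ← Units.inv_mul U, Matrix.mul_assoc, h2,
      Matrix.mul_zero]
  refine Matrix.ext fun i j => polyToPowerSeries_injective Fq ?_
  rw [Matrix.zero_apply, map_zero]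
  exact congrArg Subtype.val (congrFun (congrFun h3 i) j)

end DrinfeldModule

section Dimension

variable {Fq : Type u} [Field Fq] [Fintype Fq]

lemma aeval_theta_mem_ratField (g : Fq[X]) : Polynomial.aeval (theta Fq) g ∈ ratField Fq :=
  IntermediateField.algebra_adjoin_le_adjoin _ _ (by
    rw [Algebra.adjoin_singleton_eq_range_aeval]
    exact ⟨g, rfl⟩)

/-- The elements of a field which stabilize a finite-dimensional subspace form a field. -/
def stabilizerField {k L : Type u} [Field k] [Field L] [Algebra k L] (V : Submodule k L)
    [FiniteDimensional k V] : IntermediateField k L :=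
  Subalgebra.toIntermediateField
    { carrier := {c | ∀ z ∈ V, c * z ∈ V}
      mul_mem' := fun {a b} ha hb z hz => by
        rw [mul_assoc]
        exact ha _ (hb z hz)
      add_mem' := fun {a b} ha hb z hz => by
        rw [add_mul]
        exact add_mem (ha z hz) (hb z hz)
      algebraMap_mem' := fun a z hz => by
        rw [← Algebra.smul_def]
        exact V.smul_mem a hz }
    (by
      intro c hc z hz
      by_cases h0 : c = 0
      · rw [h0, inv_zero, zero_mul]
        exact zero_mem V
      let m : V →ₗ[k] V := (LinearMap.mulLeft k c).restrict hc
      have hinj : Function.Injective m := fun a b h =>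
        Subtype.ext (mul_left_cancel₀ h0 (congrArg Subtype.val h))
      obtain ⟨y, hy⟩ := (LinearMap.injective_iff_surjective.1 hinj) ⟨z, hz⟩
      have hy' : c * (y : L) = z := congrArg Subtype.val hy
      rw [← hy', inv_mul_cancel_left₀ h0]
      exact y.2)

end Dimension

namespace DrinfeldModule

variable {Fq : Type u} [Field Fq] [Fintype Fq] (ρ : DrinfeldModule Fq)

/-- The `k`-span of the periods. -/
abbrev periodSpan (ω : Fin ρ.rank → CInf Fq) : Submodule (ratField Fq) (CInf Fq) :=
  Submodule.span (ratField Fq) (Set.range ω)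

instance (ω : Fin ρ.rank → CInf Fq) : FiniteDimensional (ratField Fq) (ρ.periodSpan ω) :=
  FiniteDimensional.span_of_finite _ (Set.finite_range ω)

lemma sum_aeval_mem_periodSpan (ω : Fin ρ.rank → CInf Fq) (g : Fin ρ.rank → Fq[X]) :
    ∑ i, Polynomial.aeval (theta Fq) (g i) * ω i ∈ ρ.periodSpan ω :=
  sum_mem fun i _ => (ρ.periodSpan ω).smul_mem (⟨_, aeval_theta_mem_ratField (g i)⟩ : ratField Fq)
    (Submodule.subset_span ⟨i, rfl⟩)

lemma endField_le_stabilizerField {ω : Fin ρ.rank → CInf Fq} (hω : ρ.IsPeriodBasis ω) :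
    ρ.endField ≤ stabilizerField (ρ.periodSpan ω) := by
  rw [IntermediateField.adjoin_le_iff]
  intro c hc z hz
  induction hz using Submodule.span_induction with
  | mem z hz =>
    obtain ⟨i, rfl⟩ := hz
    obtain ⟨g, hg⟩ := hω.exists_eq_sum (hc _ (hω.mem_lattice i))
    rw [hg]
    exact ρ.sum_aeval_mem_periodSpan ω g
  | zero => rw [mul_zero]; exact zero_mem _
  | add x y _ _ hx hy => rw [mul_add]; exact add_mem hx hy
  | smul a x _ hx =>
    rw [mul_smul_comm]
    exact Submodule.smul_mem _ _ hx

/-- The `k`-span of the periods as a vector space over `K_ρ`. -/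
def periodSpace {ω : Fin ρ.rank → CInf Fq} (hω : ρ.IsPeriodBasis ω) :
    Submodule ρ.endField (CInf Fq) where
  carrier := ρ.periodSpan ω
  add_mem' := add_mem
  zero_mem' := zero_mem _
  smul_mem' c z hz := ρ.endField_le_stabilizerField hω c.2 z hz

lemma finiteDimensional_endField {ω : Fin ρ.rank → CInf Fq} (hω : ρ.IsPeriodBasis ω) :
    FiniteDimensional (ratField Fq) ρ.endField := by
  have h0 : ω ρ.zeroIdx ≠ 0 := hω.1.ne_zero _
  let f : ρ.endField →ₗ[ratField Fq] ρ.periodSpan ω :=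
    { toFun := fun c => ⟨c * ω ρ.zeroIdx, ρ.endField_le_stabilizerField hω c.2 _
        (Submodule.subset_span ⟨_, rfl⟩)⟩
      map_add' := fun a b => Subtype.ext (add_mul _ _ _)
      map_smul' := fun a b => Subtype.ext (smul_mul_assoc a (b : CInf Fq) _) }
  refine FiniteDimensional.of_injective f fun a b h => Subtype.ext ?_
  exact mul_right_cancel₀ h0 (congrArg Subtype.val h)

lemma finrank_periodSpace_le {ω : Fin ρ.rank → CInf Fq} (hω : ρ.IsPeriodBasis ω) :
    Module.finrank (ratField Fq) ρ.endField * Module.finrank ρ.endField (ρ.periodSpace hω) ≤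
      ρ.rank := by
  have h1 := Module.finrank_mul_finrank (ratField Fq) ρ.endField (ρ.periodSpace hω)
  rw [h1]
  have h2 : Module.finrank (ratField Fq) (ρ.periodSpace hω) =
      Module.finrank (ratField Fq) (ρ.periodSpan ω) := by
    refine LinearEquiv.finrank_eq
      { toFun := fun x => (⟨x.1, x.2⟩ : ρ.periodSpan ω)
        invFun := fun x => ⟨x.1, x.2⟩
        map_add' := fun a b => rfl
        map_smul' := fun a b => rfl
        left_inv := fun a => rfl
        right_inv := fun a => rfl }
  rw [h2]
  exact (finrank_range_le_card ω).trans (Fintype.card_fin _).le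

/-- A non-trivial relation between the logarithms makes the dimension drop. -/
lemma finrank_span_lt {ω : Fin ρ.rank → CInf Fq} (hω : ρ.IsPeriodBasis ω) {w : ℕ}
    {u c : Fin w → CInf Fq} (hc : ∀ i, c i ∈ ρ.endSet) {i₀ : Fin w} (hi₀ : c i₀ ≠ 0)
    {g : Fin ρ.rank → Fq[X]}
    (h : ∑ i, c i * u i = ∑ i, Polynomial.aeval (theta Fq) (g i) * ω i) :
    (Module.finrank ρ.endField
        (Submodule.span ρ.endField (Set.range ω ∪ Set.range u)) : ℚ) <
      (ρ.rank : ℚ) / (Module.finrank (ratField Fq) ρ.endField : ℚ) + (w : ℚ) := by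
  have hfin := ρ.finiteDimensional_endField hω
  classical
  set W := ρ.periodSpace hω with hW
  set T : Submodule ρ.endField (CInf Fq) :=
    Submodule.span ρ.endField (((Finset.univ.erase i₀).image u : Finset (CInf Fq)) : Set (CInf Fq)) with hT
  have hWfin : FiniteDimensional ρ.endField W := by
    have : W ≤ Submodule.span ρ.endField (Set.range ω) := by
      intro z hz
      have hz' : z ∈ ρ.periodSpan ω := hz
      exact Submodule.span_le_restrictScalars (ratField Fq) ρ.endField _ hz'
    have : FiniteDimensional ρ.endField (Submodule.span ρ.endField (Set.range ω)) :=
      FiniteDimensional.span_of_finite ρ.endField (Set.finite_range ω)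
    exact Submodule.finiteDimensional_of_le ‹W ≤ _›
  have hmemT : ∀ i, i ≠ i₀ → u i ∈ T := fun i hi => Submodule.subset_span (by
    rw [Finset.mem_coe, Finset.mem_image]
    exact ⟨i, Finset.mem_erase.2 ⟨hi, Finset.mem_univ i⟩, rfl⟩)
  let cK : Fin w → ρ.endField := fun i => ⟨c i, IntermediateField.subset_adjoin _ _ (hc i)⟩
  have hi₀' : cK i₀ ≠ 0 := fun h => hi₀ (congrArg Subtype.val h)
  have hui₀ : u i₀ ∈ W ⊔ T := by
    have h1 : cK i₀ • u i₀ = ∑ i, Polynomial.aeval (theta Fq) (g i) * ω i -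
        ∑ i ∈ Finset.univ.erase i₀, cK i • u i := by
      rw [← h, ← Finset.add_sum_erase _ _ (Finset.mem_univ i₀)]
      exact (add_sub_cancel_right _ _).symm
    have h2 : cK i₀ • u i₀ ∈ W ⊔ T := by
      rw [h1]
      refine sub_mem (Submodule.mem_sup_left (ρ.sum_aeval_mem_periodSpan ω g))
        (Submodule.mem_sup_right (sum_mem fun i hi => T.smul_mem _ (hmemT i ?_)))
      exact (Finset.mem_erase.1 hi).1
    rw [← inv_smul_smul₀ hi₀' (u i₀)]
    exact (W ⊔ T).smul_mem _ h2
  have hle : Submodule.span ρ.endField (Set.range ω ∪ Set.range u) ≤ W ⊔ T := by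
    rw [Submodule.span_le]
    rintro _ (⟨i, rfl⟩ | ⟨i, rfl⟩)
    · exact Submodule.mem_sup_left (show ω i ∈ ρ.periodSpan ω from
        Submodule.subset_span ⟨i, rfl⟩)
    · by_cases hi : i = i₀
      · rw [hi]
        exact hui₀
      · exact Submodule.mem_sup_right (hmemT i hi)
  have hTfin : FiniteDimensional ρ.endField T := FiniteDimensional.span_finset ρ.endField _
  have hTle : Module.finrank ρ.endField T ≤ w - 1 := by
    refine (finrank_span_finset_le_card _).trans (Finset.card_image_le.trans ?_)
    rw [Finset.card_erase_of_mem (Finset.mem_univ _), Finset.card_univ, Fintype.card_fin]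
  have hw : 0 < w := i₀.pos
  have h1 : Module.finrank ρ.endField (Submodule.span ρ.endField (Set.range ω ∪ Set.range u)) + 1 ≤
      Module.finrank ρ.endField W + w := by
    have h2 := Submodule.finrank_mono hle
    have h3 := Submodule.finrank_add_le_finrank_add_finrank W T
    omega
  have hs : 0 < Module.finrank (ratField Fq) ρ.endField := Module.finrank_pos
  have h2 : (Module.finrank ρ.endField W : ℚ) ≤ (ρ.rank : ℚ) / (Module.finrank (ratField Fq) ρ.endField : ℚ) := by
    rw [le_div_iff₀ (by exact_mod_cast hs), mul_comm]
    exact_mod_cast ρ.finrank_periodSpace_le hω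
  have h3 : (Module.finrank ρ.endField (Submodule.span ρ.endField (Set.range ω ∪ Set.range u)) : ℚ) + 1 ≤
      (Module.finrank ρ.endField W : ℚ) + w := by exact_mod_cast h1
  linarith

end DrinfeldModule

end DrinfeldProlongation

end

open CategoryTheory DrinfeldProlongation
theorem theoremT {Fq : Type*} [Field Fq] [Fintype Fq]
    (ρ : DrinfeldModule Fq)
    (ω : Fin ρ.rank → CInf Fq) (hω : ρ.IsPeriodBasis ω)
    (w : ℕ) (u : Fin w → CInf Fq)
    (α : Fin w → Kbar Fq)
    (hα : ∀ i, (α i : CInf Fq) ∈ Ksep Fq)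
    (hu : ∀ i, ρ.Exp (u i) = α i)
    (hdim : (Module.finrank ρ.endField
        (Submodule.span ρ.endField (Set.range ω ∪ Set.range u)) : ℚ) =
      (ρ.rank : ℚ) / (Module.finrank (ratField Fq) ρ.endField : ℚ) + (w : ℚ))
    (n : ℕ) (hn : 1 ≤ n) :
    ∃ (hM : IsTMotive Fq ρ.motive)
      (hP : IsTMotive Fq (ρ.prol n))
      (hY : ∀ i, IsTMotive Fq (ρ.extObj n (α i))),
      ∀ e : Fin w → End (⟨ρ.motive, hM⟩ : TMot Fq),
        (∃ i, e i ≠ 0) →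
          ∑ i, ρ.pushClass n (α i) hP (hY i) hM (e i) ≠ 0 := by
  refine ⟨ρ.isTMotive_motive hω, ρ.isTMotive_prol hω n, fun i => ρ.isTMotive_ext hω n (α i), ?_⟩
  rintro e ⟨i₀, hi₀⟩ h0
  obtain ⟨E, x, hE, hx, hEe⟩ := ρ.exists_rational_relation i₀ _ _ _ e h0
  obtain ⟨F, y, hF, hy, hFE⟩ := ρ.exists_polynomial_relation hE hx
  obtain ⟨g, -, hg⟩ := ρ.exists_period_relation hω hu hF hy
  refine (ρ.finrank_span_lt hω (fun i => ρ.evalTheta_mem_endSet hω (hF i)) (i₀ := i₀) ?_ hg).ne hdim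
  intro h
  exact hi₀ (hEe i₀ (hFE i₀ (ρ.eq_zero_of_evalTheta_eq_zero hω (hF i₀) h)))
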